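/- Let $\Sigma$ be a finite alphabet with at least two symbols, one of which is designated as $\mathtt 1$, and let $\mathcal B$ be the set of all functions $\varphi\colon\Sigma^*\to\Sigma^*$. The \emph{size} of $\varphi\in\mathcal B$ is $|\varphi|(n)=\max\{|\varphi(\mathbf a)| : |\mathbf a|\le n\}$, and $\varphi$ is \emph{length-monotone} if $|\mathbf a|\le|\mathbf b|$ implies $|\varphi(\mathbf a)|\le|\varphi(\mathbf b)|$. \emph{Second-order polynomials} form the smallest class of functions $\mathbb N^{\mathbb N}\times\mathbb N\to\mathbb N$ that contains $(l,n)\mapsto p(n)$ for all $p\in\mathbb N[X]$ and is closed under pointwise sums, pointwise products and $P\mapsto\big((l,n)\mapsto l(P(l,n))\big)$. An oracle Turing machine $M^?$ with oracle $\varphi\in\mathcal B$ replaces, in one step and without moving its heads, the content of its answer tape by the value of $\varphi$ on the content of its query tape; it computes the partial operator on $\mathcal B$ that sends each $\varphi$ with which $M$ halts on all inputs to the function $M^\varphi$, and $\mathrm{Time}_M(\varphi,\mathbf a)$ is its number of steps on input $\mathbf a$. A \emph{preparametrised space} $(X,\xi,\mu)$ is a set $X$ with a partial surjection $\xi\colon\subseteq\mathcal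 B\to X$ (the representation) and a map $\mu\colon\mathrm{dom}(\xi)\to\mathbb N^{\mathbb N}$ (the parameter) all of whose values are non-decreasing functions. A function $f\colon X\to Y$ between preparametrised spaces $(X,\xi_X,\mu_X)$ and $(Y,\xi_Y,\mu_Y)$ is \emph{polytime computable} if there are an oracle machine $M^?$ and second-order polynomials $P,Q$ such that for all $\varphi\in\mathrm{dom}(\xi_X)$: $M^\varphi$ is total and $\xi_Y(M^\varphi)=f(\xi_X(\varphi))$; $\mathrm{Time}_M(\varphi,\mathbf a)\le P(\mu_X(\varphi),|\mathbf a|)$ for all strings $\mathbf a$; and $\mu_Y(M^\varphi)(n)\le Q(\mu_X(\varphi),n)$ for all $n$. A \emph{parametrised space} is a preparametrised space whose identity function is polytime computable. Two spaces are \emph{polytime isomorphic} if there is a bijection between them that is polytime computable in both directions. A \emph{Kawamura--Cook space} is a parametrised space such that all elements of the domain of its representation are length-monotone and whose parameter is the standard one, $\mu(\varphi)=|\varphi|$. Make $\mathbb N^{\mathbb N}$ a parametrised space through the total representation that sends $\varphi$ to $n\mapsto|\varphi(\mathtt 1^n)|$, with the standard parameter. A space $(X,\xi,\mu)$ has a \emph{polytime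 computable parameter} if $\mu\colon\mathrm{dom}(\xi)\to\mathbb N^{\mathbb N}$ is polytime computable, where each element of $\mathrm{dom}(\xi)$ has itself as its only name and $\mu$ is the parameter on $\mathrm{dom}(\xi)$. \textbf{Theorem.} A parametrised space is polytime isomorphic to a Kawamura--Cook space if and only if it is polytime isomorphic to a parametrised space with polytime computable parameter. -/

import Mathlib

universe u

namespace SecondOrder

/-! ### String functions and second-order polynomials -/

/-- Baire space over the alphabet `S`: the total functions from strings to strings. -/
abbrev Baire (S : Type) : Type := List S → List S

/-- The size of a string function: `size φ n = max {|φ(a)| : |a| ≤ n}`. -/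
noncomputable def size {S : Type} (φ : Baire S) (n : ℕ) : ℕ :=
  sSup {k : ℕ | ∃ a : List S, a.length ≤ n ∧ (φ a).length = k}

theorem size_bddAbove {S : Type} [Finite S] (φ : Baire S) (n : ℕ) :
    BddAbove {k : ℕ | ∃ a : List S, a.length ≤ n ∧ (φ a).length = k} :=
  ((List.finite_length_le S n).image fun a => (φ a).length).bddAbove

theorem length_le_size {S : Type} [Finite S] (φ : Baire S) {a : List S} {n : ℕ}
    (h : a.length ≤ n) : (φ a).length ≤ size φ n :=
  le_csSup (size_bddAbove φ n) ⟨a, h, rfl⟩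

theorem size_le {S : Type} (φ : Baire S) {n B : ℕ}
    (h : ∀ a : List S, a.length ≤ n → (φ a).length ≤ B) : size φ n ≤ B := by
  refine csSup_le ⟨_, [], Nat.zero_le n, rfl⟩ ?_
  rintro k ⟨a, ha, rfl⟩
  exact h a ha

theorem size_mono {S : Type} [Finite S] (φ : Baire S) : Monotone (size φ) :=
  fun _ _ hmn => size_le φ fun _ ha => length_le_size φ (ha.trans hmn)

/-- Length-monotone string functions. -/
def IsLengthMonotone {S : Type} (φ : Baire S) : Prop :=
  ∀ a b : List S, a.length ≤ b.length → (φ a).length ≤ (φ b).length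

/-- The class of second-order polynomials, as the smallest class of functions
`ℕ^ℕ × ℕ → ℕ` with the closure properties below. -/
inductive IsSOP : ((ℕ → ℕ) → ℕ → ℕ) → Prop
  | poly (p : Polynomial ℕ) : IsSOP fun _ n => p.eval n
  | app {P : (ℕ → ℕ) → ℕ → ℕ} : IsSOP P → IsSOP fun l n => l (P l n)
  | add {P Q : (ℕ → ℕ) → ℕ → ℕ} : IsSOP P → IsSOP Q → IsSOP fun l n => P l n + Q l n
  | mul {P Q : (ℕ → ℕ) → ℕ → ℕ} : IsSOP P → IsSOP Q → IsSOP fun l n => P l n * Q l n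

/-! ### Oracle Turing machines -/

/-- Tape symbols: letters of the alphabet `S`, auxiliary symbols from `A`, and the blank `none`. -/
abbrev Symb (S A : Type) : Type := Option (S ⊕ A)

/-- The letter of `S` in a cell, if there is one. -/
def Symb.letter {S A : Type} : Symb S A → Option S
  | some (Sum.inl s) => some s
  | _ => none

/-- A two-way infinite tape; the cell `0` is the start cell. -/
abbrev Tape (S A : Type) : Type := ℤ → Symb S A

/-- The tape that holds the string `a` in the cells `0, …, |a| - 1` and is blank elsewhere. -/
def Tape.ofString {S A : Type} (a : List S) : Tape S A := fun z =>
  if 0 ≤ z then (a[z.toNat]?).map Sum.inl else none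

/-- The string on a tape: the longest block of letters of `S` that starts in the cell `0`.
In a computation only finitely many cells are non-blank, so that the block is finite. -/
noncomputable def Tape.content {S A : Type} (T : Tape S A) : List S :=
  (List.range (sInf {n : ℕ | Symb.letter (T n) = none})).filterMap fun n : ℕ => Symb.letter (T n)

/-- The tapes of a machine whose further work tapes are indexed by `W`. -/
inductive TapeIdx (W : Type) : Type
  | input : TapeIdx W
  | output : TapeIdx W
  | query : TapeIdx W
  | answer : TapeIdx W
  | work : W → TapeIdx W

/-- The head movements. -/
inductive Move : Type
  | left : Move
  | stay : Move
  | right : Move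

/-- The displacement of a head. -/
def Move.toInt : Move → ℤ
  | .left => -1
  | .stay => 0
  | .right => 1

/-- Deterministic multi-tape oracle Turing machines over the alphabet `S`, with finitely many
states, work tapes and auxiliary symbols. -/
structure OracleMachine (S : Type) where
  /-- states -/
  Q : Type
  /-- index set of the work tapes -/
  W : Type
  /-- auxiliary tape symbols -/
  A : Type
  finQ : Finite Q
  finW : Finite W
  finA : Finite A
  /-- the initial state -/
  start : Q
  /-- the final state -/
  halt : Q
  /-- the oracle state -/
  oracle : Q
  /-- the state in which the machine continues after an oracle call -/
  resume : Q
  /-- the next state, depending on the state and the scanned symbols -/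
  next : Q → (TapeIdx W → Symb S A) → Q
  /-- the symbol written on each tape -/
  write : Q → (TapeIdx W → Symb S A) → TapeIdx W → Symb S A
  /-- the movement of the head on each tape, after writing -/
  move : Q → (TapeIdx W → Symb S A) → TapeIdx W → Move

namespace OracleMachine

variable {S : Type} (M : OracleMachine S)

/-- Configurations. -/
@[ext]
structure Config where
  /-- the current state -/
  state : M.Q
  /-- the tape inscriptions -/
  tape : TapeIdx M.W → Tape S M.A
  /-- the head positions -/
  head : TapeIdx M.W → ℤ

/-- The initial configuration on the input `a`. -/
def init (a : List S) : M.Config where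
  state := M.start
  tape i := match i with
    | .input => Tape.ofString a
    | _ => fun _ => none
  head _ := 0

open Classical in
/-- One step with oracle `φ`. In the oracle state the content of the answer tape is replaced by
the value of `φ` on the content of the query tape; no head moves. -/
noncomputable def step (φ : Baire S) (c : M.Config) : M.Config :=
  if c.state = M.halt then c
  else if c.state = M.oracle then
    { state := M.resume
      tape := fun i => match i with
        | .answer => Tape.ofString (φ (c.tape .query).content)
        | j => c.tape j
      head := c.head }
  else
    { state := M.next c.state fun i => c.tape i (c.head i)
      tape := fun i => Function.update (c.tape i) (c.head i)
        (M.write c.state (fun j => c.tape j (c.head j)) i)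
      head := fun i => c.head i + (M.move c.state (fun j => c.tape j (c.head j)) i).toInt }

/-- The configuration after `t` steps on the input `a` with oracle `φ`. -/
noncomputable def run (φ : Baire S) (a : List S) (t : ℕ) : M.Config :=
  (M.step φ)^[t] (M.init a)

/-- The number of steps until the machine halts (`⊤` if it does not halt). -/
noncomputable def time (φ : Baire S) (a : List S) : ℕ∞ :=
  sInf {t : ℕ∞ | ∃ n : ℕ, (M.run φ a n).state = M.halt ∧ t = n}

/-- The string on the output tape when the machine halts (meaningful only if it halts). -/
noncomputable def result (φ : Baire S) (a : List S) : List S :=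
  ((M.run φ a (M.time φ a).toNat).tape .output).content

/-- The partial operator on Baire space computed by the machine: its domain consists of the
oracles with which the machine halts on every input. -/
noncomputable def operator : Baire S →. Baire S := fun φ =>
  ⟨∀ a, M.time φ a ≠ ⊤, fun _ => M.result φ⟩

end OracleMachine

/-! ### Parametrised spaces -/

/-- `F` is a realiser of `f` with respect to the representations `ξ` and `υ`. -/
def IsRealiser {S : Type} {X Y : Type u} (ξ : Baire S →. X) (υ : Baire S →. Y) (f : X → Y)
    (F : Baire S →. Baire S) : Prop :=
  ∀ φ, ∀ x ∈ ξ φ, ∃ ψ ∈ F φ, f x ∈ υ ψ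

/-- Preparametrised spaces: a set with a representation (a partial surjection from Baire space)
and a parameter, which assigns a non-decreasing function to each name. -/
structure PreparametrisedSpace (S : Type) : Type (u + 1) where
  /-- the underlying set -/
  carrier : Type u
  /-- the representation -/
  rep : Baire S →. carrier
  rep_surjective : ∀ x : carrier, ∃ φ, x ∈ rep φ
  /-- the parameter -/
  param : rep.Dom → ℕ → ℕ
  param_mono : ∀ φ : rep.Dom, Monotone (param φ)

/-- Polynomial-time computability of a function between preparametrised spaces: some machine
computes a realiser with running time and parameter blowup bounded by second-order polynomials
in the parameter of the input name. -/
def PolytimeComputable {S : Type} (X : PreparametrisedSpace.{u} S)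
    (Y : PreparametrisedSpace.{u} S) (f : X.carrier → Y.carrier) : Prop :=
  ∃ (M : OracleMachine S) (P Q : (ℕ → ℕ) → ℕ → ℕ), IsSOP P ∧ IsSOP Q ∧
    IsRealiser X.rep Y.rep f M.operator ∧
    (∀ (φ : X.rep.Dom) (a : List S), M.time φ a ≤ (P (X.param φ) a.length : ℕ)) ∧
    (∀ (φ : X.rep.Dom) (ψ : Y.rep.Dom), (ψ : Baire S) ∈ M.operator φ →
      ∀ n, Y.param ψ n ≤ Q (X.param φ) n)

namespace PreparametrisedSpace

variable {S : Type}

/-- A parametrised space is a preparametrised space whose identity is polytime computable. -/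
def IsParametrised (X : PreparametrisedSpace.{u} S) : Prop :=
  PolytimeComputable X X id

/-- Polytime isomorphism: a bijection that is polytime computable in both directions. -/
def PolytimeIsomorphic (X Y : PreparametrisedSpace.{u} S) : Prop :=
  ∃ e : X.carrier ≃ Y.carrier, PolytimeComputable X Y e ∧ PolytimeComputable Y X e.symm

/-- Kawamura-Cook spaces: parametrised spaces with a length-monotone representation and the
standard parameter (the restriction of the size function). -/
def IsKawamuraCook (X : PreparametrisedSpace.{u} S) : Prop :=
  X.IsParametrised ∧
  (∀ φ ∈ X.rep.Dom, IsLengthMonotone φ) ∧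
  ∀ φ : X.rep.Dom, X.param φ = size φ.1

/-- The names of a preparametrised space, as a preparametrised space: each name is represented by
itself and the parameter is that of the given space. -/
def names (X : PreparametrisedSpace.{u} S) : PreparametrisedSpace.{0} S where
  carrier := X.rep.Dom
  rep := fun φ => ⟨φ ∈ X.rep.Dom, fun h => ⟨φ, h⟩⟩
  rep_surjective := fun φ => ⟨φ.1, φ.2, rfl⟩
  param := X.param
  param_mono := X.param_mono

end PreparametrisedSpace

/-- The space `ℕ^ℕ` with the total representation `ξ(φ)(n) = |φ(1ⁿ)|`, where `one` is the letter
`1`, and the standard parameter. -/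
noncomputable def natFunSpace (S : Type) [Finite S] (one : S) : PreparametrisedSpace.{0} S where
  carrier := ℕ → ℕ
  rep := fun φ => Part.some fun n => (φ (List.replicate n one)).length
  rep_surjective := fun f => ⟨fun a => List.replicate (f a.length) one, by simp⟩
  param := fun φ => size φ.1
  param_mono := fun φ => size_mono φ.1

/-- The parameter of `X`, as a function from the names of `X` (measured by that same parameter)
to `ℕ^ℕ`, is polytime computable. -/
def PreparametrisedSpace.HasPolytimeParameter {S : Type} [Finite S] (one : S)
    (X : PreparametrisedSpace.{u} S) : Prop :=
  PolytimeComputable X.names (natFunSpace S one) X.param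

end SecondOrder

/-! In a Kawamura-Cook space the parameter of a name `φ` is its size, and by length-monotonicity the
maximum in the size is attained at `1ⁿ`. Hence `φ` itself, read as a name in `natFunSpace`, denotes
its own parameter, and the identity machine computes it (`IsKawamuraCook.hasPolytimeParameter`).

For the converse let `e` be an isomorphism from `X` to `Z`, and let the machine `M` compute the
parameter of `Z`. The machine `N` for the inverse of `e` turns a name `ψ` of `Z` with parameter `l`
into a name `φ` of `X`. Its time bound `P` also bounds the lengths of its outputs, so that `|φ(a)| ≤
P l |a|`, and the parameter of `φ` is at most `Q l`: the function `l` controls `φ` (`Controls`). The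
new names are the functions `monotoneCode one zero l φ` with `l` controlling `φ`. Such a function
sends a string `w` that codes a pair of `a` and `n` to two letters, which tell the letter of index
`n` in `φ(a)` or that there is none, followed by `l(|w|)` letters of padding. The length of the
value depends on `|w|` alone and is `l(|w|) + 2`, so the codes are length-monotone and their size is
`l + 2`.

From a code, the values of `φ` are recovered by asking for one letter after the other; the control
by `l` keeps the number of questions polynomial in the size of the code
(`polytimeComputable_of_monotoneSpace`). In the other direction `ψ` is sent to the code of `φ`
padded by `l`: `N` supplies the letters, and `M` on `1ⁿ` supplies the padding (`exists_encoder`).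
Preceded by `e`, this is the map from `X` to the new space (`PolytimeComputable.comp`).

The main labour lies in the machines. Structured programs with a cost semantics (`Prog`, `Exec`) are
compiled to oracle machines (`Prog.compile_spec`). Any oracle machine can be simulated by a program
that leaves its own tapes clean (`Exec.simulate`), so that it can serve as a subroutine and as the
oracle of another machine (`Exec.call`, `OracleMachine.exists_comp`). -/

namespace SecondOrder

open scoped Classical

/-! ### Symbols and tapes -/

/-- Renaming of the auxiliary symbols. -/
def Symb.map {S A B : Type} (f : A → B) : Symb S A → Symb S B := Option.map (Sum.map id f)

@[simp] theorem Symb.map_none {S A B : Type} (f : A → B) : Symb.map (S := S) f none = none := rfl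

@[simp] theorem Symb.map_letter {S A B : Type} (f : A → B) (s : S) :
    Symb.map f (some (Sum.inl s)) = some (Sum.inl s) := rfl

@[simp] theorem Symb.map_aux {S A B : Type} (f : A → B) (a : A) :
    Symb.map (S := S) f (some (Sum.inr a)) = some (Sum.inr (f a)) := rfl

@[simp] theorem Symb.letter_none {S A : Type} : Symb.letter (none : Symb S A) = none := rfl

@[simp] theorem Symb.letter_some {S A : Type} (s : S) :
    Symb.letter (some (Sum.inl s) : Symb S A) = some s := rfl

@[simp] theorem Symb.letter_aux {S A : Type} (a : A) :
    Symb.letter (some (Sum.inr a) : Symb S A) = none := rfl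

@[simp] theorem Symb.letter_map {S A B : Type} (f : A → B) (x : Symb S A) :
    Symb.letter (Symb.map f x) = Symb.letter x := by
  rcases x with _ | _ | _ <;> rfl

theorem Symb.map_injective {S A B : Type} {f : A → B} (hf : f.Injective) :
    (Symb.map (S := S) f).Injective :=
  Option.map_injective (Sum.map_injective.2 ⟨Function.injective_id, hf⟩)

theorem Symb.eq_of_letter {S A : Type} {x : Symb S A} {s : S} (h : x.letter = some s) :
    x = some (Sum.inl s) := by
  rcases x with _ | _ | _ <;> simp_all

/-- A left inverse of `Symb.map f` for injective `f`. -/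
noncomputable def Symb.unmap {S A B : Type} (f : A → B) (y : Symb S B) : Symb S A :=
  if h : ∃ x, Symb.map f x = y then h.choose else none

theorem Symb.unmap_map {S A B : Type} {f : A → B} (hf : f.Injective) (x : Symb S A) :
    Symb.unmap f (Symb.map f x) = x := by
  have h : ∃ x', Symb.map f x' = Symb.map f x := ⟨x, rfl⟩
  rw [Symb.unmap, dif_pos h]
  exact Symb.map_injective hf h.choose_spec

/-- Renaming of the auxiliary symbols on a tape. -/
def Tape.map {S A B : Type} (f : A → B) (T : Tape S A) : Tape S B := fun z => (T z).map f

@[simp] theorem Tape.map_apply {S A B : Type} (f : A → B) (T : Tape S A) (z : ℤ) :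
    T.map f z = (T z).map f := rfl

/-- The blank tape. -/
def Tape.blank {S A : Type} : Tape S A := fun _ => none

@[simp] theorem Tape.blank_apply {S A : Type} (z : ℤ) : (Tape.blank : Tape S A) z = none := rfl

@[simp] theorem Tape.map_blank {S A B : Type} (f : A → B) :
    Tape.map f (Tape.blank : Tape S A) = Tape.blank := rfl

@[simp] theorem Tape.map_ofString {S A B : Type} (f : A → B) (a : List S) :
    Tape.map f (Tape.ofString a : Tape S A) = Tape.ofString a := by
  funext z
  simp only [Tape.map, Tape.ofString]
  split_ifs with h
  · cases a[z.toNat]? <;> rfl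
  · rfl

theorem Tape.map_update {S A B : Type} (f : A → B) (T : Tape S A) (z : ℤ) (x : Symb S A) :
    Tape.map f (Function.update T z x) = Function.update (Tape.map f T) z (x.map f) := by
  funext y
  by_cases h : y = z
  · subst h; simp [Tape.map]
  · simp [Tape.map, h]

@[simp] theorem Tape.content_map {S A B : Type} (f : A → B) (T : Tape S A) :
    (Tape.map f T).content = T.content := by
  simp [Tape.content, Tape.map]

@[simp] theorem Tape.ofString_nil {S A : Type} : (Tape.ofString [] : Tape S A) = Tape.blank := by
  funext z; simp [Tape.ofString, Tape.blank]

theorem Tape.ofString_natCast {S A : Type} (a : List S) (k : ℕ) :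
    (Tape.ofString a : Tape S A) k = (a[k]?).map Sum.inl := by
  simp [Tape.ofString]

theorem Tape.ofString_of_lt {S A : Type} (a : List S) {k : ℕ} (h : k < a.length) :
    (Tape.ofString a : Tape S A) k = some (Sum.inl a[k]) := by
  simp [Tape.ofString, h]

theorem Tape.ofString_of_neg {S A : Type} (a : List S) {z : ℤ} (h : z < 0) :
    (Tape.ofString a : Tape S A) z = none := by
  simp [Tape.ofString, h]

theorem Tape.ofString_of_le {S A : Type} (a : List S) {z : ℤ} (h : (a.length : ℤ) ≤ z) :
    (Tape.ofString a : Tape S A) z = none := by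
  have : a.length ≤ z.toNat := by omega
  simp [Tape.ofString, this]

theorem Tape.ofString_concat {S A : Type} (a : List S) (s : S) :
    (Tape.ofString (a ++ [s]) : Tape S A) =
      Function.update (Tape.ofString a) (a.length : ℤ) (some (Sum.inl s)) := by
  funext z
  by_cases h : z = a.length
  · subst h; simp [Tape.ofString]
  · rw [Function.update_of_ne h]
    simp only [Tape.ofString]
    split_ifs with h0
    · rw [List.getElem?_append]
      split_ifs with h1
      · rfl
      · rw [List.getElem?_eq_none (l := [s]), List.getElem?_eq_none (l := a)]
        · omega
        · simp; omega
    · rfl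

/-- The condition behind `w` only excludes letters of the alphabet: an auxiliary symbol ends the
content just as a blank does. -/
theorem Tape.content_eq {S A : Type} {T : Tape S A} {w : List S}
    (h : ∀ k (hk : k < w.length), T k = some (Sum.inl w[k]))
    (h' : (T w.length).letter = none) : T.content = w := by
  have hs : sInf {n : ℕ | Symb.letter (T n) = none} = w.length := by
    apply le_antisymm
    · exact Nat.sInf_le h'
    · refine le_csInf ⟨_, h'⟩ fun n hn => ?_
      by_contra hlt
      push Not at hlt
      simp [h n hlt] at hn
  rw [Tape.content, hs]
  clear h' hs
  induction w using List.reverseRecOn with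
  | nil => rfl
  | append_singleton l s ih =>
    rw [List.length_append, List.length_singleton, List.range_succ, List.filterMap_append, ih]
    · have := h l.length (by simp)
      simp [this]
    · intro k hk
      have := h k (by simp; omega)
      rw [this, List.getElem_append_left hk]

@[simp] theorem Tape.content_ofString {S A : Type} (a : List S) :
    (Tape.ofString a : Tape S A).content = a :=
  Tape.content_eq (fun _ hk => Tape.ofString_of_lt a hk) (by rw [Tape.ofString_of_le a le_rfl]; rfl)

/-- The defining property of the content of a tape on which the block of letters is finite. -/
theorem Tape.content_spec {S A : Type} {T : Tape S A} (hT : ∃ n : ℕ, (T n).letter = none) :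
    (∀ k (hk : k < T.content.length), T k = some (Sum.inl T.content[k])) ∧
      (T T.content.length).letter = none := by
  obtain ⟨w, h, h'⟩ : ∃ w : List S, (∀ k (hk : k < w.length), T k = some (Sum.inl w[k])) ∧
      (T w.length).letter = none := by
    have key : ∀ n : ℕ, (∀ k < n, (T k).letter ≠ none) → ∃ w : List S, w.length = n ∧
        ∀ k (hk : k < w.length), T k = some (Sum.inl w[k]) := by
      intro n
      induction n with
      | zero => exact fun _ => ⟨[], rfl, by simp⟩
      | succ n ih =>
        intro hn
        obtain ⟨w, hw, hw'⟩ := ih fun k hk => hn k (by omega)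
        obtain ⟨s, hs⟩ := Option.ne_none_iff_exists'.1 (hn n (by omega))
        refine ⟨w ++ [s], by simp [hw], fun k hk => ?_⟩
        by_cases hkn : k < w.length
        · rw [hw' k hkn, List.getElem_append_left hkn]
        · have : k = n := by simp at hk; omega
          subst this
          rw [Symb.eq_of_letter hs, List.getElem_append_right (by omega)]
          simp
    obtain ⟨w, hw, hw'⟩ := key (Nat.find hT) fun k hk => Nat.find_min hT hk
    exact ⟨w, hw', hw ▸ Nat.find_spec hT⟩
  rw [Tape.content_eq h h']
  exact ⟨h, h'⟩

/-! ### Structured programs on tapes -/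

/-- Configurations of a program: tapes, indexed by `I`, with heads. -/
@[ext]
structure Cfg (S I A : Type) where
  tape : I → Tape S A
  head : I → ℤ

namespace Cfg

variable {S I A : Type}

/-- The scanned symbols. -/
def read (C : Cfg S I A) : I → Symb S A := fun i => C.tape i (C.head i)

/-- Write on all tapes, then move all heads. -/
noncomputable def act (w : (I → Symb S A) → I → Symb S A) (m : (I → Symb S A) → I → Move)
    (C : Cfg S I A) : Cfg S I A where
  tape i := Function.update (C.tape i) (C.head i) (w C.read i)
  head i := C.head i + (m C.read i).toInt

/-- Replace the inscription of a tape. -/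
noncomputable def setTape (C : Cfg S I A) (i : I) (T : Tape S A) : Cfg S I A where
  tape := Function.update C.tape i T
  head := C.head

/-- Place a head. -/
noncomputable def setHead (C : Cfg S I A) (i : I) (z : ℤ) : Cfg S I A where
  tape := C.tape
  head := Function.update C.head i z

@[simp] theorem setTape_head (C : Cfg S I A) (i : I) (T : Tape S A) :
    (C.setTape i T).head = C.head := rfl

@[simp] theorem setHead_tape (C : Cfg S I A) (i : I) (z : ℤ) :
    (C.setHead i z).tape = C.tape := rfl

@[simp] theorem setTape_tape_self (C : Cfg S I A) (i : I) (T : Tape S A) :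
    (C.setTape i T).tape i = T := by simp [setTape]

@[simp] theorem setHead_head_self (C : Cfg S I A) (i : I) (z : ℤ) :
    (C.setHead i z).head i = z := by simp [setHead]

theorem setTape_tape_of_ne (C : Cfg S I A) {i j : I} (T : Tape S A) (h : j ≠ i) :
    (C.setTape i T).tape j = C.tape j := by simp [setTape, h]

theorem setHead_head_of_ne (C : Cfg S I A) {i j : I} (z : ℤ) (h : j ≠ i) :
    (C.setHead i z).head j = C.head j := by simp [setHead, h]

end Cfg

/-- Structured programs over tapes indexed by `I`. -/
inductive Prog (S I A : Type) : Type
  /-- write and move, depending on the scanned symbols -/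
  | act (w : (I → Symb S A) → I → Symb S A) (m : (I → Symb S A) → I → Move)
  /-- consult the oracle -/
  | ask
  | seq (p q : Prog S I A)
  | ite (b : (I → Symb S A) → Prop) (p q : Prog S I A)
  | loop (b : (I → Symb S A) → Prop) (p : Prog S I A)

infixr:60 " ;; " => Prog.seq

/-- `Exec K p C C' t`: the program `p` leads from `C` to `C'` within `t` steps, where `K` says what
a consultation of the oracle does and what it costs. -/
inductive Exec {S I A : Type} (K : Cfg S I A → Cfg S I A → ℕ → Prop) :
    Prog S I A → Cfg S I A → Cfg S I A → ℕ → Prop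
  | act (w m C) : Exec K (.act w m) C (C.act w m) 1
  | ask {C C' n} : K C C' n → Exec K .ask C C' n
  | seq {p q C C' C'' s t} : Exec K p C C' s → Exec K q C' C'' t → Exec K (p ;; q) C C'' (s + t)
  | ite_pos {b p q C C' t} : b C.read → Exec K p C C' t → Exec K (.ite b p q) C C' (t + 1)
  | ite_neg {b p q C C' t} : ¬ b C.read → Exec K q C C' t → Exec K (.ite b p q) C C' (t + 1)
  | loop_pos {b p C C' C'' s t} : b C.read → Exec K p C C' s → Exec K (.loop b p) C' C'' t →
      Exec K (.loop b p) C C'' (s + t + 1)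
  | loop_neg {b p C} : ¬ b C.read → Exec K (.loop b p) C C 1
  | mono {p C C' s t} : Exec K p C C' s → s ≤ t → Exec K p C C' t

theorem Exec.act' {S I A : Type} {K : Cfg S I A → Cfg S I A → ℕ → Prop} {w m}
    {C C' : Cfg S I A} (h : C.act w m = C') : Exec K (.act w m) C C' 1 := h ▸ .act w m C

/-- A loop whose intermediate configurations are known. -/
theorem Exec.loop_iterate {S I A : Type} {K : Cfg S I A → Cfg S I A → ℕ → Prop}
    {b : (I → Symb S A) → Prop} {p : Prog S I A} (C : ℕ → Cfg S I A) (n t : ℕ)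
    (hb : ∀ k < n, b (C k).read) (hp : ∀ k < n, Exec K p (C k) (C (k + 1)) t)
    (hn : ¬ b (C n).read) : Exec K (.loop b p) (C 0) (C n) (n * (t + 1) + 1) := by
  -- Induction on the number `j` of rounds that are still to come, because `Exec.loop_pos` splits
  -- off the first round. Each round pays 1 for its test, and the final failing test gives the last
  -- 1.
  suffices h : ∀ j k, j + k = n → Exec K (.loop b p) (C k) (C n) (j * (t + 1) + 1) from h n 0 rfl
  intro j
  induction j with
  | zero => rintro k rfl; simpa using Exec.loop_neg (by simpa using hn)
  | succ j ih =>
    intro k hk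
    refine (Exec.loop_pos (hb k (by omega)) (hp k (by omega)) (ih (k + 1) (by omega))).mono ?_
    rw [Nat.succ_mul]; omega

namespace Prog

variable {S I A : Type}

/-- Control states. -/
def St : Prog S I A → Type
  | act _ _ => Unit
  | ask => Unit
  | seq p q => p.St ⊕ q.St
  | ite _ p q => Option (p.St ⊕ q.St)
  | loop _ p => Option p.St

theorem finite_st : (p : Prog S I A) → Finite p.St
  | act _ _ => inferInstanceAs (Finite Unit)
  | ask => inferInstanceAs (Finite Unit)
  | seq p q => by
    have := p.finite_st
    have := q.finite_st
    exact inferInstanceAs (Finite (p.St ⊕ q.St))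
  | ite _ p q => by
    have := p.finite_st
    have := q.finite_st
    exact inferInstanceAs (Finite (Option (p.St ⊕ q.St)))
  | loop _ p => by
    have := p.finite_st
    exact inferInstanceAs (Finite (Option p.St))

/-- The first control state. -/
def entry : (p : Prog S I A) → p.St
  | act _ _ => ()
  | ask => ()
  | seq p _ => Sum.inl p.entry
  | ite _ _ _ => none
  | loop _ _ => none

/-- The next control state; `none` is the end of the program. -/
noncomputable def next : (p : Prog S I A) → p.St → (I → Symb S A) → Option p.St
  | act _ _, _, _ => none
  | ask, _, _ => none
  | seq p q, Sum.inl s, r => some (((p.next s r).map Sum.inl).getD (Sum.inr q.entry))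
  | seq _ q, Sum.inr s, r => (q.next s r).map Sum.inr
  | ite b p q, none, r => some (some (if b r then Sum.inl p.entry else Sum.inr q.entry))
  | ite _ p _, some (Sum.inl s), r => (p.next s r).map fun s' => some (Sum.inl s')
  | ite _ _ q, some (Sum.inr s), r => (q.next s r).map fun s' => some (Sum.inr s')
  | loop b p, none, r => if b r then some (some p.entry) else none
  | loop _ p, some s, r => some (p.next s r)

/-- The symbols written. -/
def write : (p : Prog S I A) → p.St → (I → Symb S A) → I → Symb S A
  | act w _, _, r => w r
  | ask, _, r => r
  | seq p _, Sum.inl s, r => p.write s r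
  | seq _ q, Sum.inr s, r => q.write s r
  | ite _ _ _, none, r => r
  | ite _ p _, some (Sum.inl s), r => p.write s r
  | ite _ _ q, some (Sum.inr s), r => q.write s r
  | loop _ _, none, r => r
  | loop _ p, some s, r => p.write s r

/-- The head movements. -/
def move : (p : Prog S I A) → p.St → (I → Symb S A) → I → Move
  | act _ m, _, r => m r
  | ask, _, _ => fun _ => .stay
  | seq p _, Sum.inl s, r => p.move s r
  | seq _ q, Sum.inr s, r => q.move s r
  | ite _ _ _, none, _ => fun _ => .stay
  | ite _ p _, some (Sum.inl s), r => p.move s r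
  | ite _ _ q, some (Sum.inr s), r => q.move s r
  | loop _ _, none, _ => fun _ => .stay
  | loop _ p, some s, r => p.move s r

/-- The control states that consult the oracle. -/
def IsAsk : (p : Prog S I A) → p.St → Prop
  | act _ _, _ => False
  | ask, _ => True
  | seq p _, Sum.inl s => p.IsAsk s
  | seq _ q, Sum.inr s => q.IsAsk s
  | ite _ _ _, none => False
  | ite _ p _, some (Sum.inl s) => p.IsAsk s
  | ite _ _ q, some (Sum.inr s) => q.IsAsk s
  | loop _ _, none => False
  | loop _ p, some s => p.IsAsk s

end Prog

/-- Consultation of the oracle `φ` with query tape `q` and answer tape `a`. -/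
noncomputable def Cfg.ask {S I A : Type} (φ : Baire S) (q a : I) (C : Cfg S I A) : Cfg S I A :=
  C.setTape a (Tape.ofString (φ (C.tape q).content))

/-- The effect of a control state on the tapes. -/
noncomputable def Prog.effect {S I A : Type} (φ : Baire S) (q a : I) (p : Prog S I A) (s : p.St)
    (C : Cfg S I A) : Cfg S I A :=
  if p.IsAsk s then C.ask φ q a else C.act (p.write s) (p.move s)

/-- Runs of the flowchart of a program. -/
inductive Prog.Run {S I A : Type} (φ : Baire S) (q a : I) (p : Prog S I A) :
    p.St → Cfg S I A → Cfg S I A → ℕ → Prop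
  | exit {s C} : p.next s C.read = none → Prog.Run φ q a p s C (p.effect φ q a s C) 1
  | step {s s' C C' n} : p.next s C.read = some s' →
      Prog.Run φ q a p s' (p.effect φ q a s C) C' n → Prog.Run φ q a p s C C' (n + 1)

namespace Prog

variable {S I A : Type} {φ : Baire S} {i j : I}

theorem act_stay (C : Cfg S I A) : C.act (fun r => r) (fun _ _ => .stay) = C := by
  ext k
  · simp [Cfg.act, Cfg.read]
  · simp [Cfg.act, Move.toInt]

/-- The exit of `p` becomes the transition to the entry of `q` and costs no step of its own, so the
numbers of steps add up exactly. -/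
theorem Run.seq {p q : Prog S I A} {s C C' C'' m n} (hp : p.Run φ i j s C C' m)
    (hq : q.Run φ i j q.entry C' C'' n) : (p ;; q).Run φ i j (Sum.inl s) C C'' (m + n) := by
  have lift : ∀ {s C C' n}, q.Run φ i j s C C' n → (p ;; q).Run φ i j (Sum.inr s) C C' n := by
    intro s C C' n h
    induction h with
    | exit h => exact Run.exit (p := p ;; q) (s := Sum.inr _) (by simp [next, h]; rfl)
    | step h _ ih => exact Run.step (p := p ;; q) (s := Sum.inr _) (by simp [next, h]; rfl) ih
  induction hp with
  | exit h =>
    rw [Nat.add_comm]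
    exact Run.step (p := p ;; q) (s := Sum.inl _) (by simp [next, h]) (lift hq)
  | step h _ ih =>
    rw [Nat.add_right_comm]
    exact Run.step (p := p ;; q) (s := Sum.inl _) (by simp [next, h]) (ih hq)

theorem Run.ite_left {b} {p q : Prog S I A} {s C C' n} (h : p.Run φ i j s C C' n) :
    (Prog.ite b p q).Run φ i j (some (Sum.inl s)) C C' n := by
  induction h with
  | exit h => exact Run.exit (p := Prog.ite b p q) (s := some (Sum.inl _)) (by simp [next, h]; rfl)
  | step h _ ih =>
    exact Run.step (p := Prog.ite b p q) (s := some (Sum.inl _)) (by simp [next, h]; rfl) ih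

theorem Run.ite_right {b} {p q : Prog S I A} {s C C' n} (h : q.Run φ i j s C C' n) :
    (Prog.ite b p q).Run φ i j (some (Sum.inr s)) C C' n := by
  induction h with
  | exit h => exact Run.exit (p := Prog.ite b p q) (s := some (Sum.inr _)) (by simp [next, h]; rfl)
  | step h _ ih =>
    exact Run.step (p := Prog.ite b p q) (s := some (Sum.inr _)) (by simp [next, h]; rfl) ih

theorem Run.loop {b} {p : Prog S I A} {s C C' C'' m n} (h : p.Run φ i j s C C' m)
    (h' : (Prog.loop b p).Run φ i j none C' C'' n) :
    (Prog.loop b p).Run φ i j (some s) C C'' (m + n) := by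
  induction h with
  | exit h =>
    rw [Nat.add_comm]
    exact Run.step (p := Prog.loop b p) (s := some _) (by simp [next, h]) h'
  | step h _ ih =>
    rw [Nat.add_right_comm]
    exact Run.step (p := Prog.loop b p) (s := some _) (by simp [next, h]) (ih h')

theorem effect_ite_none (b) (p q : Prog S I A) (C : Cfg S I A) :
    (Prog.ite b p q).effect φ i j none C = C := by
  exact (if_neg (by simp [IsAsk])).trans (act_stay C)

theorem effect_loop_none (b) (p : Prog S I A) (C : Cfg S I A) :
    (Prog.loop b p).effect φ i j none C = C := by
  exact (if_neg (by simp [IsAsk])).trans (act_stay C)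

/-- The ask relation of an oracle that is consulted in one step. -/
def AskOracle (φ : Baire S) (q a : I) : Cfg S I A → Cfg S I A → ℕ → Prop :=
  fun C C' n => C' = C.ask φ q a ∧ n = 1

/-- A test of `ite` or `loop` is one flowchart step without effect on the tapes, which matches its
cost in `Exec`. There is only an inequality because `Exec.mono` may have weakened the bounds. -/
theorem run_of_exec {p : Prog S I A} {C C' t} (h : Exec (AskOracle φ i j) p C C' t) :
    ∃ n ≤ t, p.Run φ i j p.entry C C' n := by
  induction h with
  | act w m C =>
    refine ⟨1, le_rfl, ?_⟩
    have := Run.exit (φ := φ) (q := i) (a := j) (p := .act w m) (s := ()) (C := C) rfl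
    have e : (Prog.act w m).effect φ i j () C = C.act w m := if_neg (by simp [IsAsk])
    rwa [e] at this
  | @ask C C' n h =>
    obtain ⟨rfl, rfl⟩ := h
    refine ⟨1, le_rfl, ?_⟩
    have := Run.exit (φ := φ) (q := i) (a := j) (p := .ask) (s := ()) (C := C) rfl
    have e : (Prog.ask : Prog S I A).effect φ i j () C = C.ask φ i j := if_pos (by simp [IsAsk])
    rwa [e] at this
  | seq _ _ ih ih' =>
    obtain ⟨m, hm, hm'⟩ := ih
    obtain ⟨n, hn, hn'⟩ := ih'
    exact ⟨m + n, by omega, hm'.seq hn'⟩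
  | @ite_pos b p q C C' t hb _ ih =>
    obtain ⟨n, hn, hn'⟩ := ih
    refine ⟨n + 1, by omega, Run.step (p := Prog.ite b p q) (s := none)
      (s' := some (Sum.inl p.entry)) (by simp [next, hb]) ?_⟩
    rw [effect_ite_none]
    exact hn'.ite_left
  | @ite_neg b p q C C' t hb _ ih =>
    obtain ⟨n, hn, hn'⟩ := ih
    refine ⟨n + 1, by omega, Run.step (p := Prog.ite b p q) (s := none)
      (s' := some (Sum.inr q.entry)) (by simp [next, hb]) ?_⟩
    rw [effect_ite_none]
    exact hn'.ite_right
  | @loop_pos b p C C' C'' s t hb _ _ ih ih' =>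
    obtain ⟨m, hm, hm'⟩ := ih
    obtain ⟨n, hn, hn'⟩ := ih'
    refine ⟨m + n + 1, by omega, Run.step (p := Prog.loop b p) (s := none)
      (s' := some p.entry) (by simp [next, hb]) ?_⟩
    rw [effect_loop_none]
    exact hm'.loop hn'
  | @loop_neg b p C hb =>
    refine ⟨1, le_rfl, ?_⟩
    have := Run.exit (φ := φ) (q := i) (a := j) (p := .loop b p) (s := none) (C := C)
      (by simp [next, hb])
    rwa [effect_loop_none] at this
  | mono _ hst ih =>
    obtain ⟨n, hn, hn'⟩ := ih
    exact ⟨n, hn.trans hst, hn'⟩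

end Prog

/-! ### Compilation to oracle machines -/

/-- Renaming of the work tapes. -/
def TapeIdx.map {V W : Type} (f : V → W) : TapeIdx V → TapeIdx W
  | .input => .input
  | .output => .output
  | .query => .query
  | .answer => .answer
  | .work w => .work (f w)

theorem TapeIdx.map_injective {V W : Type} {f : V → W} (hf : f.Injective) :
    (TapeIdx.map f).Injective := by
  intro x y h
  cases x <;> cases y <;> simp_all [TapeIdx.map]
  exact hf h

/-- The states of a compiled program. -/
inductive CState (σ : Type) : Type
  | at (s : Option σ)
  | oracle
  | resume

instance {σ : Type} [Finite σ] : Finite (CState σ) :=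
  Finite.of_injective
    (fun x : CState σ => match x with
      | .at s => some (some s)
      | .oracle => some none
      | .resume => none)
    (by rintro (_ | _ | _) (_ | _ | _) <;> simp)

namespace Prog

variable {S W A : Type}

/-- The scanned symbols on the tapes of a program. -/
noncomputable def scanned (p : Prog S (TapeIdx W) A)
    (r : TapeIdx (Option W) → Symb S (A ⊕ Option p.St)) : TapeIdx W → Symb S A :=
  fun i => Symb.unmap Sum.inl (r (i.map some))

/-- The state transitions of a compiled program. -/
noncomputable def cnext (p : Prog S (TapeIdx W) A) (s : CState p.St)
    (r : TapeIdx (Option W) → Symb S (A ⊕ Option p.St)) : CState p.St :=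
  match s with
  | .at (some s) => if p.IsAsk s then .oracle else .at (p.next s (p.scanned r))
  | .resume => match r (.work none) with
    | some (Sum.inr (Sum.inr s)) => .at s
    | _ => .at none
  | s => s

/-- The symbols written by a compiled program. -/
noncomputable def cwrite (p : Prog S (TapeIdx W) A) (s : CState p.St)
    (r : TapeIdx (Option W) → Symb S (A ⊕ Option p.St)) (i : TapeIdx (Option W)) :
    Symb S (A ⊕ Option p.St) :=
  match s with
  | .at (some s) => if p.IsAsk s then
      (if i = .work none then some (Sum.inr (Sum.inr (p.next s (p.scanned r)))) else r i)
    else if h : ∃ k : TapeIdx W, k.map some = i then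
      Symb.map Sum.inl (p.write s (p.scanned r) h.choose) else r i
  | _ => r i

/-- The head movements of a compiled program. -/
noncomputable def cmove (p : Prog S (TapeIdx W) A) (s : CState p.St)
    (r : TapeIdx (Option W) → Symb S (A ⊕ Option p.St)) (i : TapeIdx (Option W)) : Move :=
  match s with
  | .at (some s) => if p.IsAsk s then .stay
    else if h : ∃ k : TapeIdx W, k.map some = i then
      p.move s (p.scanned r) h.choose else .stay
  | _ => .stay

/-- The oracle machine of a program. An additional work tape keeps the return address of the
oracle calls. -/
@[reducible] noncomputable def compile [Finite W] [Finite A] (p : Prog S (TapeIdx W) A) :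
    OracleMachine S where
  Q := CState p.St
  W := Option W
  A := A ⊕ Option p.St
  finQ := have := p.finite_st; inferInstance
  finW := inferInstance
  finA := have := p.finite_st; inferInstance
  start := .at (some p.entry)
  halt := .at none
  oracle := .oracle
  resume := .resume
  next := p.cnext
  write := p.cwrite
  move := p.cmove

variable {φ : Baire S} (p : Prog S (TapeIdx W) A)

theorem map_some_choose {i : TapeIdx W} (h : ∃ k : TapeIdx W, k.map some = i.map some) :
    h.choose = i :=
  TapeIdx.map_injective (Option.some_injective W) h.choose_spec

variable [Finite W] [Finite A]

/-- The machine is in the control state `s`, and its tapes are those of `C`. -/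
def Sim (s : Option p.St) (C : Cfg S (TapeIdx W) A) (c : p.compile.Config) : Prop :=
  c.state = .at s ∧ ∀ i : TapeIdx W, c.tape (i.map some) = (C.tape i).map Sum.inl ∧
    c.head (i.map some) = C.head i

variable {p}

theorem Sim.scanned_eq {s} {C : Cfg S (TapeIdx W) A} {c : p.compile.Config} (h : Sim p s C c) :
    p.scanned (fun i => c.tape i (c.head i)) = C.read := by
  funext i
  have : c.tape (i.map some) (c.head (i.map some)) = (C.read i).map Sum.inl := by
    rw [(h.2 i).1, (h.2 i).2]; rfl
  rw [scanned, this, Symb.unmap_map Sum.inl_injective]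

theorem compile_step {c : p.compile.Config} (h : c.state ≠ .at none) (h' : c.state ≠ .oracle) :
    p.compile.step φ c =
      { state := p.cnext c.state fun i => c.tape i (c.head i)
        tape := fun i => Function.update (c.tape i) (c.head i)
          (p.cwrite c.state (fun j => c.tape j (c.head j)) i)
        head := fun i => c.head i +
          (p.cmove c.state (fun j => c.tape j (c.head j)) i).toInt } := by
  rw [OracleMachine.step, if_neg h, if_neg h']

/-- All oracle calls of a machine return to the same state, so the continuation cannot be kept in
the state. It is written on the extra work tape, whose head does not move. This makes three steps:
store the return address, consult the oracle, jump to the address. -/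
theorem Sim.step_ask {s} {C : Cfg S (TapeIdx W) A} {c : p.compile.Config}
    (h : Sim p (some s) C c) (hask : p.IsAsk s) :
    Sim p (p.next s C.read) (C.ask φ .query .answer) ((p.compile.step φ)^[3] c) := by
  have hsc := h.scanned_eq
  have hs : c.state = .at (some s) := h.1
  generalize hc₁ : p.compile.step φ c = c₁
  generalize hc₂ : p.compile.step φ c₁ = c₂
  generalize hc₃ : p.compile.step φ c₂ = c₃
  have e₁ : c₁.state = .oracle ∧ c₁.tape (.work none) (c₁.head (.work none)) =
      some (Sum.inr (Sum.inr (p.next s C.read))) ∧ ∀ i : TapeIdx W,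
      c₁.tape (i.map some) = c.tape (i.map some) ∧ c₁.head (i.map some) = c.head (i.map some) := by
    rw [← hc₁, compile_step (by simp [hs]) (by simp [hs]), hs]
    refine ⟨by simp [cnext, hask], ?_, fun i => ⟨?_, ?_⟩⟩
    · simp [cwrite, cmove, hask, Move.toInt, hsc]
    · have : i.map some ≠ TapeIdx.work (none : Option W) := by cases i <;> simp [TapeIdx.map]
      simp [cwrite, hask, this]
    · simp [cmove, hask, Move.toInt]
  have e₂ : c₂.state = .resume ∧ c₂.tape (.work none) = c₁.tape (.work none) ∧
      c₂.head = c₁.head ∧ ∀ i : TapeIdx W,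
      c₂.tape (i.map some) = ((C.ask φ .query .answer).tape i).map Sum.inl := by
    rw [← hc₂, OracleMachine.step, if_neg (by simp [e₁.1]), if_pos e₁.1]
    refine ⟨rfl, rfl, rfl, fun i => ?_⟩
    have hq : c₁.tape .query = (C.tape .query).map Sum.inl :=
      ((e₁.2.2 .query).1).trans (h.2 .query).1
    have hi := ((e₁.2.2 i).1).trans (h.2 i).1
    have hcq : (c₁.tape .query).content = (C.tape .query).content := by
      rw [hq]; exact Tape.content_map _ _
    cases i with
    | answer =>
      simp only [TapeIdx.map, hcq, Cfg.ask, Cfg.setTape, Function.update_self]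
      exact (Tape.map_ofString _ _).symm
    | _ =>
      simp only [Cfg.ask, Cfg.setTape]
      rw [Function.update_of_ne (by simp)]
      exact hi
  have e₃ : c₃.state = .at (p.next s C.read) ∧ c₃.tape = c₂.tape ∧ c₃.head = c₂.head := by
    have hr : c₂.tape (.work none) (c₂.head (.work none)) =
        some (Sum.inr (Sum.inr (p.next s C.read))) := by
      rw [e₂.2.1, e₂.2.2.1, e₁.2.1]
    rw [← hc₃, compile_step (by simp [e₂.1]) (by simp [e₂.1]), e₂.1]
    refine ⟨by simp only [cnext]; rw [hr], ?_, ?_⟩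
    · funext i
      simp [cwrite]
    · funext i
      simp [cmove, Move.toInt]
  have : (p.compile.step φ)^[3] c = c₃ := by rw [← hc₃, ← hc₂, ← hc₁]; rfl
  rw [this]
  refine ⟨e₃.1, fun i => ⟨?_, ?_⟩⟩
  · rw [e₃.2.1, e₂.2.2.2]
  · rw [e₃.2.2, e₂.2.2.1, (e₁.2.2 i).2, (h.2 i).2]
    rfl

theorem Sim.step_act {s} {C : Cfg S (TapeIdx W) A} {c : p.compile.Config}
    (h : Sim p (some s) C c) (hask : ¬ p.IsAsk s) :
    Sim p (p.next s C.read) (C.act (p.write s) (p.move s)) (p.compile.step φ c) := by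
  have hsc := h.scanned_eq
  have hs : c.state = .at (some s) := h.1
  rw [compile_step (by simp [hs]) (by simp [hs]), hs]
  refine ⟨by simp [cnext, hask, hsc], fun i => ?_⟩
  have hex : ∃ k : TapeIdx W, k.map some = i.map some := ⟨i, rfl⟩
  have h1 := (h.2 i).1
  have h2 := (h.2 i).2
  constructor
  · simp only [cwrite, hask, if_false, hex, dif_pos, hsc]
    rw [map_some_choose hex, h1, h2, Cfg.act, Tape.map_update]
  · simp only [cmove, hask, if_false, hex, dif_pos, hsc]
    rw [map_some_choose hex, h2, Cfg.act]

theorem Sim.step {s} {C : Cfg S (TapeIdx W) A} {c : p.compile.Config} (h : Sim p (some s) C c) :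
    ∃ k ≤ 3, Sim p (p.next s C.read) (p.effect φ .query .answer s C)
      ((p.compile.step φ)^[k] c) := by
  by_cases hask : p.IsAsk s
  · exact ⟨3, le_rfl, by rw [effect, if_pos hask]; exact h.step_ask hask⟩
  · exact ⟨1, by norm_num, by rw [effect, if_neg hask]; exact h.step_act hask⟩

theorem Sim.run {s} {C C' : Cfg S (TapeIdx W) A} {n : ℕ}
    (h : p.Run φ .query .answer s C C' n) {c : p.compile.Config} (hc : Sim p (some s) C c) :
    ∃ k ≤ 3 * n, Sim p none C' ((p.compile.step φ)^[k] c) := by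
  induction h generalizing c with
  | exit h =>
    obtain ⟨k, hk, hk'⟩ := hc.step (φ := φ)
    exact ⟨k, by omega, h ▸ hk'⟩
  | step h _ ih =>
    obtain ⟨k, hk, hk'⟩ := hc.step (φ := φ)
    rw [h] at hk'
    obtain ⟨l, hl, hl'⟩ := ih hk'
    refine ⟨l + k, by omega, ?_⟩
    rwa [Function.iterate_add_apply]

end Prog

/-! ### Running times and results of oracle machines -/

namespace OracleMachine

variable {S : Type} (M : OracleMachine S)

theorem step_of_halt {φ : Baire S} {c : M.Config} (h : c.state = M.halt) : M.step φ c = c := by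
  rw [step, if_pos h]

theorem step_of_ne {φ : Baire S} {c : M.Config} (h : c.state ≠ M.halt) (h' : c.state ≠ M.oracle) :
    M.step φ c =
      { state := M.next c.state fun i => c.tape i (c.head i)
        tape := fun i => Function.update (c.tape i) (c.head i)
          (M.write c.state (fun j => c.tape j (c.head j)) i)
        head := fun i => c.head i + (M.move c.state (fun j => c.tape j (c.head j)) i).toInt } := by
  rw [step, if_neg h, if_neg h']

theorem step_of_oracle {φ : Baire S} {c : M.Config} (h : c.state ≠ M.halt)
    (h' : c.state = M.oracle) :
    M.step φ c =
      { state := M.resume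
        tape := fun i => match i with
          | .answer => Tape.ofString (φ (c.tape .query).content)
          | j => c.tape j
        head := c.head } := by
  exact (if_neg h).trans (if_pos h')

theorem run_succ (φ : Baire S) (a : List S) (n : ℕ) :
    M.run φ a (n + 1) = M.step φ (M.run φ a n) :=
  Function.iterate_succ_apply' _ _ _

theorem run_of_le {φ : Baire S} {a : List S} {m n : ℕ} (h : (M.run φ a m).state = M.halt)
    (hmn : m ≤ n) : M.run φ a n = M.run φ a m := by
  induction n, hmn using Nat.le_induction with
  | base => rfl
  | succ n _ ih => rw [run_succ, ih, M.step_of_halt h]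

theorem time_le {φ : Baire S} {a : List S} {n : ℕ} (h : (M.run φ a n).state = M.halt) :
    M.time φ a ≤ n :=
  sInf_le ⟨n, h, rfl⟩

theorem exists_time_eq {φ : Baire S} {a : List S} (h : M.time φ a ≠ ⊤) :
    ∃ n : ℕ, M.time φ a = n ∧ (M.run φ a n).state = M.halt ∧
      ∀ k < n, (M.run φ a k).state ≠ M.halt := by
  have hne : {t : ℕ∞ | ∃ n : ℕ, (M.run φ a n).state = M.halt ∧ t = n}.Nonempty := by
    by_contra hc
    rw [Set.not_nonempty_iff_eq_empty] at hc
    exact h (by rw [time, hc, sInf_empty])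
  obtain ⟨n, hn, hn'⟩ := csInf_mem hne
  refine ⟨n, hn', hn, fun k hk hk' => ?_⟩
  have := M.time_le hk'
  rw [time, hn'] at this
  exact absurd (Nat.cast_le.1 this) (by omega)

theorem result_eq {φ : Baire S} {a : List S} {n : ℕ} (h : (M.run φ a n).state = M.halt) :
    M.result φ a = ((M.run φ a n).tape .output).content := by
  obtain ⟨k, hk, hk', -⟩ := M.exists_time_eq (ne_top_of_le_ne_top (by simp) (M.time_le h))
  have : k ≤ n := by
    have := M.time_le h
    rw [hk] at this
    exact_mod_cast this
  rw [result, hk, M.run_of_le hk' this]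
  rfl

/-- A head advances by at most one cell per step, hence after `n` steps nothing has been written in
the cells from `n` onwards. -/
theorem output_blank (φ : Baire S) (a : List S) (n : ℕ) :
    (M.run φ a n).head .output ≤ n ∧
      ∀ z : ℤ, (n : ℤ) ≤ z → (M.run φ a n).tape .output z = none := by
  induction n with
  | zero => exact ⟨le_rfl, fun z _ => rfl⟩
  | succ n ih =>
    rw [run_succ, step]
    split_ifs with h h'
    · exact ⟨ih.1.trans (by simp), fun z hz => ih.2 z (by push_cast at hz; omega)⟩
    · exact ⟨ih.1.trans (by simp), fun z hz => ih.2 z (by push_cast at hz; omega)⟩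
    · refine ⟨?_, fun z hz => ?_⟩
      · have : ∀ m : Move, m.toInt ≤ 1 := by rintro (_ | _ | _) <;> simp [Move.toInt]
        have := this (M.move (M.run φ a n).state
          (fun j => (M.run φ a n).tape j ((M.run φ a n).head j)) .output)
        have := ih.1
        push_cast
        omega
      · push_cast at hz
        have := ih.1
        dsimp only
        rw [Function.update_of_ne (by omega)]
        exact ih.2 z (by omega)

/-- If the output had more than `n` letters, the cell `k ≤ n` would hold one, but it is still blank
after the `k` steps of the computation. In this way time bounds become bounds for the values of
computed names. -/
theorem length_result_le {φ : Baire S} {a : List S} {n : ℕ} (h : M.time φ a ≤ n) :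
    (M.result φ a).length ≤ n := by
  obtain ⟨k, hk, hk', -⟩ := M.exists_time_eq (ne_top_of_le_ne_top (by simp) h)
  have hkn : k ≤ n := by rw [hk] at h; exact_mod_cast h
  rw [M.result_eq hk']
  have hb := (M.output_blank φ a k).2
  have hs := Tape.content_spec (T := (M.run φ a k).tape .output) ⟨k, by rw [hb k le_rfl]; rfl⟩
  by_contra hlt
  push Not at hlt
  have := hs.1 k (by omega)
  rw [hb k le_rfl] at this
  cases this

end OracleMachine

/-- The initial configuration of a program for an oracle machine. -/
def Prog.initCfg {S W A : Type} (a : List S) : Cfg S (TapeIdx W) A where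
  tape i := match i with
    | .input => Tape.ofString a
    | _ => Tape.blank
  head _ := 0

/-- The factor 3 is the price of an oracle call in the compiled machine; every other flowchart step
is one machine step. -/
theorem Prog.compile_spec {S W A : Type} [Finite W] [Finite A] {p : Prog S (TapeIdx W) A}
    {φ : Baire S} {a : List S} {C' : Cfg S (TapeIdx W) A} {t : ℕ}
    (h : Exec (Prog.AskOracle φ .query .answer) p (Prog.initCfg a) C' t) :
    p.compile.time φ a ≤ (3 * t : ℕ) ∧ p.compile.result φ a = (C'.tape .output).content := by
  obtain ⟨n, hn, hrun⟩ := Prog.run_of_exec h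
  have h0 : Prog.Sim p (some p.entry) (Prog.initCfg a) (p.compile.init a) := by
    refine ⟨rfl, fun i => ⟨?_, rfl⟩⟩
    cases i <;> simp [OracleMachine.init, Prog.initCfg, TapeIdx.map] <;> rfl
  obtain ⟨k, hk, hk'⟩ := Prog.Sim.run hrun h0
  have hh : (p.compile.run φ a k).state = p.compile.halt := hk'.1
  refine ⟨(p.compile.time_le hh).trans (Nat.cast_le.2 (by omega)), ?_⟩
  rw [p.compile.result_eq hh]
  exact (congrArg Tape.content (hk'.2 .output).1).trans (Tape.content_map _ _)

/-! ### Embedding programs into larger tape sets -/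

section Embed

variable {S I J A B : Type}

/-- The configuration `C` placed on the tapes `e i` of the configuration `F`. -/
noncomputable def Cfg.embed (e : I → J) (f : A → B) (F : Cfg S J B) (C : Cfg S I A) :
    Cfg S J B where
  tape j := if h : ∃ i, e i = j then (C.tape h.choose).map f else F.tape j
  head j := if h : ∃ i, e i = j then C.head h.choose else F.head j

/-- A program moved to the tapes `e i`, with the subroutine `H` in place of the oracle. -/
noncomputable def Prog.subst (p : Prog S I A) (e : I → J) (f : A → B) (H : Prog S J B) :
    Prog S J B :=
  match p with
  | .act w m => .act
      (fun r j => if h : ∃ i, e i = j then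
        (w (fun i => (r (e i)).unmap f) h.choose).map f else r j)
      (fun r j => if h : ∃ i, e i = j then m (fun i => (r (e i)).unmap f) h.choose else .stay)
  | .ask => H
  | .seq p q => .seq (p.subst e f H) (q.subst e f H)
  | .ite b p q => .ite (fun r => b fun i => (r (e i)).unmap f) (p.subst e f H) (q.subst e f H)
  | .loop b p => .loop (fun r => b fun i => (r (e i)).unmap f) (p.subst e f H)

variable {e : I → J} {f : A → B} (he : e.Injective) (hf : f.Injective)

include he

theorem choose_eq_of_injective {i : I} (h : ∃ i', e i' = e i) : h.choose = i := he h.choose_spec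

theorem Cfg.embed_tape (F : Cfg S J B) (C : Cfg S I A) (i : I) :
    (Cfg.embed e f F C).tape (e i) = (C.tape i).map f := by
  have h : ∃ i', e i' = e i := ⟨i, rfl⟩
  simp only [embed, dif_pos h, choose_eq_of_injective he h]

theorem Cfg.embed_head (F : Cfg S J B) (C : Cfg S I A) (i : I) :
    (Cfg.embed e f F C).head (e i) = C.head i := by
  have h : ∃ i', e i' = e i := ⟨i, rfl⟩
  simp only [embed, dif_pos h, choose_eq_of_injective he h]

omit he in
theorem Cfg.embed_tape_of_notMem (F : Cfg S J B) (C : Cfg S I A) {j : J} (h : ¬ ∃ i, e i = j) :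
    (Cfg.embed e f F C).tape j = F.tape j := by
  simp only [embed, dif_neg h]

omit he in
theorem Cfg.embed_head_of_notMem (F : Cfg S J B) (C : Cfg S I A) {j : J} (h : ¬ ∃ i, e i = j) :
    (Cfg.embed e f F C).head j = F.head j := by
  simp only [embed, dif_neg h]

/-- This is how a given configuration is recognised as an embedded one: it serves as its own
background. -/
theorem Cfg.embed_self (F : Cfg S J B) (C : Cfg S I A) (ht : ∀ i, F.tape (e i) = (C.tape i).map f)
    (hh : ∀ i, F.head (e i) = C.head i) : Cfg.embed e f F C = F := by
  apply Cfg.ext <;> funext j <;> by_cases h : ∃ i, e i = j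
  · obtain ⟨i, rfl⟩ := h; rw [embed_tape he, ht]
  · rw [embed_tape_of_notMem F C h]
  · obtain ⟨i, rfl⟩ := h; rw [embed_head he, hh]
  · rw [embed_head_of_notMem F C h]

theorem Cfg.embed_setTape (F : Cfg S J B) (C : Cfg S I A) (i : I) (T : Tape S A) :
    Cfg.embed e f F (C.setTape i T) = (Cfg.embed e f F C).setTape (e i) (T.map f) := by
  apply Cfg.ext <;> funext j <;> by_cases h : ∃ i, e i = j
  · obtain ⟨k, rfl⟩ := h
    rw [embed_tape he]
    by_cases hk : k = i
    · subst hk; simp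
    · rw [setTape_tape_of_ne _ _ hk, setTape_tape_of_ne _ _ (he.ne hk), embed_tape he]
  · rw [embed_tape_of_notMem F _ h, setTape_tape_of_ne _ _ (fun h' => h ⟨i, h'.symm⟩),
      embed_tape_of_notMem F _ h]
  · obtain ⟨k, rfl⟩ := h
    rw [embed_head he, setTape_head, setTape_head, embed_head he]
  · rw [embed_head_of_notMem F _ h, setTape_head, embed_head_of_notMem F _ h]

theorem Cfg.setTape_embed (F : Cfg S J B) (C : Cfg S I A) {j : J} (h : ¬ ∃ i, e i = j)
    (T : Tape S B) :
    Cfg.embed e f (F.setTape j T) C = (Cfg.embed e f F C).setTape j T := by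
  apply Cfg.ext <;> funext k <;> by_cases hk : ∃ i, e i = k
  · obtain ⟨i, rfl⟩ := hk
    rw [embed_tape he, setTape_tape_of_ne _ _ (fun h' => h ⟨i, h'⟩), embed_tape he]
  · rw [embed_tape_of_notMem _ _ hk]
    by_cases hkj : k = j
    · subst hkj; simp
    · rw [setTape_tape_of_ne _ _ hkj, setTape_tape_of_ne _ _ hkj, embed_tape_of_notMem _ _ hk]
  · obtain ⟨i, rfl⟩ := hk
    rw [embed_head he, setTape_head, embed_head he]
  · rw [embed_head_of_notMem _ _ hk, setTape_head, setTape_head, embed_head_of_notMem _ _ hk]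

include hf

theorem Cfg.embed_read (F : Cfg S J B) (C : Cfg S I A) :
    (fun i => ((Cfg.embed e f F C).read (e i)).unmap f) = C.read := by
  funext i
  rw [read, embed_tape he, embed_head he, Tape.map_apply, Symb.unmap_map hf]
  rfl

theorem Cfg.embed_act (F : Cfg S J B) (C : Cfg S I A) (w m) :
    (Cfg.embed e f F C).act
      (fun r j => if h : ∃ i, e i = j then
        (w (fun i => (r (e i)).unmap f) h.choose).map f else r j)
      (fun r j => if h : ∃ i, e i = j then m (fun i => (r (e i)).unmap f) h.choose else .stay) =
    Cfg.embed e f F (C.act w m) := by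
  apply Cfg.ext <;> funext j <;> by_cases h : ∃ i, e i = j
  · obtain ⟨k, rfl⟩ := h
    have h : ∃ i', e i' = e k := ⟨k, rfl⟩
    rw [embed_tape he]
    simp only [act, dif_pos h, choose_eq_of_injective he h, embed_tape he, embed_head he,
      embed_read he hf, Tape.map_update]
  · rw [embed_tape_of_notMem _ _ h]
    simp only [act, dif_neg h, read, embed_tape_of_notMem _ _ h, Function.update_eq_self]
  · obtain ⟨k, rfl⟩ := h
    have h : ∃ i', e i' = e k := ⟨k, rfl⟩
    rw [embed_head he]
    simp only [act, dif_pos h, choose_eq_of_injective he h, embed_head he, embed_read he hf]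
  · rw [embed_head_of_notMem _ _ h]
    simp only [act, dif_neg h, embed_head_of_notMem _ _ h, Move.toInt, add_zero]

/-- Execution of a program moved to other tapes; the remaining tapes are subject to the invariant
`Φ` of the subroutine. -/
theorem Exec.subst {K : Cfg S I A → Cfg S I A → ℕ → Prop} {K' : Cfg S J B → Cfg S J B → ℕ → Prop}
    {H : Prog S J B} (Φ : Cfg S J B → Prop)
    (hH : ∀ C C' n F, K C C' n → Φ F →
      ∃ F', Φ F' ∧ Exec K' H (Cfg.embed e f F C) (Cfg.embed e f F' C') n)
    {p : Prog S I A} {C C' : Cfg S I A} {t : ℕ} (h : Exec K p C C' t) {F : Cfg S J B} (hF : Φ F) :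
    ∃ F', Φ F' ∧ Exec K' (p.subst e f H) (Cfg.embed e f F C) (Cfg.embed e f F' C') t := by
  induction h generalizing F with
  | act w m C => exact ⟨F, hF, .act' (Cfg.embed_act he hf F C w m)⟩
  -- Only here can the background `F` change; all other constructs touch nothing but the embedded
  -- tapes.
  | ask h => exact hH _ _ _ F h hF
  | seq _ _ ih ih' =>
    obtain ⟨F₁, hF₁, h₁⟩ := ih hF
    obtain ⟨F₂, hF₂, h₂⟩ := ih' hF₁
    exact ⟨F₂, hF₂, h₁.seq h₂⟩
  | ite_pos hb _ ih =>
    obtain ⟨F₁, hF₁, h₁⟩ := ih hF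
    exact ⟨F₁, hF₁, .ite_pos (by rwa [Cfg.embed_read he hf]) h₁⟩
  | ite_neg hb _ ih =>
    obtain ⟨F₁, hF₁, h₁⟩ := ih hF
    exact ⟨F₁, hF₁, .ite_neg (by rwa [Cfg.embed_read he hf]) h₁⟩
  | loop_pos hb _ _ ih ih' =>
    obtain ⟨F₁, hF₁, h₁⟩ := ih hF
    obtain ⟨F₂, hF₂, h₂⟩ := ih' hF₁
    exact ⟨F₂, hF₂, .loop_pos (by rwa [Cfg.embed_read he hf]) h₁ h₂⟩
  | loop_neg hb => exact ⟨F, hF, .loop_neg (by rwa [Cfg.embed_read he hf])⟩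
  | mono _ hst ih =>
    obtain ⟨F₁, hF₁, h₁⟩ := ih hF
    exact ⟨F₁, hF₁, h₁.mono hst⟩

end Embed

/-! ### Programs that handle strings -/

section Strings

variable {S I A : Type}

/-- Move all heads. -/
def Cfg.moved (D : I → Move) (C : Cfg S I A) : Cfg S I A where
  tape := C.tape
  head j := C.head j + (D j).toInt

/-- The movement of a single head. -/
noncomputable def only (i : I) (d : Move) : I → Move := fun j => if j = i then d else .stay

theorem Cfg.moved_only (C : Cfg S I A) (i : I) (d : Move) :
    C.moved (only i d) = C.setHead i (C.head i + d.toInt) := by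
  apply Cfg.ext
  · rfl
  · funext j
    by_cases h : j = i
    · subst h; simp [moved, only]
    · simp [moved, only, h, setHead, Move.toInt]

@[simp] theorem Cfg.setHead_setHead (C : Cfg S I A) (i : I) (y z : ℤ) :
    (C.setHead i y).setHead i z = C.setHead i z := by
  simp [setHead]

@[simp] theorem Cfg.setTape_setTape (C : Cfg S I A) (i : I) (T U : Tape S A) :
    (C.setTape i T).setTape i U = C.setTape i U := by
  simp [setTape]

theorem Cfg.setTape_setHead (C : Cfg S I A) (i j : I) (T : Tape S A) (z : ℤ) :
    (C.setHead j z).setTape i T = (C.setTape i T).setHead j z := rfl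

theorem Cfg.setTape_comm (C : Cfg S I A) {i j : I} (h : i ≠ j) (T U : Tape S A) :
    (C.setTape i T).setTape j U = (C.setTape j U).setTape i T := by
  simp [setTape, Function.update_comm h]

theorem Cfg.setHead_eq {C : Cfg S I A} {i : I} {z : ℤ} (h : C.head i = z) : C.setHead i z = C := by
  subst h; simp [setHead]

theorem Cfg.setTape_eq {C : Cfg S I A} {i : I} {T : Tape S A} (h : C.tape i = T) :
    C.setTape i T = C := by
  subst h; simp [setTape]

/-- Move all heads. -/
def Prog.shift (D : I → Move) : Prog S I A := .act (fun r => r) fun _ => D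

/-- Write on one tape, then move all heads. -/
noncomputable def Prog.put (i : I) (g : (I → Symb S A) → Symb S A) (D : I → Move) : Prog S I A :=
  .act (fun r => Function.update r i (g r)) fun _ => D

variable {K : Cfg S I A → Cfg S I A → ℕ → Prop}

theorem Exec.shift (D : I → Move) (C : Cfg S I A) : Exec K (.shift D) C (C.moved D) 1 :=
  .act' (by simp [Cfg.act, Cfg.moved, Cfg.read])

theorem Exec.put (i : I) (g : (I → Symb S A) → Symb S A) (D : I → Move) (C : Cfg S I A) :
    Exec K (.put i g D) C
      ((C.setTape i (Function.update (C.tape i) (C.head i) (g C.read))).moved D) 1 := by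
  refine .act' (Cfg.ext ?_ rfl)
  funext j
  by_cases h : j = i
  · subst h; simp [Cfg.act, Cfg.moved]
  · simp [Cfg.act, Cfg.moved, Cfg.setTape, Cfg.read, h]

theorem Exec.moveHead (i : I) (d : Move) (C : Cfg S I A) (z : ℤ) :
    Exec K (.shift (only i d)) (C.setHead i z) (C.setHead i (z + d.toInt)) 1 := by
  have := Exec.shift (K := K) (only i d) (C.setHead i z)
  rwa [Cfg.moved_only, Cfg.setHead_setHead, Cfg.setHead_head_self] at this

/-- A scan over `n` cells. -/
theorem Exec.scan (i : I) (d : Move) {b : (I → Symb S A) → Prop} (C : Cfg S I A) (z : ℤ) (n : ℕ)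
    (hb : ∀ k < n, b (C.setHead i (z + k * d.toInt)).read)
    (hn : ¬ b (C.setHead i (z + n * d.toInt)).read) :
    Exec K (.loop b (.shift (only i d))) (C.setHead i z) (C.setHead i (z + n * d.toInt))
      (2 * n + 1) := by
  have := Exec.loop_iterate (K := K) (b := b) (p := .shift (only i d))
    (fun k => C.setHead i (z + k * d.toInt)) n 1 hb
    (fun k _ => by
      have := Exec.moveHead (K := K) i d C (z + k * d.toInt)
      rwa [add_assoc, ← add_one_mul, ← Nat.cast_succ] at this) hn
  simp only [Nat.cast_zero, zero_mul, add_zero] at this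
  exact this.mono (by omega)

@[simp] theorem toInt_left : Move.left.toInt = -1 := rfl
@[simp] theorem toInt_stay : Move.stay.toInt = 0 := rfl
@[simp] theorem toInt_right : Move.right.toInt = 1 := rfl

/-- The scanned symbol is a letter. -/
def IsLetter (i : I) (r : I → Symb S A) : Prop := (r i).letter ≠ none

theorem isLetter_setHead {C : Cfg S I A} {i : I} {w : List S} (h : C.tape i = Tape.ofString w)
    {z : ℤ} (h0 : 0 ≤ z) (h1 : z < w.length) : IsLetter i (C.setHead i z).read := by
  obtain ⟨k, rfl⟩ := Int.eq_ofNat_of_zero_le h0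
  have hk : k < w.length := by exact_mod_cast h1
  simp [IsLetter, Cfg.read, h, Tape.ofString_of_lt w hk]

theorem not_isLetter_setHead {C : Cfg S I A} {i : I} {w : List S}
    (h : C.tape i = Tape.ofString w) {z : ℤ} (hz : z < 0 ∨ (w.length : ℤ) ≤ z) :
    ¬ IsLetter i (C.setHead i z).read := by
  rcases hz with hz | hz
  · simp [IsLetter, Cfg.read, h, Tape.ofString_of_neg w hz]
  · simp [IsLetter, Cfg.read, h, Tape.ofString_of_le w hz]

/-- Return to the start of a string from its end. -/
noncomputable def Prog.rewind (i : I) : Prog S I A :=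
  .shift (only i .left) ;; .loop (IsLetter i) (.shift (only i .left)) ;; .shift (only i .right)

/-- At the end of the string the head scans a blank, so it has to step left before the scan. The
scan stops in the blank cell `-1`, and the last move corrects this. -/
theorem Exec.rewind (i : I) (C : Cfg S I A) (w : List S) (h : C.tape i = Tape.ofString w) {n : ℕ}
    (hn : n ≤ w.length) : Exec K (.rewind i) (C.setHead i n) (C.setHead i 0) (2 * n + 3) := by
  have h2 := Exec.scan (K := K) i .left (b := IsLetter i) C (n + Move.left.toInt) n
    (fun k hk => isLetter_setHead h (by simp; omega) (by simp; omega))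
    (not_isLetter_setHead h (by simp))
  have h3 := (Exec.moveHead (K := K) i .left C n).seq (h2.seq (Exec.moveHead i .right C _))
  rw [show (n : ℤ) + Move.left.toInt + n * Move.left.toInt + Move.right.toInt = 0 by simp] at h3
  exact h3.mono (by omega)

/-- Erase a string. -/
noncomputable def Prog.eraseString (i : I) : Prog S I A :=
  .loop (IsLetter i) (.shift (only i .right)) ;; .shift (only i .left) ;;
    .loop (IsLetter i) (.put i (fun _ => none) (only i .left)) ;; .shift (only i .right)

theorem Tape.update_ofString_concat (a : List S) (s : S) :
    Function.update (Tape.ofString (a ++ [s]) : Tape S A) (a.length : ℤ) none =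
      Tape.ofString a := by
  rw [Tape.ofString_concat, Function.update_idem]
  funext z
  by_cases h : z = a.length
  · subst h; rw [Function.update_self, Tape.ofString_of_le _ le_rfl]
  · rw [Function.update_of_ne h]

/-- Letters are removed from the right, so that the inscription is a prefix of `w` all the time. -/
theorem Exec.eraseString (i : I) (C : Cfg S I A) (w : List S) (h : C.tape i = Tape.ofString w)
    (h0 : C.head i = 0) :
    Exec K (.eraseString i) C (C.setTape i Tape.blank) (5 * w.length + 5) := by
  have h1 := Exec.scan (K := K) i .right (b := IsLetter i) C 0 w.length
    (fun k hk => isLetter_setHead h (by simp) (by simpa using hk))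
    (not_isLetter_setHead h (by simp))
  rw [Cfg.setHead_eq h0] at h1
  have h2 := Exec.moveHead (K := K) i .left C (0 + (w.length : ℤ) * Move.right.toInt)
  have h3 : Exec K (.loop (IsLetter i) (.put i (fun _ => none) (only i .left)))
      (C.setHead i ((w.length : ℤ) - 1)) ((C.setTape i Tape.blank).setHead i (-1))
      (w.length * (1 + 1) + 1) := by
    have := Exec.loop_iterate (K := K) (b := IsLetter i)
      (p := .put i (fun _ => none) (only i .left))
      (fun k => (C.setTape i (Tape.ofString (w.take (w.length - k)))).setHead i
        ((w.length : ℤ) - 1 - k)) w.length 1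
      (fun k hk => isLetter_setHead (Cfg.setTape_tape_self _ _ _) (by omega) (by simp; omega))
      (fun k hk => by
        have := Exec.put (K := K) i (fun _ => none) (only i .left)
          ((C.setTape i (Tape.ofString (w.take (w.length - k)))).setHead i
            ((w.length : ℤ) - 1 - k))
        rw [Cfg.moved_only, Cfg.setTape_setHead, Cfg.setTape_setTape] at this
        simp only [Cfg.setHead_setHead, Cfg.setHead_tape, Cfg.setTape_tape_self,
          Cfg.setHead_head_self, toInt_left] at this
        have hl : w.length - k = w.length - (k + 1) + 1 := by omega
        have hlt : w.length - (k + 1) < w.length := by omega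
        rw [hl, List.take_add_one, List.getElem?_eq_getElem hlt, Option.toList_some] at this
        have hlen : ((w.length : ℤ) - 1 - k) = (w.take (w.length - (k + 1))).length := by
          simp; omega
        rw [hlen, Tape.update_ofString_concat] at this
        convert this using 2
        · rw [hl, List.take_add_one, List.getElem?_eq_getElem hlt, Option.toList_some]
        · simp; omega)
      (not_isLetter_setHead (Cfg.setTape_tape_self _ _ _) (by left; omega))
    simpa [Cfg.setTape_eq h] using this
  have h4 := Exec.moveHead (K := K) i .right (C.setTape i Tape.blank) (-1)
  simp only [toInt_right, toInt_left, zero_add, mul_one, neg_add_cancel] at h1 h2 h4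
  rw [Cfg.setHead_eq (C := C.setTape i Tape.blank) h0] at h4
  exact (h1.seq (h2.seq (h3.seq h4))).mono (by omega)

/-- Append the letters that `rd` reads to the string on the tape `i`, until there is none,
with the head movements `D` on the other tapes. -/
noncomputable def Prog.copy (rd : (I → Symb S A) → Option S) (i : I) (D : I → Move) :
    Prog S I A :=
  .loop (fun r => rd r ≠ none)
    (.put i (fun r => (rd r).map Sum.inl) (Function.update D i .right))

/-- Copying of the string `w`: the configurations `G k` describe the other tapes. -/
theorem Exec.copy (rd : (I → Symb S A) → Option S) (i : I) (D : I → Move) (G : ℕ → Cfg S I A)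
    (v w : List S)
    (hG : ∀ k < w.length, ∀ j ≠ i, (G (k + 1)).tape j = (G k).tape j ∧
      (G (k + 1)).head j = (G k).head j + (D j).toInt)
    (hrd : ∀ k ≤ w.length, ∀ r : I → Symb S A, (∀ j ≠ i, r j = (G k).read j) → rd r = w[k]?) :
    Exec K (.copy rd i D) (((G 0).setTape i (Tape.ofString v)).setHead i v.length)
      (((G w.length).setTape i (Tape.ofString (v ++ w))).setHead i (v.length + w.length))
      (2 * w.length + 1) := by
  -- The tape `i` changes during the loop; this is why `hrd` leaves its scanned symbol arbitrary.
  have hr : ∀ k ≤ w.length, rd (((G k).setTape i (Tape.ofString (v ++ w.take k))).setHead i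
      (v.length + k)).read = w[k]? := fun k hk => hrd k hk _ fun j hj => by
    simp [Cfg.read, Cfg.setHead_head_of_ne _ _ hj, Cfg.setTape_tape_of_ne _ _ hj]
  have := Exec.loop_iterate (K := K) (b := fun r => rd r ≠ none)
    (p := .put i (fun r => (rd r).map Sum.inl) (Function.update D i .right))
    (fun k => ((G k).setTape i (Tape.ofString (v ++ w.take k))).setHead i (v.length + k))
    w.length 1
    (fun k hk => by
      rw [hr k hk.le, List.getElem?_eq_getElem hk]
      simp)
    (fun k hk => by
      have := Exec.put (K := K) i (fun r => (rd r).map Sum.inl) (Function.update D i .right)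
        (((G k).setTape i (Tape.ofString (v ++ w.take k))).setHead i (v.length + k))
      convert this using 1
      rw [hr k hk.le, List.getElem?_eq_getElem hk]
      apply Cfg.ext
      · funext j
        by_cases hj : j = i
        · subst hj
          have hlen : (v.length : ℤ) + k = (v ++ w.take k).length := by simp; omega
          simp only [Cfg.setHead_tape, Cfg.moved, Cfg.setTape_tape_self, Cfg.setHead_head_self,
            Option.map_some]
          rw [hlen, ← Tape.ofString_concat, List.take_add_one, List.getElem?_eq_getElem hk,
            Option.toList_some, List.append_assoc]
        · simp [Cfg.setTape_tape_of_ne _ _ hj, Cfg.moved, (hG k hk j hj).1]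
      · funext j
        by_cases hj : j = i
        · subst hj; simp [Cfg.moved]; ring
        · simp [Cfg.setHead_head_of_ne _ _ hj, Cfg.moved, (hG k hk j hj).2, hj])
    (by
      rw [hr _ le_rfl, List.getElem?_eq_none le_rfl]
      simp)
  simp only [List.take_zero, List.append_nil, Nat.cast_zero, add_zero, List.take_length] at this
  exact this.mono (by omega)

end Strings

/-! ### Simulation of an oracle machine by a program -/

/-- The tapes of a simulation: virtual tapes, a tape for the state, and four tapes that hold the
input, a query to the oracle, its last answer, and the output. -/
inductive VTape (W : Type) : Type
  | vt (i : TapeIdx W)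
  | st
  | inp
  | qry
  | ans
  | out

/-- The auxiliary symbols of a simulation: cells of virtual tapes, which hold a symbol if one has
been written there, and carry marks for the origin and for the position of the head; and states
together with the information whether the oracle has been consulted. -/
inductive VSym (S Q A : Type) : Type
  | cell (x : Option (Symb S A)) (org hd : Bool)
  | st (q : Q) (asked : Bool)

/-! ### Virtual tapes as intervals of marked cells. -/

section Cells

variable {S Q A : Type}

/-- The symbol written in a cell. -/
def cellVal : Symb S (VSym S Q A) → Option (Symb S A)
  | some (Sum.inr (.cell x _ _)) => x
  | _ => none

/-- The origin mark of a cell. -/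
def cellOrg : Symb S (VSym S Q A) → Bool
  | some (Sum.inr (.cell _ o _)) => o
  | _ => false

/-- The head mark of a cell. -/
def cellHd : Symb S (VSym S Q A) → Bool
  | some (Sum.inr (.cell _ _ h)) => h
  | _ => false

/-- The letter in a cell. -/
def cellLetter (x : Symb S (VSym S Q A)) : Option S := (cellVal x).bind Symb.letter

/-- The virtual tape with inscription `T`, of which the cells from `L` to `R` have been visited,
and with a head mark in `m`. -/
def vtape (T : ℤ → Option (Symb S A)) (L R : ℤ) (m : Option ℤ) : Tape S (VSym S Q A) := fun z =>
  if L ≤ z ∧ z ≤ R then some (Sum.inr (.cell (T z) (decide (z = 0)) (decide (m = some z))))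
  else none

variable {T : ℤ → Option (Symb S A)} {L R : ℤ} {m : Option ℤ} {z : ℤ}

theorem vtape_mem (h : L ≤ z) (h' : z ≤ R) : (vtape T L R m z : Symb S (VSym S Q A)) =
    some (Sum.inr (.cell (T z) (decide (z = 0)) (decide (m = some z)))) :=
  if_pos ⟨h, h'⟩

theorem vtape_notMem (h : z < L ∨ R < z) : (vtape T L R m z : Symb S (VSym S Q A)) = none :=
  if_neg (by omega)

theorem cellVal_vtape (hT : ∀ z, ¬ (L ≤ z ∧ z ≤ R) → T z = none) :
    cellVal (vtape T L R m z : Symb S (VSym S Q A)) = T z := by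
  by_cases h : L ≤ z ∧ z ≤ R
  · rw [vtape_mem h.1 h.2]; rfl
  · rw [vtape_notMem (by omega), hT z h]; rfl

theorem cellOrg_vtape (hL : L ≤ 0) (hR : 0 ≤ R) :
    cellOrg (vtape T L R m z : Symb S (VSym S Q A)) = decide (z = 0) := by
  by_cases h : L ≤ z ∧ z ≤ R
  · rw [vtape_mem h.1 h.2]; rfl
  · have : z ≠ 0 := by omega
    rw [vtape_notMem (by omega)]; simp [cellOrg, this]

theorem cellHd_vtape (hm : ∀ z, m = some z → L ≤ z ∧ z ≤ R) :
    cellHd (vtape T L R m z : Symb S (VSym S Q A)) = decide (m = some z) := by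
  by_cases h : L ≤ z ∧ z ≤ R
  · rw [vtape_mem h.1 h.2]; rfl
  · have : m ≠ some z := fun h' => h (hm z h')
    rw [vtape_notMem (by omega)]; simp [cellHd, this]

/-- The cell `z` lies in the visited interval or is adjacent to it, so the visited cells remain an
interval. Copying the origin mark is correct for a new cell too, because the origin is already in
the interval. -/
theorem vtape_update (hL : L ≤ 0) (hR : 0 ≤ R) (h : L - 1 ≤ z) (h' : z ≤ R + 1)
    (v : Option (Symb S A)) (m' : Option ℤ) (hm : ∀ y, y ≠ z → (m = some y ↔ m' = some y)) :
    Function.update (vtape T L R m : Tape S (VSym S Q A)) z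
      (some (Sum.inr (.cell v (cellOrg (vtape T L R m z : Symb S (VSym S Q A)))
        (decide (m' = some z))))) =
      vtape (Function.update T z v) (min L z) (max R z) m' := by
  funext y
  by_cases hy : y = z
  · subst hy
    rw [Function.update_self, cellOrg_vtape hL hR, vtape_mem (by omega) (by omega),
      Function.update_self]
  · rw [Function.update_of_ne hy]
    by_cases hLR : L ≤ y ∧ y ≤ R
    · rw [vtape_mem hLR.1 hLR.2, vtape_mem (by omega) (by omega), Function.update_of_ne hy]
      simp only [hm y hy]
    · rw [vtape_notMem (by omega), vtape_notMem (by omega)]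

end Cells

/-! ### Movements, searches and erasure on virtual tapes. -/

section Simulation

variable {S : Type} (M : OracleMachine S)

/-- The symbols of the simulation of `M`. -/
abbrev VSymb : Type := Symb S (VSym S M.Q M.A)

/-- The configurations of the simulation of `M`. -/
abbrev VCfg : Type := Cfg S (VTape M.W) (VSym S M.Q M.A)

/-- The programs in the simulation of `M`. -/
abbrev VProg : Type := Prog S (VTape M.W) (VSym S M.Q M.A)

variable {M}

/-- The configuration with the state symbol `σ`, the virtual tapes `V` with heads `H`, the input
`x`, the last answer `y`, the query `q` and the output `o`. -/
noncomputable def vcfg (σ : VSymb M) (V : TapeIdx M.W → Tape S (VSym S M.Q M.A))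
    (H : TapeIdx M.W → ℤ) (x y q o : List S) : VCfg M where
  tape j := match j with
    | .vt i => V i
    | .st => Function.update Tape.blank 0 σ
    | .inp => Tape.ofString x
    | .qry => Tape.ofString q
    | .ans => Tape.ofString y
    | .out => Tape.ofString o
  head j := match j with
    | .vt i => H i
    | .inp => H .input
    | .ans => H .answer
    | _ => 0

/-- Move the head of a virtual tape; the heads on the input and on the answer of the oracle
follow. -/
noncomputable def vmove {W : Type} (i : TapeIdx W) (d : Move) : VTape W → Move
  | .vt j => if j = i then d else .stay
  | .inp => if .input = i then d else .stay
  | .ans => if .answer = i then d else .stay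
  | _ => .stay

variable {σ : VSymb M} {V : TapeIdx M.W → Tape S (VSym S M.Q M.A)} {H : TapeIdx M.W → ℤ}
  {x y q o : List S} {i : TapeIdx M.W}

/-- In `vcfg` the heads on `inp` and `ans` stand where the heads of the virtual input and answer
tapes stand; `vmove` preserves this. -/
theorem vcfg_moved (d : Move) (z : ℤ) : (vcfg σ V (Function.update H i z) x y q o).moved (vmove i d) =
    vcfg σ V (Function.update H i (z + d.toInt)) x y q o := by
  apply Cfg.ext
  · rfl
  · funext j
    cases j with
    | vt j => by_cases h : j = i <;> simp [vcfg, Cfg.moved, vmove, h]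
    | inp => by_cases h : .input = i <;> simp [vcfg, Cfg.moved, vmove, Function.update, h]
    | ans => by_cases h : .answer = i <;> simp [vcfg, Cfg.moved, vmove, Function.update, h]
    | _ => simp [vcfg, Cfg.moved, vmove]

theorem vcfg_setTape (T : Tape S (VSym S M.Q M.A)) : (vcfg σ V H x y q o).setTape (.vt i) T =
    vcfg σ (Function.update V i T) H x y q o := by
  apply Cfg.ext
  · funext j
    cases j with
    | vt j => by_cases h : j = i <;> simp [vcfg, Cfg.setTape, Function.update, h]
    | _ => simp [vcfg, Cfg.setTape]
  · rfl

variable {K : VCfg M → VCfg M → ℕ → Prop}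

theorem Exec.vshift (d : Move) (z : ℤ) :
    Exec K (.shift (vmove i d)) (vcfg σ V (Function.update H i z) x y q o)
      (vcfg σ V (Function.update H i (z + d.toInt)) x y q o) 1 := by
  have := Exec.shift (K := K) (vmove i d) (vcfg σ V (Function.update H i z) x y q o)
  rwa [vcfg_moved] at this

/-- Process the cells of a virtual tape, starting with the scanned one, as long as `P` holds. -/
noncomputable def Prog.sweep (i : TapeIdx M.W) (P : VSymb M → Prop) (g : VSymb M → VSymb M)
    (d : Move) : VProg M :=
  .loop (fun r => P (r (.vt i))) (.put (.vt i) (fun r => g (r (.vt i))) (vmove i d))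

/-- `U k` is the virtual tape after `k` processed cells. With the intermediate tapes given in closed
form, no use of the lemma needs an induction of its own. -/
theorem Exec.sweep (P : VSymb M → Prop) (g : VSymb M → VSymb M) (d : Move)
    (U : ℕ → Tape S (VSym S M.Q M.A)) (z : ℤ) (n : ℕ)
    (hP : ∀ k < n, P (U k (z + k * d.toInt))) (hn : ¬ P (U n (z + n * d.toInt)))
    (hU : ∀ k < n, U (k + 1) =
      Function.update (U k) (z + k * d.toInt) (g (U k (z + k * d.toInt)))) :
    Exec K (.sweep i P g d) (vcfg σ (Function.update V i (U 0)) (Function.update H i z) x y q o)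
      (vcfg σ (Function.update V i (U n)) (Function.update H i (z + n * d.toInt)) x y q o)
      (2 * n + 1) := by
  have hr : ∀ k, (vcfg σ (Function.update V i (U k)) (Function.update H i (z + k * d.toInt))
      x y q o).read (.vt i) = U k (z + k * d.toInt) := fun k => by simp [Cfg.read, vcfg]
  have := Exec.loop_iterate (K := K) (b := fun r => P (r (.vt i)))
    (p := .put (.vt i) (fun r => g (r (.vt i))) (vmove i d))
    (fun k => vcfg σ (Function.update V i (U k)) (Function.update H i (z + k * d.toInt)) x y q o)
    n 1 (fun k hk => by simpa only [hr] using hP k hk)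
    (fun k hk => by
      have := Exec.put (K := K) (.vt i) (fun r => g (r (.vt i))) (vmove i d)
        (vcfg σ (Function.update V i (U k)) (Function.update H i (z + k * d.toInt)) x y q o)
      rw [hr, vcfg_setTape, vcfg_moved] at this
      have e1 : (vcfg σ (Function.update V i (U k)) (Function.update H i (z + k * d.toInt))
        x y q o).tape (.vt i) = U k := by simp [vcfg]
      have e2 : (vcfg σ (Function.update V i (U k)) (Function.update H i (z + k * d.toInt))
        x y q o).head (.vt i) = z + k * d.toInt := by simp [vcfg]
      rw [e1, e2, ← hU k hk, Function.update_idem] at this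
      rwa [Nat.cast_succ, add_one_mul, ← add_assoc]) (by simpa only [hr] using hn)
  simp only [Nat.cast_zero, zero_mul, add_zero] at this
  exact this.mono (by omega)

theorem Exec.vscan (P : VSymb M → Prop) (d : Move) (z : ℤ) (n : ℕ)
    (hP : ∀ k < n, P (V i (z + k * d.toInt))) (hn : ¬ P (V i (z + n * d.toInt))) :
    Exec K (.sweep i P id d) (vcfg σ V (Function.update H i z) x y q o)
      (vcfg σ V (Function.update H i (z + n * d.toInt)) x y q o) (2 * n + 1) := by
  have := Exec.sweep (K := K) (σ := σ) (V := V) (H := H) (x := x) (y := y) (q := q) (o := o) (i := i) P id d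
    (fun _ => V i) z n hP hn (fun k _ => by simp)
  rwa [Function.update_eq_self] at this

/-- Go left beyond the visited cells. -/
noncomputable def Prog.leftEnd (i : TapeIdx M.W) : VProg M := .sweep i (· ≠ none) id .left

/-- Go to the leftmost cell with property `P`. -/
noncomputable def Prog.seek (i : TapeIdx M.W) (P : VSymb M → Prop) : VProg M :=
  .leftEnd i ;; .shift (vmove i .right) ;; .sweep i (fun c => ¬ P c) id .right

/-- Erase the symbols on a virtual tape and go to the origin. -/
noncomputable def Prog.clear (i : TapeIdx M.W) : VProg M :=
  .leftEnd i ;; .shift (vmove i .right) ;;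
    .sweep i (· ≠ none) (fun c => some (Sum.inr (.cell none (cellOrg c) (cellHd c)))) .right ;;
    .shift (vmove i .left) ;; .seek i (fun c => cellOrg c = true)

/-- Make a virtual tape blank and go to the origin. -/
noncomputable def Prog.clean (i : TapeIdx M.W) : VProg M :=
  .leftEnd i ;; .shift (vmove i .right) ;;
    .sweep i (· ≠ none) (fun c => if cellOrg c then c else none) .right ;;
    .shift (vmove i .left) ;; .sweep i (fun c => cellOrg c = false) id .left ;;
    .put (.vt i) (fun _ => none) (vmove i .stay)

section

variable {T : ℤ → Option (Symb S M.A)} {L R : ℤ} {m : Option ℤ} {h : ℤ} {N : ℕ}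

/-- A visited cell is never blank, even if no symbol is stored in it, so the scan ends exactly in `L
- 1`. It passes at most `2 * N + 1` cells at cost 2 each. -/
theorem Exec.leftEnd (hV : V i = vtape T L R m) (h1 : L - 1 ≤ h) (h2 : h ≤ R) (hL : -(N : ℤ) ≤ L)
    (hR : R ≤ N) :
    Exec K (.leftEnd i) (vcfg σ V (Function.update H i h) x y q o)
      (vcfg σ V (Function.update H i (L - 1)) x y q o) (4 * N + 3) := by
  have := Exec.vscan (K := K) (σ := σ) (V := V) (H := H) (x := x) (y := y) (q := q) (o := o) (i := i)
    (· ≠ none) .left h (h - (L - 1)).toNat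
    (fun k hk => by
      rw [hV, toInt_left, vtape_mem (by omega) (by omega)]
      simp)
    (by
      rw [hV, toInt_left, vtape_notMem (by omega)]
      simp)
  rw [toInt_left, show h + ((h - (L - 1)).toNat : ℤ) * -1 = L - 1 by omega] at this
  exact this.mono (by omega)

theorem Exec.seek {P : VSymb M → Prop} {z : ℤ} (hV : V i = vtape T L R m) (h1 : L - 1 ≤ h)
    (h2 : h ≤ R) (hL : -(N : ℤ) ≤ L) (hR : R ≤ N) (hz : L ≤ z) (hz' : z ≤ R)
    (hP : ∀ y, L ≤ y → y < z → ¬ P (V i y)) (hP' : P (V i z)) :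
    Exec K (.seek i P) (vcfg σ V (Function.update H i h) x y q o)
      (vcfg σ V (Function.update H i z) x y q o) (8 * N + 5) := by
  have h3 := Exec.vscan (K := K) (σ := σ) (V := V) (H := H) (x := x) (y := y) (q := q) (o := o) (i := i)
    (fun c => ¬ P c) .right L (z - L).toNat
    (fun k hk => by
      rw [toInt_right]
      exact hP _ (by omega) (by omega))
    (by
      rw [toInt_right, show L + ((z - L).toNat : ℤ) * 1 = z by omega]
      simpa using hP')
  rw [toInt_right, show L + ((z - L).toNat : ℤ) * 1 = z by omega] at h3
  have h4 := Exec.vshift (K := K) (σ := σ) (V := V) (H := H) (x := x) (y := y) (q := q) (o := o) (i := i)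
    .right (L - 1)
  rw [toInt_right, sub_add_cancel] at h4
  exact ((Exec.leftEnd hV h1 h2 hL hR).seq (h4.seq h3)).mono (by omega)

theorem Exec.seek_org (hV : V i = vtape T L R m) (h1 : L - 1 ≤ h)
    (h2 : h ≤ R) (hL : -(N : ℤ) ≤ L) (hR : R ≤ N) (hL0 : L ≤ 0) (hR0 : 0 ≤ R) :
    Exec K (.seek i (fun c => cellOrg c = true)) (vcfg σ V (Function.update H i h) x y q o)
      (vcfg σ V (Function.update H i 0) x y q o) (8 * N + 5) := by
  refine Exec.seek hV h1 h2 hL hR hL0 hR0 (fun y _ hy => ?_) ?_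
  · rw [hV, cellOrg_vtape hL0 hR0]; simp; omega
  · rw [hV, cellOrg_vtape hL0 hR0]; simp

theorem Exec.seek_hd {z : ℤ} (hV : V i = vtape T L R (some z)) (h1 : L - 1 ≤ h)
    (h2 : h ≤ R) (hL : -(N : ℤ) ≤ L) (hR : R ≤ N) (hz : L ≤ z) (hz' : z ≤ R) :
    Exec K (.seek i (fun c => cellHd c = true)) (vcfg σ V (Function.update H i h) x y q o)
      (vcfg σ V (Function.update H i z) x y q o) (8 * N + 5) := by
  have hm : ∀ z', some z = some z' → L ≤ z' ∧ z' ≤ R := by rintro _ ⟨⟩; exact ⟨hz, hz'⟩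
  refine Exec.seek hV h1 h2 hL hR hz hz' (fun y _ hy => ?_) ?_
  · rw [hV, cellHd_vtape hm]; simp; omega
  · rw [hV, cellHd_vtape hm]; simp

/-- This prepares the virtual answer tape for a new answer: once the written symbols are forgotten,
its cells stand for the string on `ans` again, whereas the marks of origin and head survive. -/
theorem Exec.clear (hV : V i = vtape T L R m) (h1 : L - 1 ≤ h) (h2 : h ≤ R) (hL : -(N : ℤ) ≤ L)
    (hR : R ≤ N) (hL0 : L ≤ 0) (hR0 : 0 ≤ R) :
    Exec K (.clear i) (vcfg σ V (Function.update H i h) x y q o)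
      (vcfg σ (Function.update V i (vtape (fun _ => none) L R m)) (Function.update H i 0) x y q o)
      (16 * N + 13) := by
  set n := (R + 1 - L).toNat with hn
  have h3 := Exec.sweep (K := K) (σ := σ) (V := V) (H := H) (x := x) (y := y) (q := q) (o := o) (i := i)
    (· ≠ none) (fun c => some (Sum.inr (.cell none (cellOrg c) (cellHd c)))) .right
    (fun k => vtape (fun z => if z < L + k then none else T z) L R m) L n
    (fun k hk => by
      rw [toInt_right, vtape_mem (by omega) (by omega)]
      simp)
    (by
      rw [toInt_right, vtape_notMem (by omega)]
      simp)
    (fun k hk => by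
      rw [toInt_right, mul_one]
      funext z
      by_cases hz : z = L + k
      · subst hz
        rw [Function.update_self, vtape_mem (by omega) (by omega),
          vtape_mem (by omega) (by omega)]
        simp [cellOrg, cellHd]
      · rw [Function.update_of_ne hz]
        have : z < L + (k + 1) ↔ z < L + k := by omega
        simp only [vtape, Nat.cast_succ, this])
  have e0 : (vtape (fun z => if z < L + (0 : ℕ) then none else T z) L R m :
      Tape S (VSym S M.Q M.A)) = V i := by
    rw [hV]
    funext z
    by_cases hz : L ≤ z ∧ z ≤ R
    · rw [vtape_mem hz.1 hz.2, vtape_mem hz.1 hz.2, if_neg (by simp; omega)]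
    · rw [vtape_notMem (by omega), vtape_notMem (by omega)]
  have e1 : (vtape (fun z => if z < L + n then none else T z) L R m :
      Tape S (VSym S M.Q M.A)) = vtape (fun _ => none) L R m := by
    funext z
    by_cases hz : L ≤ z ∧ z ≤ R
    · rw [vtape_mem hz.1 hz.2, vtape_mem hz.1 hz.2, if_pos (by omega)]
    · rw [vtape_notMem (by omega), vtape_notMem (by omega)]
  rw [e0, e1, Function.update_eq_self, toInt_right, mul_one,
    show L + (n : ℤ) = R + 1 by omega] at h3
  have h4 := Exec.vshift (K := K) (σ := σ) (V := V) (H := H) (x := x) (y := y) (q := q) (o := o) (i := i)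
    .right (L - 1)
  rw [toInt_right, sub_add_cancel] at h4
  have h5 := Exec.vshift (K := K) (σ := σ)
    (V := Function.update V i (vtape (fun _ => none) L R m)) (H := H) (x := x) (y := y) (q := q) (o := o)
    (i := i) .left (R + 1)
  rw [toInt_left, show R + 1 + -1 = R by omega] at h5
  have h6 := Exec.seek_org (K := K) (σ := σ)
    (V := Function.update V i (vtape (fun _ => none) L R m)) (H := H) (x := x) (y := y) (q := q) (o := o)
    (i := i) (h := R) (Function.update_self ..) (by omega) le_rfl hL hR hL0 hR0
  exact ((Exec.leftEnd hV h1 h2 hL hR).seq (h4.seq (h3.seq (h5.seq h6)))).mono (by omega)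

/-- The sweep spares the origin, the only landmark by which the head can find the cell 0 again; it
is erased last. -/
theorem Exec.clean (hV : V i = vtape T L R m) (h1 : L - 1 ≤ h) (h2 : h ≤ R) (hL : -(N : ℤ) ≤ L)
    (hR : R ≤ N) (hL0 : L ≤ 0) (hR0 : 0 ≤ R) :
    Exec K (.clean i) (vcfg σ V (Function.update H i h) x y q o)
      (vcfg σ (Function.update V i Tape.blank) (Function.update H i 0) x y q o)
      (10 * N + 10) := by
  set n := (R + 1 - L).toNat with hn
  set U : ℕ → Tape S (VSym S M.Q M.A) :=
    fun k z => if z < L + k ∧ z ≠ 0 then none else vtape T L R m z with hU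
  have h3 := Exec.sweep (K := K) (σ := σ) (V := V) (H := H) (x := x) (y := y) (q := q) (o := o) (i := i)
    (· ≠ none) (fun c => if cellOrg c then c else none) .right U L n
    (fun k hk => by
      rw [toInt_right]
      simp only [hU]
      rw [if_neg (by omega), vtape_mem (by omega) (by omega)]
      simp)
    (by
      rw [toInt_right]
      simp only [hU]
      rw [if_neg (by omega), vtape_notMem (by omega)]
      simp)
    (fun k hk => by
      rw [toInt_right, mul_one]
      funext z
      by_cases hz : z = L + k
      · subst hz
        rw [Function.update_self]
        simp only [hU]
        rw [if_neg (c := L + (k : ℤ) < L + k ∧ _) (by omega), cellOrg_vtape hL0 hR0]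
        by_cases h0 : L + (k : ℤ) = 0 <;> simp [h0]
      · rw [Function.update_of_ne hz]
        have : z < L + (k + 1) ↔ z < L + k := by omega
        simp only [hU, Nat.cast_succ, this])
  have e0 : U 0 = V i := by
    rw [hV]
    funext z
    simp only [hU]
    split_ifs with hz
    · rw [vtape_notMem (by simp at hz; omega)]
    · rfl
  have e1 : U n = Function.update Tape.blank 0 (vtape T L R m 0) := by
    funext z
    simp only [hU]
    by_cases h0 : z = 0
    · subst h0; simp
    · rw [Function.update_of_ne h0]
      split_ifs with hz
      · rfl
      · rw [vtape_notMem (by omega)]; rfl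
  rw [e0, e1, Function.update_eq_self, toInt_right, mul_one,
    show L + (n : ℤ) = R + 1 by omega] at h3
  have h4 := Exec.vshift (K := K) (σ := σ) (V := V) (H := H) (x := x) (y := y) (q := q) (o := o) (i := i)
    .right (L - 1)
  rw [toInt_right, sub_add_cancel] at h4
  set V' := Function.update V i (Function.update Tape.blank 0 (vtape T L R m 0)) with hV'
  have h5 := Exec.vshift (K := K) (σ := σ) (V := V') (H := H) (x := x) (y := y) (q := q) (o := o)
    (i := i) .left (R + 1)
  rw [toInt_left, show R + 1 + -1 = R by omega] at h5
  have h6 := Exec.vscan (K := K) (σ := σ) (V := V') (H := H) (x := x) (y := y) (q := q) (o := o) (i := i)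
    (fun c => cellOrg c = false) .left R R.toNat
    (fun k hk => by
      rw [hV', Function.update_self, toInt_left, Function.update_of_ne (by omega)]
      rfl)
    (by
      rw [hV', Function.update_self, toInt_left, show R + (R.toNat : ℤ) * -1 = 0 by omega,
        Function.update_self, cellOrg_vtape hL0 hR0]
      simp)
  rw [toInt_left, show R + (R.toNat : ℤ) * -1 = 0 by omega] at h6
  have h7 := Exec.put (K := K) (.vt i) (fun _ => none) (vmove i .stay)
    (vcfg σ V' (Function.update H i 0) x y q o)
  have e2 : (vcfg σ V' (Function.update H i 0) x y q o).tape (.vt i) =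
    Function.update Tape.blank 0 (vtape T L R m 0) := by simp [vcfg, hV']
  have e3 : (vcfg σ V' (Function.update H i 0) x y q o).head (.vt i) = 0 := by simp [vcfg]
  have e4 : Function.update (Tape.blank : Tape S (VSym S M.Q M.A)) 0 none = Tape.blank :=
    Function.update_eq_self (f := Tape.blank) 0
  rw [vcfg_setTape, vcfg_moved, e2, e3, toInt_stay, add_zero] at h7
  rw [Function.update_idem, hV', Function.update_idem, e4] at h7
  exact ((Exec.leftEnd hV h1 h2 hL hR).seq
    (h4.seq (h3.seq (h5.seq (h6.seq h7))))).mono (by omega)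

end

end Simulation

/-! ### Simulation of single steps, of oracle calls and of complete runs. -/

section Simulation

variable {S : Type} {M : OracleMachine S} {σ : VSymb M}
  {V : TapeIdx M.W → Tape S (VSym S M.Q M.A)} {H : TapeIdx M.W → ℤ} {x y q o : List S}
  {i : TapeIdx M.W} {K : VCfg M → VCfg M → ℕ → Prop}

/-- Copy the string on a virtual tape to one of the tapes for strings, starting in the origin. -/
noncomputable def Prog.grab (i : TapeIdx M.W) (j : VTape M.W) : VProg M :=
  .copy (fun r => cellLetter (r (.vt i))) j (vmove i .right) ;; .rewind j ;;
    .shift (vmove i .left)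

/-- The head is left one cell before the end of `w`, and not behind it, where it might be outside
the visited interval; the searches that follow start from a head in `L - 1` or in the interval. -/
theorem Exec.grab {T : ℤ → Option (Symb S M.A)} {L R : ℤ} {m : Option ℤ}
    (hV : V i = vtape T L R m) (hT : ∀ z, ¬ (L ≤ z ∧ z ≤ R) → T z = none) {w : List S}
    (hw : ∀ k (hk : k < w.length), T k = some (some (Sum.inl w[k])))
    (hw' : (T w.length).bind Symb.letter = none) (j : VTape M.W)
    (hj : j = .qry ∧ q = [] ∨ j = .out ∧ o = []) :
    Exec K (.grab i j) (vcfg σ V (Function.update H i 0) x y q o)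
      ((vcfg σ V (Function.update H i ((w.length : ℤ) - 1)) x y q o).setTape j (Tape.ofString w))
      (4 * w.length + 5) := by
  have hl : ∀ k : ℕ, k ≤ w.length → cellLetter (V i k) = w[k]? := by
    intro k hk
    rw [hV, cellLetter, cellVal_vtape hT]
    rcases hk.lt_or_eq with hk | rfl
    · rw [hw k hk, List.getElem?_eq_getElem hk]; rfl
    · rw [hw', List.getElem?_eq_none le_rfl]
  have hvj : ∀ i', j ≠ .vt i' := by rcases hj with ⟨rfl, -⟩ | ⟨rfl, -⟩ <;> simp
  have hjh : ∀ H, (vcfg σ V H x y q o).head j = 0 := by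
    rcases hj with ⟨rfl, -⟩ | ⟨rfl, -⟩ <;> exact fun _ => rfl
  have hjt : ∀ H, (vcfg σ V H x y q o).tape j = Tape.ofString [] := by
    rcases hj with ⟨rfl, rfl⟩ | ⟨rfl, rfl⟩ <;> exact fun _ => rfl
  have h1 := Exec.copy (K := K) (fun r => cellLetter (r (.vt i))) j (vmove i .right)
    (fun k => vcfg σ V (Function.update H i k) x y q o) [] w
    (fun k hk j' _ => by
      refine ⟨rfl, ?_⟩
      have := vcfg_moved (σ := σ) (V := V) (H := H) (x := x) (y := y) (q := q) (o := o) (i := i)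
        .right k
      rw [Nat.cast_succ, ← toInt_right, ← this]
      rfl)
    (fun k hk r hr => by
      rw [hr _ (hvj i).symm, ← hl k hk]
      simp [Cfg.read, vcfg])
  rw [Cfg.setTape_eq (hjt _), Cfg.setHead_eq (by simpa using hjh _), List.nil_append,
    List.length_nil, Nat.cast_zero, zero_add] at h1
  have h2 := Exec.rewind (K := K) j ((vcfg σ V (Function.update H i w.length) x y q o).setTape j
    (Tape.ofString w)) w (Cfg.setTape_tape_self _ _ _) le_rfl
  rw [Cfg.setHead_eq (z := 0) (by simpa using hjh _)] at h2
  have h3 := Exec.shift (K := K) (vmove i .left)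
    ((vcfg σ V (Function.update H i w.length) x y q o).setTape j (Tape.ofString w))
  have e : ((vcfg σ V (Function.update H i w.length) x y q o).setTape j (Tape.ofString w)).moved
      (vmove i .left) =
      (vcfg σ V (Function.update H i ((w.length : ℤ) - 1)) x y q o).setTape j
        (Tape.ofString w) := by
    have := vcfg_moved (σ := σ) (V := V) (H := H) (x := x) (y := y) (q := q) (o := o) (i := i)
        .left w.length
    rw [toInt_left, ← sub_eq_add_neg] at this
    rw [← this]
    rfl
  rw [e] at h3
  exact (h1.seq (h2.seq h3)).mono (by omega)

theorem vcfg_setTape_qry (w : List S) : (vcfg σ V H x y q o).setTape .qry (Tape.ofString w) =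
    vcfg σ V H x y w o := by
  apply Cfg.ext
  · funext j; cases j <;> simp [vcfg, Cfg.setTape]
  · rfl

theorem vcfg_setTape_out (w : List S) : (vcfg σ V H x y q o).setTape .out (Tape.ofString w) =
    vcfg σ V H x y q w := by
  apply Cfg.ext
  · funext j; cases j <;> simp [vcfg, Cfg.setTape]
  · rfl

theorem vcfg_setTape_ans (w : List S) : (vcfg σ V H x y q o).setTape .ans (Tape.ofString w) =
    vcfg σ V H x w q o := by
  apply Cfg.ext
  · funext j; cases j <;> simp [vcfg, Cfg.setTape]
  · rfl

/-- Process the scanned cells of all virtual tapes and the state symbol. -/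
noncomputable def Prog.touch (f g : VSymb M → VSymb M) : VProg M :=
  .act (fun r j => match j with
    | .vt i => f (r (.vt i))
    | .st => g (r .st)
    | j => r j) fun _ _ => .stay

theorem Exec.touch (f g : VSymb M → VSymb M) :
    Exec K (.touch f g) (vcfg σ V H x y q o)
      (vcfg (g σ) (fun i => Function.update (V i) (H i) (f (V i (H i)))) H x y q o) 1 := by
  refine .act' (Cfg.ext ?_ ?_)
  · funext j
    cases j <;> simp [vcfg, Cfg.act, Cfg.read]
  · funext j
    cases j <;> simp [vcfg, Cfg.act]

/-- The symbol in a cell that only holds letters. -/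
def letterSymb (c : VSymb M) : Symb S M.A := c.letter.map Sum.inl

/-- The state in a state symbol. -/
def stState : VSymb M → M.Q
  | some (Sum.inr (.st s _)) => s
  | _ => M.start

/-- The information in a state symbol whether the oracle has been consulted. -/
def stAsked : VSymb M → Bool
  | some (Sum.inr (.st _ b)) => b
  | _ => false

/-- The symbols in the cells that the simulated machine has not written. -/
def vreadBase (r : VTape M.W → VSymb M) (i : TapeIdx M.W) : Symb S M.A :=
  match i with
  | .input => letterSymb (r .inp)
  | .answer => if stAsked (r .st) then letterSymb (r .ans) else none
  | _ => none

/-- The symbols scanned by the simulated machine. -/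
def vread (r : VTape M.W → VSymb M) (i : TapeIdx M.W) : Symb S M.A :=
  (cellVal (r (.vt i))).getD (vreadBase r i)

/-- Simulation of an ordinary step. -/
noncomputable def Prog.vstep : VProg M :=
  .act
    (fun r j => match j with
      | .vt i => some (Sum.inr (.cell (some (M.write (stState (r .st)) (vread r) i))
          (cellOrg (r (.vt i))) false))
      | .st => some (Sum.inr (.st (M.next (stState (r .st)) (vread r)) (stAsked (r .st))))
      | j => r j)
    (fun r j => match j with
      | .vt i => M.move (stState (r .st)) (vread r) i
      | .inp => M.move (stState (r .st)) (vread r) .input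
      | .ans => M.move (stState (r .st)) (vread r) .answer
      | _ => .stay)

/-- Set or remove the head mark in a cell. -/
def setMark (b : Bool) (c : VSymb M) : VSymb M := some (Sum.inr (.cell (cellVal c) (cellOrg c) b))

/-- Simulation of a consultation of the oracle. -/
noncomputable def Prog.vask : VProg M :=
  .touch (setMark true) (fun c => c) ;; .seek .query (fun c => cellOrg c = true) ;; .grab .query .qry ;;
    .seek .query (fun c => cellHd c = true) ;; .clear .answer ;; .ask ;;
    .seek .answer (fun c => cellHd c = true) ;;
    .touch (setMark false) (fun _ => some (Sum.inr (.st M.resume true)))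

/-- The content of the tapes of a machine as far as it has not been written by the machine. -/
def vbase (x y : List S) (asked : Bool) : TapeIdx M.W → Tape S M.A
  | .input => Tape.ofString x
  | .answer => if asked then Tape.ofString y else Tape.blank
  | _ => Tape.blank

/-- The virtual tapes `T`, of which the cells from `L` to `R` have been visited, represent the
configuration `c`. -/
structure VInv (x y : List S) (c : M.Config) (T : TapeIdx M.W → ℤ → Option (Symb S M.A))
    (L R : TapeIdx M.W → ℤ) (asked : Bool) (N : ℕ) : Prop where
  tape_eq : ∀ i z, c.tape i z = (T i z).getD (vbase x y asked i z)
  supp : ∀ i z, ¬ (L i ≤ z ∧ z ≤ R i) → T i z = none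
  left_nonpos : ∀ i, L i ≤ 0
  right_nonneg : ∀ i, 0 ≤ R i
  le_head : ∀ i, L i - 1 ≤ c.head i
  head_le : ∀ i, c.head i ≤ R i + 1
  le_left : ∀ i, -(N : ℤ) ≤ L i
  right_le : ∀ i, R i ≤ N

/-- The configuration `C` of the simulation represents the configuration `c`. -/
def VRep (P : List S → Prop) (x : List S) (c : M.Config) (N : ℕ) (C : VCfg M) : Prop :=
  ∃ T L R asked y, P y ∧ VInv x y c T L R asked N ∧
    C = vcfg (some (Sum.inr (.st c.state asked))) (fun i => vtape (T i) (L i) (R i) none) c.head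
      x y [] []

/-- A cell without a written symbol shows what the parallel head on `inp` or `ans` scans, so neither
the input nor an answer is ever copied to a virtual tape. Until the first consultation the flag
`asked` hides the string on `ans`, which may stem from an earlier run. -/
theorem vread_eq {c : M.Config} {T : TapeIdx M.W → ℤ → Option (Symb S M.A)}
    {L R : TapeIdx M.W → ℤ} {asked : Bool} {N : ℕ} (h : VInv x y c T L R asked N) :
    vread (vcfg (some (Sum.inr (.st c.state asked))) (fun i => vtape (T i) (L i) (R i) none)
      c.head x y q o).read = fun i => c.tape i (c.head i) := by
  have hl : ∀ (w : List S) (z : ℤ), letterSymb (M := M) (Tape.ofString w z) = Tape.ofString w z := by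
    intro w z
    simp only [letterSymb, Tape.ofString]
    split_ifs
    · cases w[z.toNat]? <;> rfl
    · rfl
  funext i
  have hc : cellVal ((vcfg (some (Sum.inr (.st c.state asked)))
      (fun i => vtape (T i) (L i) (R i) none) c.head x y q o).read (.vt i)) = T i (c.head i) :=
    cellVal_vtape (h.supp i)
  rw [vread, h.tape_eq, hc]
  congr 1
  cases i with
  | input => exact hl _ _
  | answer =>
    simp only [vreadBase, vbase, Cfg.read, vcfg, Function.update_self, stAsked]
    cases asked
    · rfl
    · exact hl _ _
  | _ => rfl

/-- A simulated step is a single action. It may extend each visited interval by the scanned cell,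
hence `N + 1`. -/
theorem Exec.vstep {ψ : Baire S} {P : List S → Prop} {c : M.Config} {N : ℕ} {C : VCfg M}
    (h : VRep P x c N C) (hh : c.state ≠ M.halt) (ho : c.state ≠ M.oracle) :
    ∃ C', VRep P x (M.step ψ c) (N + 1) C' ∧ Exec K .vstep C C' 1 := by
  obtain ⟨T, L, R, asked, y, hy, hI, rfl⟩ := h
  have hstep := M.step_of_ne (φ := ψ) hh ho
  have hH := hI.le_head
  have hH' := hI.head_le
  have hL := hI.le_left
  have hR := hI.right_le
  have hL0 := hI.left_nonpos
  have hR0 := hI.right_nonneg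
  refine ⟨_, ⟨fun i => Function.update (T i) (c.head i)
    (some (M.write c.state (fun j => c.tape j (c.head j)) i)), fun i => min (L i) (c.head i),
    fun i => max (R i) (c.head i), asked, y, hy, ?_, rfl⟩, ?_⟩
  · have hm : ∀ i, -1 ≤ (M.move c.state (fun j => c.tape j (c.head j)) i).toInt ∧
        (M.move c.state (fun j => c.tape j (c.head j)) i).toInt ≤ 1 := fun i => by
      cases M.move c.state (fun j => c.tape j (c.head j)) i <;> simp
    rw [hstep]
    refine ⟨fun i z => ?_, fun i z hz => ?_, fun i => ?_, fun i => ?_, fun i => ?_, fun i => ?_,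
      fun i => ?_, fun i => ?_⟩
    · by_cases hz : z = c.head i
      · subst hz; simp
      · simp only [Function.update_of_ne hz]
        exact hI.tape_eq i z
    · have : z ≠ c.head i := by omega
      rw [Function.update_of_ne this]
      exact hI.supp i z (by omega)
    · have := hL0 i; omega
    · have := hR0 i; omega
    · have := hm i; have := hH i; have := hH' i; dsimp only; omega
    · have := hm i; have := hH i; have := hH' i; dsimp only; omega
    · have := hL i; have := hH i; push_cast; omega
    · have := hR i; have := hH' i; push_cast; omega
  · refine .act' ?_
    have hr := vread_eq (q := []) (o := []) hI
    have hst : (vcfg (some (Sum.inr (.st c.state asked)))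
      (fun i => vtape (T i) (L i) (R i) none) c.head x y [] []).read .st =
        some (Sum.inr (.st c.state asked)) := by simp [Cfg.read, vcfg]
    rw [hstep]
    apply Cfg.ext
    · funext j
      cases j with
      | vt j =>
        simp only [Cfg.act, hr, hst, stState]
        simp only [vcfg, Cfg.read]
        have := vtape_update (Q := M.Q) (T := T j) (m := none) (hL0 j) (hR0 j) (hH j) (hH' j)
          (some (M.write c.state (fun j => c.tape j (c.head j)) j)) none (by simp)
        simpa using this
      | st =>
        simp only [Cfg.act, hr, hst, stState, stAsked]
        simp [vcfg]
      | _ => simp [Cfg.act, vcfg, Cfg.read]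
    · funext j
      cases j <;> simp only [Cfg.act, hr, hst, stState] <;> simp [vcfg]

/-- The ask relation in a simulation: the oracle is `ψ`, queries have length at most `B`, the
strings on the answer tape satisfy `P`, and a consultation, which erases the query, takes at most
`n` steps. -/
def AskErase (ψ : Baire S) (B : ℕ) (P : List S → Prop) (n : ℕ) :
    VCfg M → VCfg M → ℕ → Prop := fun C C' t =>
  ∃ w y, w.length ≤ B ∧ P y ∧ C.tape .qry = Tape.ofString w ∧ C.head .qry = 0 ∧
    C.tape .ans = Tape.ofString y ∧ C.head .ans = 0 ∧
    C' = (C.setTape .qry Tape.blank).setTape .ans (Tape.ofString (ψ w)) ∧ t = n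

/-- For the output and query tapes, where everything has been written by the machine itself: the
content consists of written symbols and cannot reach beyond the visited cells. -/
theorem content_letters {T : ℤ → Option (Symb S M.A)} {U : Tape S M.A} {R : ℤ} {N : ℕ}
    (hU : ∀ z, U z = (T z).getD none) (hT : ∀ z, R < z → T z = none) (hR : R < N) :
    (∀ k (hk : k < U.content.length), T k = some (some (Sum.inl U.content[k]))) ∧
      (T U.content.length).bind Symb.letter = none ∧ U.content.length ≤ N := by
  have hN : U N = none := by rw [hU, hT _ hR]; rfl
  obtain ⟨h1, h2⟩ := Tape.content_spec (T := U) ⟨N, by rw [hN]; rfl⟩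
  refine ⟨fun k hk => ?_, ?_, ?_⟩
  · have := h1 k hk
    rw [hU] at this
    cases hTk : T k with
    | none => rw [hTk] at this; cases this
    | some v => rw [hTk] at this; exact congrArg some this
  · rw [hU] at h2
    cases hTk : T U.content.length with
    | none => rfl
    | some v => rw [hTk] at h2; exact h2
  · by_contra hlt
    push Not at hlt
    have := h1 N hlt
    rw [hN] at this
    cases this

/-- An oracle call moves no head, so the positions are marked before the heads on the query and
answer tapes travel and are restored from the marks. Marking also makes the scanned cells visited.
Only the query is copied; the answer stays on `ans` and becomes visible through the cleared virtual
answer tape. -/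
theorem Exec.vask {ψ : Baire S} {P : List S → Prop} {B n : ℕ} (hP : ∀ w, w.length ≤ B → P (ψ w))
    {c : M.Config} {N : ℕ} {C : VCfg M} (h : VRep P x c N C) (hB : N + 2 ≤ B)
    (hh : c.state ≠ M.halt) (ho : c.state = M.oracle) :
    ∃ C', VRep P x (M.step ψ c) (N + 1) C' ∧
      Exec (AskErase ψ B P n) .vask C C' (60 * (N + 2) + n) := by
  obtain ⟨T, L, R, asked, y, hy, hI, rfl⟩ := h
  have hstep := M.step_of_oracle (φ := ψ) hh ho
  have hH := hI.le_head
  have hH' := hI.head_le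
  have hL0 := hI.left_nonpos
  have hR0 := hI.right_nonneg
  set w := (c.tape .query).content with hw
  obtain ⟨hw1, hw2, hw3⟩ := content_letters (T := T .query) (U := c.tape .query) (R := R .query)
    (N := N + 1) (fun z => hI.tape_eq .query z) (fun z hz => hI.supp .query z (by omega))
    (by have := hI.right_le .query; push_cast; omega)
  rw [← hw] at hw1 hw2 hw3
  set L' := fun i => min (L i) (c.head i) with hL'
  set R' := fun i => max (R i) (c.head i) with hR'
  set V₁ : TapeIdx M.W → Tape S (VSym S M.Q M.A) :=
    fun i => vtape (T i) (L' i) (R' i) (some (c.head i)) with hV₁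
  have hLN : ∀ i, -((N + 1 : ℕ) : ℤ) ≤ L' i := fun i => by
    have := hI.le_left i; have := hH i; simp only [hL']; push_cast; omega
  have hRN : ∀ i, R' i ≤ ((N + 1 : ℕ) : ℤ) := fun i => by
    have := hI.right_le i; have := hH' i; simp only [hR']; push_cast; omega
  have hL'0 : ∀ i, L' i ≤ 0 := fun i => by have := hL0 i; simp only [hL']; omega
  have hR'0 : ∀ i, 0 ≤ R' i := fun i => by have := hR0 i; simp only [hR']; omega
  have hLh : ∀ i, L' i ≤ c.head i := fun i => by simp only [hL']; omega
  have hhR : ∀ i, c.head i ≤ R' i := fun i => by simp only [hR']; omega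
  have hupd : ∀ i, Function.update (T i) (c.head i) (T i (c.head i)) = T i := fun i =>
    Function.update_eq_self _ _
  let K := AskErase (M := M) ψ B P n
  have s1 : Exec K (.touch (setMark true) (fun c => c))
      (vcfg (some (Sum.inr (.st c.state asked))) (fun i => vtape (T i) (L i) (R i) none)
        c.head x y [] [])
      (vcfg (some (Sum.inr (.st c.state asked))) V₁ c.head x y [] []) 1 := by
    convert Exec.touch (K := K) (setMark true) (fun c => c) using 2
    funext i
    have := vtape_update (Q := M.Q) (T := T i) (m := none) (hL0 i) (hR0 i) (hH i) (hH' i)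
      (T i (c.head i)) (some (c.head i)) (fun z hz => by simp [Ne.symm hz])
    rw [hupd] at this
    rw [decide_eq_true rfl] at this
    rw [setMark, cellVal_vtape (hI.supp i), this]
  have s2 := Exec.seek_org (K := K) (σ := some (Sum.inr (.st c.state asked))) (V := V₁)
    (H := c.head) (x := x) (y := y) (q := []) (o := []) (i := .query) (h := c.head .query) rfl
    (by have := hLh .query; omega) (hhR _) (hLN _) (hRN _) (hL'0 _) (hR'0 _)
  rw [Function.update_eq_self] at s2
  have s3 := Exec.grab (K := K) (σ := some (Sum.inr (.st c.state asked))) (V := V₁)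
    (H := c.head) (x := x) (y := y) (q := []) (o := []) (i := .query) rfl
    (fun z hz => hI.supp .query z (by simp only [hL', hR'] at hz; omega)) hw1 hw2 .qry
    (Or.inl ⟨rfl, rfl⟩)
  rw [vcfg_setTape_qry] at s3
  have hwR : (w.length : ℤ) - 1 ≤ R' .query := by
    by_contra hlt
    have h0 : 0 < w.length := by have := hR'0 .query; omega
    have := hw1 (w.length - 1) (by omega)
    rw [hI.supp .query _ (by simp only [hR'] at hlt; omega)] at this
    cases this
  have s4 := Exec.seek_hd (K := K) (σ := some (Sum.inr (.st c.state asked))) (V := V₁)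
    (H := c.head) (x := x) (y := y) (q := w) (o := []) (i := .query) (h := (w.length : ℤ) - 1) rfl
    (by have := hL'0 .query; omega) hwR (hLN _) (hRN _) (hLh _) (hhR _)
  rw [Function.update_eq_self] at s4
  -- Clearing also takes the head on `ans` back to the start, as `AskErase` demands; the head mark
  -- restores it in `s7`.
  have s5 := Exec.clear (K := K) (σ := some (Sum.inr (.st c.state asked))) (V := V₁)
    (H := c.head) (x := x) (y := y) (q := w) (o := []) (i := .answer) (h := c.head .answer) rfl
    (by have := hLh .answer; omega) (hhR _) (hLN _) (hRN _) (hL'0 _) (hR'0 _)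
  rw [Function.update_eq_self] at s5
  set V₂ := Function.update V₁ .answer
    (vtape (fun _ => none) (L' .answer) (R' .answer) (some (c.head .answer))) with hV₂
  have s6 : Exec K .ask
      (vcfg (some (Sum.inr (.st c.state asked))) V₂ (Function.update c.head .answer 0) x y w [])
      (vcfg (some (Sum.inr (.st c.state asked))) V₂ (Function.update c.head .answer 0) x (ψ w)
        [] []) n := by
    refine .ask ⟨w, y, by omega, hy, rfl, rfl, rfl, by simp [vcfg], ?_, rfl⟩
    rw [← Tape.ofString_nil, vcfg_setTape_qry, vcfg_setTape_ans]
  have s7 := Exec.seek_hd (K := K) (σ := some (Sum.inr (.st c.state asked))) (V := V₂)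
    (H := c.head) (x := x) (y := ψ w) (q := []) (o := []) (i := .answer) (h := 0)
    (Function.update_self ..) (by have := hL'0 .answer; omega) (hR'0 _) (hLN _) (hRN _) (hLh _)
    (hhR _)
  rw [Function.update_eq_self] at s7
  set T' : TapeIdx M.W → ℤ → Option (Symb S M.A) :=
    Function.update T .answer fun _ => none with hT'
  have hV₂' : ∀ i, V₂ i = vtape (T' i) (L' i) (R' i) (some (c.head i)) := by
    intro i
    by_cases hi : i = .answer
    · subst hi; simp [hV₂, hT']
    · simp [hV₂, hT', hV₁, hi]
  have hsupp : ∀ i z, ¬ (L' i ≤ z ∧ z ≤ R' i) → T' i z = none := by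
    intro i z hz
    by_cases hi : i = .answer
    · subst hi; simp [hT']
    · rw [hT', Function.update_of_ne hi]
      exact hI.supp i z (by simp only [hL', hR'] at hz; omega)
  have s8 : Exec K (.touch (setMark false) fun _ => some (Sum.inr (.st M.resume true)))
      (vcfg (some (Sum.inr (.st c.state asked))) V₂ c.head x (ψ w) [] [])
      (vcfg (some (Sum.inr (.st M.resume true))) (fun i => vtape (T' i) (L' i) (R' i) none)
        c.head x (ψ w) [] []) 1 := by
    convert Exec.touch (K := K) (setMark false) (fun _ => some (Sum.inr (.st M.resume true)))
      using 2
    funext i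
    have := vtape_update (Q := M.Q) (T := T' i) (m := some (c.head i)) (z := c.head i) (hL'0 i) (hR'0 i)
      (by have := hLh i; omega) (by have := hhR i; omega)
      (T' i (c.head i)) none (fun z hz => by simp [Ne.symm hz])
    rw [Function.update_eq_self, min_eq_left (hLh i), max_eq_left (hhR i)] at this
    rw [hV₂', setMark, cellVal_vtape (hsupp i), ← this]
    simp
  refine ⟨_, ⟨T', L', R', true, ψ w, hP w (by omega), ?_, ?_⟩,
    (s1.seq (s2.seq (s3.seq (s4.seq (s5.seq (s6.seq (s7.seq s8))))))).mono (by omega)⟩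
  · rw [hstep]
    refine ⟨fun i z => ?_, hsupp, hL'0, hR'0, fun i => ?_, fun i => ?_, hLN, hRN⟩
    · by_cases hi : i = .answer
      · subst hi
        simp [hT', vbase, hw]
      · have hT'i : T' i = T i := by rw [hT', Function.update_of_ne hi]
        have hb : vbase (M := M) x (ψ w) true i = vbase x y asked i := by
          cases i <;> first | rfl | exact absurd rfl hi
        rw [hT'i, hb, ← hI.tape_eq]
        cases i <;> first | rfl | exact absurd rfl hi
    · have := hLh i; dsimp only; omega
    · have := hhR i; dsimp only; omega
  · rw [hstep]

/-- Make a list of virtual tapes blank. -/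
noncomputable def Prog.cleanAll : List (TapeIdx M.W) → VProg M
  | [] => .shift fun _ => .stay
  | i :: l => .clean i ;; .cleanAll l

theorem Exec.cleanAll {N : ℕ} (l : List (TapeIdx M.W)) (hl : l.Nodup)
    (V : TapeIdx M.W → Tape S (VSym S M.Q M.A)) (H : TapeIdx M.W → ℤ)
    (hV : ∀ i ∈ l, ∃ T L R m, V i = vtape T L R m ∧ L - 1 ≤ H i ∧ H i ≤ R ∧ -(N : ℤ) ≤ L ∧ R ≤ N ∧
      L ≤ 0 ∧ 0 ≤ R) :
    Exec K (.cleanAll l) (vcfg σ V H x y q o)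
      (vcfg σ (fun i => if i ∈ l then Tape.blank else V i) (fun i => if i ∈ l then 0 else H i)
        x y q o) (l.length * (10 * N + 10) + 1) := by
  induction l generalizing V H with
  | nil =>
    have := Exec.shift (K := K) (fun _ => .stay) (vcfg σ V H x y q o)
    have e : (vcfg σ V H x y q o).moved (fun _ => .stay) = vcfg σ V H x y q o := by
      apply Cfg.ext
      · rfl
      · funext j; simp [Cfg.moved]
    rw [e] at this
    simpa [Prog.cleanAll] using this
  | cons i l ih =>
    obtain ⟨hi, hl⟩ := List.nodup_cons.1 hl
    obtain ⟨T, L, R, m, h0, h1, h2, h3, h4, h5, h6⟩ := hV i (by simp)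
    have h7 := Exec.clean (K := K) (σ := σ) (V := V) (H := H) (x := x) (y := y) (q := q) (o := o)
      h0 h1 h2 h3 h4 h5 h6
    rw [Function.update_eq_self] at h7
    have h8 := ih hl (Function.update V i Tape.blank) (Function.update H i 0) fun j hj => by
      have hji : j ≠ i := fun h => hi (h ▸ hj)
      simpa only [Function.update_of_ne hji] using hV j (by simp [hj])
    have h9 := h7.seq h8
    have e1 : (fun j => if j ∈ i :: l then (Tape.blank : Tape S (VSym S M.Q M.A)) else V j) =
        fun j => if j ∈ l then Tape.blank else Function.update V i Tape.blank j := by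
      funext j
      by_cases hj : j = i
      · subst hj; simp [hi]
      · simp [hj]
    have e2 : (fun j => if j ∈ i :: l then (0 : ℤ) else H j) =
        fun j => if j ∈ l then 0 else Function.update H i 0 j := by
      funext j
      by_cases hj : j = i
      · subst hj; simp [hi]
      · simp [hj]
    rw [e1, e2]
    refine h9.mono ?_
    rw [List.length_cons, add_one_mul l.length]
    omega

theorem TapeIdx.finite {W : Type} [Finite W] : Finite (TapeIdx W) :=
  Finite.of_injective
    (fun i : TapeIdx W => match i with
      | .input => some (some (some (some none)))
      | .output => some (some (some none))
      | .query => some (some none)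
      | .answer => some none
      | .work w => some (some (some (some (some w)))))
    (by rintro (_ | _ | _ | _ | _) (_ | _ | _ | _ | _) <;> simp)

/-- The tapes of a machine. -/
noncomputable def OracleMachine.tapes (M : OracleMachine S) : List (TapeIdx M.W) :=
  have := M.finW
  have := TapeIdx.finite (W := M.W)
  (Set.toFinite (Set.univ : Set (TapeIdx M.W))).toFinset.toList

/-- Simulation of a machine: the input is on the tape `inp`, the output is written on the tape
`out`, and all virtual tapes are blank in the end. -/
noncomputable def Prog.simulate (M : OracleMachine S) : VProg M :=
  .touch (fun _ => some (Sum.inr (.cell none true false)))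
      (fun _ => some (Sum.inr (.st M.start false))) ;;
    .loop (fun r => stState (r .st) ≠ M.halt)
      (.ite (fun r => stState (r .st) = M.oracle) .vask .vstep) ;;
    .touch (setMark true) (fun c => c) ;; .seek .output (fun c => cellOrg c = true) ;;
    .grab .output .out ;; .cleanAll M.tapes ;; .touch (fun c => c) (fun _ => none)

/-- After `k` steps all visited cells are within distance `k` of the origin, so each of the rounds
is bounded by the cost of an oracle call at distance `t`. The induction is on the number `j` of
remaining steps. -/
theorem Exec.simulate_loop {ψ : Baire S} {P : List S → Prop} {B n : ℕ}
    (hP : ∀ w, w.length ≤ B → P (ψ w)) {t : ℕ} (hB : t + 2 ≤ B)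
    (ht : (M.run ψ x t).state = M.halt) (ht' : ∀ k < t, (M.run ψ x k).state ≠ M.halt) (j k : ℕ)
    (hjk : j + k = t) {C : VCfg M} (hC : VRep P x (M.run ψ x k) k C) :
    ∃ C', VRep P x (M.run ψ x t) t C' ∧ Exec (AskErase ψ B P n)
      (.loop (fun r => stState (r .st) ≠ M.halt)
        (.ite (fun r => stState (r .st) = M.oracle) .vask .vstep)) C C'
      (j * (60 * (t + 2) + n + 2) + 1) := by
  have hst : ∀ {c N C}, VRep (M := M) P x c N C → stState (C.read .st) = c.state := by
    rintro c N C ⟨T, L, R, asked, y, -, -, rfl⟩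
    simp [Cfg.read, vcfg, stState]
  induction j generalizing k C with
  | zero =>
    obtain rfl : k = t := by omega
    exact ⟨C, hC, (Exec.loop_neg (by simp [hst hC, ht])).mono (by omega)⟩
  | succ j ih =>
    have hk : (M.run ψ x k).state ≠ M.halt := ht' k (by omega)
    obtain ⟨C₁, hC₁, h₁⟩ : ∃ C₁, VRep P x (M.run ψ x (k + 1)) (k + 1) C₁ ∧
        Exec (AskErase ψ B P n) (.ite (fun r => stState (r .st) = M.oracle) .vask .vstep) C C₁
          (60 * (t + 2) + n + 1) := by
      rw [M.run_succ]
      by_cases ho : (M.run ψ x k).state = M.oracle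
      · obtain ⟨C₁, hC₁, h₁⟩ := Exec.vask (n := n) hP hC (by omega) hk ho
        exact ⟨C₁, hC₁, (Exec.ite_pos (by rw [hst hC, ho]) h₁).mono (by omega)⟩
      · obtain ⟨C₁, hC₁, h₁⟩ := Exec.vstep (K := AskErase ψ B P n) (ψ := ψ) hC hk ho
        exact ⟨C₁, hC₁, (Exec.ite_neg (by rwa [hst hC]) h₁).mono (by omega)⟩
    obtain ⟨C₂, hC₂, h₂⟩ := ih (k + 1) (by omega) hC₁
    refine ⟨C₂, hC₂, (Exec.loop_pos (by rwa [hst hC]) h₁ h₂).mono ?_⟩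
    rw [add_one_mul j]; omega

/-- The final configuration differs from the initial one only in the output and in the string on
`ans`, of which `P` is known. Hence, once the output is erased, the simulation can be started again,
which a composition does at every oracle call. -/
theorem Exec.simulate {ψ : Baire S} {P : List S → Prop} {B n t : ℕ}
    (hP : ∀ w, w.length ≤ B → P (ψ w)) (ht : M.time ψ x ≤ t) (hB : t + 2 ≤ B) (hy : P y) :
    ∃ y', P y' ∧ Exec (AskErase ψ B P n) (.simulate M)
      (vcfg none (fun _ => Tape.blank) (fun _ => 0) x y [] [])
      (vcfg none (fun _ => Tape.blank) (fun _ => 0) x y' [] (M.result ψ x))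
      ((M.tapes.length + t + 1) * (n + 100 * (t + 2))) := by
  obtain ⟨s, hs, hh, hlt⟩ := M.exists_time_eq (ne_top_of_le_ne_top (by simp) ht)
  have hst : s ≤ t := by rw [hs] at ht; exact_mod_cast ht
  let K := AskErase (M := M) ψ B P n
  -- The first action marks the origins, so that on each virtual tape precisely the cell 0 counts as
  -- visited.
  have h1 : Exec K (.touch (fun _ => some (Sum.inr (.cell none true false)))
      (fun _ => some (Sum.inr (.st M.start false))))
      (vcfg none (fun _ => Tape.blank) (fun _ => 0) x y [] [])
      (vcfg (some (Sum.inr (.st M.start false)))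
        (fun _ => vtape (fun _ => none) 0 0 none) (fun _ => 0) x y [] []) 1 := by
    convert Exec.touch (K := K) _ _ using 2
    funext i z
    by_cases hz : z = 0
    · subst hz; simp [vtape]
    · rw [vtape_notMem (by omega), Function.update_of_ne hz]; rfl
  have hC₀ : VRep P x (M.run ψ x 0) 0 (vcfg (some (Sum.inr (.st M.start false)))
      (fun _ => vtape (fun _ => none) 0 0 none) (fun _ => 0) x y [] []) := by
    refine ⟨fun _ _ => none, fun _ => 0, fun _ => 0, false, y, hy, ?_, rfl⟩
    refine ⟨fun i z => ?_, fun _ _ _ => rfl, fun _ => le_rfl, fun _ => le_rfl, fun _ => ?_,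
      fun _ => ?_, fun _ => by simp, fun _ => by simp⟩
    · cases i <;> rfl
    · simp [OracleMachine.run, OracleMachine.init]
    · simp [OracleMachine.run, OracleMachine.init]
  obtain ⟨C₁, ⟨T, L, R, asked, y', hy', hI, rfl⟩, h2⟩ :=
    Exec.simulate_loop (n := n) hP (by omega) hh hlt s 0 (by omega) hC₀
  rw [M.result_eq hh]
  set c := M.run ψ x s with hc
  have hH := hI.le_head
  have hH' := hI.head_le
  have hL0 := hI.left_nonpos
  have hR0 := hI.right_nonneg
  set w := (c.tape .output).content with hw
  obtain ⟨hw1, hw2, hw3⟩ := content_letters (T := T .output) (U := c.tape .output) (R := R .output)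
    (N := s + 1) (fun z => hI.tape_eq .output z) (fun z hz => hI.supp .output z (by omega))
    (by have := hI.right_le .output; push_cast; omega)
  rw [← hw] at hw1 hw2 hw3
  set L' := fun i => min (L i) (c.head i) with hL'
  set R' := fun i => max (R i) (c.head i) with hR'
  set V₁ : TapeIdx M.W → Tape S (VSym S M.Q M.A) :=
    fun i => vtape (T i) (L' i) (R' i) (some (c.head i)) with hV₁
  have hLN : ∀ i, -((s + 1 : ℕ) : ℤ) ≤ L' i := fun i => by
    have := hI.le_left i; have := hH i; simp only [hL']; push_cast; omega
  have hRN : ∀ i, R' i ≤ ((s + 1 : ℕ) : ℤ) := fun i => by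
    have := hI.right_le i; have := hH' i; simp only [hR']; push_cast; omega
  have hL'0 : ∀ i, L' i ≤ 0 := fun i => by have := hL0 i; simp only [hL']; omega
  have hR'0 : ∀ i, 0 ≤ R' i := fun i => by have := hR0 i; simp only [hR']; omega
  have hLh : ∀ i, L' i ≤ c.head i := fun i => by simp only [hL']; omega
  have hhR : ∀ i, c.head i ≤ R' i := fun i => by simp only [hR']; omega
  -- A head may have ended one cell outside the visited interval. Setting the mark makes this cell
  -- visited, as the searches and `clean` require; the mark itself is not used.
  have s1 : Exec K (.touch (setMark true) (fun c => c))
      (vcfg (some (Sum.inr (.st c.state asked))) (fun i => vtape (T i) (L i) (R i) none)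
        c.head x y' [] [])
      (vcfg (some (Sum.inr (.st c.state asked))) V₁ c.head x y' [] []) 1 := by
    convert Exec.touch (K := K) (setMark true) (fun c => c) using 2
    funext i
    have := vtape_update (Q := M.Q) (T := T i) (m := none) (hL0 i) (hR0 i) (hH i) (hH' i)
      (T i (c.head i)) (some (c.head i)) (fun z hz => by simp [Ne.symm hz])
    rw [Function.update_eq_self] at this
    rw [decide_eq_true rfl] at this
    rw [setMark, cellVal_vtape (hI.supp i), this]
  have s2 := Exec.seek_org (K := K) (σ := some (Sum.inr (.st c.state asked))) (V := V₁)
    (H := c.head) (x := x) (y := y') (q := []) (o := []) (i := .output) (h := c.head .output) rfl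
    (by have := hLh .output; omega) (hhR _) (hLN _) (hRN _) (hL'0 _) (hR'0 _)
  rw [Function.update_eq_self] at s2
  have s3 := Exec.grab (K := K) (σ := some (Sum.inr (.st c.state asked))) (V := V₁)
    (H := c.head) (x := x) (y := y') (q := []) (o := []) (i := .output) rfl
    (fun z hz => hI.supp .output z (by simp only [hL', hR'] at hz; omega)) hw1 hw2 .out
    (Or.inr ⟨rfl, rfl⟩)
  rw [vcfg_setTape_out] at s3
  have hwR : (w.length : ℤ) - 1 ≤ R' .output := by
    by_contra hlt
    have h0 : 0 < w.length := by have := hR'0 .output; omega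
    have := hw1 (w.length - 1) (by omega)
    rw [hI.supp .output _ (by simp only [hR'] at hlt; omega)] at this
    cases this
  have hmem : ∀ i, i ∈ M.tapes := fun i => by simp [OracleMachine.tapes]
  have s4 := Exec.cleanAll (K := K) (σ := some (Sum.inr (.st c.state asked))) (N := s + 1)
    (x := x) (y := y') (q := []) (o := w) M.tapes (Finset.nodup_toList _) V₁
    (Function.update c.head .output ((w.length : ℤ) - 1)) (fun i _ => by
      refine ⟨T i, L' i, R' i, _, rfl, ?_, ?_, hLN i, hRN i, hL'0 i, hR'0 i⟩
      · by_cases hi : i = .output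
        · subst hi; have := hL'0 .output; rw [Function.update_self]; omega
        · rw [Function.update_of_ne hi]; have := hLh i; omega
      · by_cases hi : i = .output
        · subst hi; rwa [Function.update_self]
        · rw [Function.update_of_ne hi]; exact hhR i)
  simp only [hmem, if_true] at s4
  have s5 : Exec K (.touch (fun c => c) (fun _ => none))
      (vcfg (some (Sum.inr (.st c.state asked))) (fun _ => Tape.blank) (fun _ => 0) x y' [] w)
      (vcfg none (fun _ => Tape.blank) (fun _ => 0) x y' [] w) 1 := by
    convert Exec.touch (K := K) (fun c => c) (fun _ => none) using 2
    funext i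
    simp
  refine ⟨y', hy', (h1.seq (h2.seq (s1.seq (s2.seq (s3.seq (s4.seq s5)))))).mono ?_⟩
  have a1 : s * (60 * (s + 2) + n + 2) ≤ t * (n + 100 * (t + 2)) :=
    Nat.mul_le_mul hst (by omega)
  have a2 : M.tapes.length * (10 * (s + 1) + 10) ≤ M.tapes.length * (n + 100 * (t + 2)) :=
    Nat.mul_le_mul_left _ (by omega)
  rw [add_mul, add_mul]
  omega

end Simulation

/-! ### Subroutines -/

section Call

variable {S : Type} {M : OracleMachine S}

instance {Q A : Type} [Finite S] [Finite Q] [Finite A] : Finite (VSym S Q A) :=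
  Finite.of_injective
    (fun c : VSym S Q A => match c with
      | .cell x o h => (Sum.inl (x, o, h) : Option (Option (S ⊕ A)) × Bool × Bool ⊕ Q × Bool)
      | .st q b => Sum.inr (q, b))
    (by rintro (_ | _) (_ | _) <;> simp)

/-- The configuration before and after a simulation with input `x`; `y` is the last answer of the
oracle and `o` is the output. -/
noncomputable def idle (M : OracleMachine S) (x y o : List S) : VCfg M :=
  vcfg none (fun _ => Tape.blank) (fun _ => 0) x y [] o

theorem idle_eq (x y y' o : List S) :
    idle M x y' o = ((idle M x y []).setTape .ans (Tape.ofString y')).setTape .out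
      (Tape.ofString o) := by
  rw [idle, idle, vcfg_setTape_ans, vcfg_setTape_out]

@[simp] theorem idle_head (x y o : List S) (j : VTape M.W) : (idle M x y o).head j = 0 := by
  cases j <;> rfl

@[simp] theorem idle_tape_vt (x y o : List S) (i : TapeIdx M.W) :
    (idle M x y o).tape (.vt i) = Tape.blank := rfl

@[simp] theorem idle_tape_st (x y o : List S) : (idle M x y o).tape .st = Tape.blank :=
  Function.update_eq_self (f := Tape.blank) 0

@[simp] theorem idle_tape_inp (x y o : List S) :
    (idle M x y o).tape .inp = Tape.ofString x := rfl

@[simp] theorem idle_tape_qry (x y o : List S) : (idle M x y o).tape .qry = Tape.blank :=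
  Tape.ofString_nil

@[simp] theorem idle_tape_ans (x y o : List S) :
    (idle M x y o).tape .ans = Tape.ofString y := rfl

@[simp] theorem idle_tape_out (x y o : List S) :
    (idle M x y o).tape .out = Tape.ofString o := rfl

variable {W B : Type} {φ : Baire S}

/-- Consult the oracle and erase the query. -/
noncomputable def Prog.askErase : Prog S (TapeIdx W) B := .ask ;; .eraseString .query

theorem Exec.askErase {C : Cfg S (TapeIdx W) B} {w : List S}
    (h : C.tape .query = Tape.ofString w) (h0 : C.head .query = 0) :
    Exec (Prog.AskOracle φ .query .answer) .askErase C
      ((C.setTape .query Tape.blank).setTape .answer (Tape.ofString (φ w)))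
      (5 * w.length + 6) := by
  have h1 : Exec (Prog.AskOracle φ .query .answer) .ask C
      (C.setTape .answer (Tape.ofString (φ w))) 1 :=
    .ask ⟨by rw [Cfg.ask, h, Tape.content_ofString], rfl⟩
  have h2 := Exec.eraseString (K := Prog.AskOracle φ .query .answer) (TapeIdx.query : TapeIdx W)
    (C.setTape .answer (Tape.ofString (φ w))) w
    (by rw [Cfg.setTape_tape_of_ne _ _ (by simp), h]) h0
  rw [Cfg.setTape_comm _ (by simp)] at h2
  exact (h1.seq h2).mono (by omega)

/-- Run the machine `M` as a subroutine, where the oracle of `M` is the oracle of the program. -/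
noncomputable def Prog.call (M : OracleMachine S) (e : VTape M.W → TapeIdx W)
    (f : VSym S M.Q M.A → B) : Prog S (TapeIdx W) B :=
  (Prog.simulate M).subst e f .askErase

/-- The hypothesis `hG` says that the tapes of the simulation are clean except for the argument and
some old answer. Queries have length at most `t + 2`, so asking and erasing one costs at most `5 *
(t + 2) + 6 ≤ 8 * (t + 2)`; with the 100 of `Exec.simulate` this makes 108. -/
theorem Exec.call {e : VTape M.W → TapeIdx W} {f : VSym S M.Q M.A → B} (he : e.Injective)
    (hf : f.Injective) (hq : e .qry = .query) (ha : e .ans = .answer) {G : Cfg S (TapeIdx W) B}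
    {x y : List S} (hG : Cfg.embed e f G (idle M x y []) = G) {t : ℕ} (ht : M.time φ x ≤ t) :
    ∃ y', Exec (Prog.AskOracle φ .query .answer) (.call M e f) G
      ((G.setTape .answer (Tape.ofString y')).setTape (e .out) (Tape.ofString (M.result φ x)))
      ((M.tapes.length + t + 1) * (108 * (t + 2))) := by
  obtain ⟨y', -, h⟩ := Exec.simulate (ψ := φ) (P := fun _ => True) (n := 5 * (t + 2) + 6) (y := y)
    (fun _ _ => trivial) ht le_rfl trivial
  -- The query and answer tapes lie in the range of `e`, so the oracle calls keep the background
  -- equal to `G`.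
  obtain ⟨F, rfl, h'⟩ := Exec.subst (K' := Prog.AskOracle φ .query .answer) (H := .askErase) he hf
    (fun F => F = G) (by
      rintro C C' n F ⟨w, z, hw, -, h1, h2, -, -, rfl, rfl⟩ rfl
      refine ⟨F, rfl, ?_⟩
      have h3 := Exec.askErase (φ := φ) (C := Cfg.embed e f F C) (w := w)
        (by rw [← hq, Cfg.embed_tape he, h1, Tape.map_ofString])
        (by rw [← hq, Cfg.embed_head he, h2])
      rw [Cfg.embed_setTape he, Cfg.embed_setTape he, hq, ha, Tape.map_blank, Tape.map_ofString]
      exact h3.mono (by omega)) h rfl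
  refine ⟨y', ?_⟩
  have e1 := idle_eq (M := M) x y y' (M.result φ x)
  rw [idle] at e1
  rw [e1, Cfg.embed_setTape he, Cfg.embed_setTape he, ha, Tape.map_ofString,
    Tape.map_ofString] at h'
  rw [← idle, hG] at h'
  exact h'.mono (Nat.mul_le_mul_left _ (by omega))

end Call

/-! ### Composition of machines -/

section Comp

variable {S : Type} (N M : OracleMachine S)

/-- The work tapes for the composition: those of the two simulations, and two tapes for the input
and the output of the inner machine. -/
abbrev CompWork : Type := (Option (TapeIdx N.W) ⊕ Option (TapeIdx M.W)) ⊕ Bool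

/-- The auxiliary symbols for the composition. -/
abbrev CompSym : Type := VSym S N.Q N.A ⊕ VSym S M.Q M.A

/-- The tapes of the outer simulation. -/
def outerTape : VTape N.W → TapeIdx (CompWork N M)
  | .vt i => .work (Sum.inl (Sum.inl (some i)))
  | .st => .work (Sum.inl (Sum.inl none))
  | .inp => .input
  | .qry => .work (Sum.inr false)
  | .ans => .work (Sum.inr true)
  | .out => .output

/-- The tapes of the inner simulation. -/
def innerTape : VTape M.W → TapeIdx (CompWork N M)
  | .vt i => .work (Sum.inl (Sum.inr (some i)))
  | .st => .work (Sum.inl (Sum.inr none))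
  | .inp => .work (Sum.inr false)
  | .qry => .query
  | .ans => .answer
  | .out => .work (Sum.inr true)

theorem outerTape_injective : (outerTape N M).Injective := by
  rintro (_ | _ | _ | _ | _ | _) (_ | _ | _ | _ | _ | _) <;> simp [outerTape]

theorem innerTape_injective : (innerTape N M).Injective := by
  rintro (_ | _ | _ | _ | _ | _) (_ | _ | _ | _ | _ | _) <;> simp [innerTape]

/-- The inner machine as an oracle for the outer one. -/
noncomputable def innerCall : Prog S (TapeIdx (CompWork N M)) (CompSym N M) :=
  .eraseString (.work (Sum.inr true)) ;; .call M (innerTape N M) Sum.inr ;;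
    .eraseString (.work (Sum.inr false))

/-- Simulation of `N`, where the oracle is computed by `M`. -/
noncomputable def compProg : Prog S (TapeIdx (CompWork N M)) (CompSym N M) :=
  (Prog.simulate N).subst (outerTape N M) Sum.inl (innerCall N M)

variable {N M}

/-- The tapes of the inner simulation are ready for use. -/
def InnerIdle (F : Cfg S (TapeIdx (CompWork N M)) (CompSym N M)) : Prop :=
  (∀ o, F.tape (.work (Sum.inl (Sum.inr o))) = Tape.blank) ∧
    (∀ o, F.head (.work (Sum.inl (Sum.inr o))) = 0) ∧
    F.tape .query = Tape.blank ∧ F.head .query = 0 ∧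
    (∃ y, F.tape .answer = Tape.ofString y) ∧ F.head .answer = 0

theorem InnerIdle.setTape_answer {F : Cfg S (TapeIdx (CompWork N M)) (CompSym N M)}
    (h : InnerIdle F) (y : List S) : InnerIdle (F.setTape .answer (Tape.ofString y)) := by
  obtain ⟨h1, h2, h3, h4, -, h6⟩ := h
  refine ⟨fun o => ?_, h2, ?_, h4, ⟨y, by simp⟩, h6⟩
  · rw [Cfg.setTape_tape_of_ne _ _ (by simp), h1]
  · rw [Cfg.setTape_tape_of_ne _ _ (by simp), h3]

/-- The query tape of `N` is the input tape of `M`, and the answer tape of `N` is the output tape of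
`M`, so no string is transferred. The old answer has to be erased before the call and the query
after it; the length bounds in `AskErase` pay for this. -/
theorem exec_innerCall {φ : Baire S} {tM B : ℕ} (hM : ∀ w, w.length ≤ B → M.time φ w ≤ tM)
    {C C' : VCfg N} {n : ℕ}
    (h : AskErase (M.result φ) B (fun y => y.length ≤ tM)
      ((M.tapes.length + tM + 1) * (108 * (tM + 2)) + 5 * tM + 5 * B + 10) C C' n)
    {F : Cfg S (TapeIdx (CompWork N M)) (CompSym N M)} (hF : InnerIdle F) :
    ∃ F', InnerIdle F' ∧ Exec (Prog.AskOracle φ .query .answer) (innerCall N M)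
      (Cfg.embed (outerTape N M) Sum.inl F C) (Cfg.embed (outerTape N M) Sum.inl F' C') n := by
  obtain ⟨w, y, hw, hy, h1, h2, h3, h4, rfl, rfl⟩ := h
  have he := outerTape_injective N M
  set G := Cfg.embed (outerTape N M) Sum.inl F C with hG
  have g1 : G.tape (.work (Sum.inr false)) = Tape.ofString w := by
    have := Cfg.embed_tape (f := (Sum.inl : _ → CompSym N M)) he F C .qry
    rw [h1, Tape.map_ofString] at this
    exact this
  have g2 : G.head (.work (Sum.inr false)) = 0 := by
    have := Cfg.embed_head (f := (Sum.inl : _ → CompSym N M)) he F C .qry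
    rw [h2] at this
    exact this
  have g3 : G.tape (.work (Sum.inr true)) = Tape.ofString y := by
    have := Cfg.embed_tape (f := (Sum.inl : _ → CompSym N M)) he F C .ans
    rw [h3, Tape.map_ofString] at this
    exact this
  have g4 : G.head (.work (Sum.inr true)) = 0 := by
    have := Cfg.embed_head (f := (Sum.inl : _ → CompSym N M)) he F C .ans
    rw [h4] at this
    exact this
  have hno : ∀ {j}, (∀ k, outerTape N M k ≠ j) → G.tape j = F.tape j ∧ G.head j = F.head j :=
    fun hj => ⟨Cfg.embed_tape_of_notMem _ _ (by simpa using hj),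
      Cfg.embed_head_of_notMem _ _ (by simpa using hj)⟩
  have g5 : ∀ o, G.tape (.work (Sum.inl (Sum.inr o))) = Tape.blank ∧
      G.head (.work (Sum.inl (Sum.inr o))) = 0 := fun o => by
    have := hno (j := .work (Sum.inl (Sum.inr o))) (by rintro (_ | _) <;> simp [outerTape])
    rwa [hF.1, hF.2.1] at this
  have g6 : G.tape .query = Tape.blank ∧ G.head .query = 0 := by
    have := hno (j := .query) (by rintro (_ | _) <;> simp [outerTape])
    rwa [hF.2.2.1, hF.2.2.2.1] at this
  obtain ⟨z, hz⟩ := hF.2.2.2.2.1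
  have hans : ¬ ∃ k, outerTape N M k = .answer := by rintro ⟨_ | _, hk⟩ <;> simp [outerTape] at hk
  have g7 : G.tape .answer = Tape.ofString z ∧ G.head .answer = 0 := by
    have := hno (j := .answer) (by simpa using hans)
    rwa [hz, hF.2.2.2.2.2] at this
  let K := Prog.AskOracle (I := TapeIdx (CompWork N M)) (A := CompSym N M) φ .query .answer
  have s1 := Exec.eraseString (K := K) (.work (Sum.inr true)) G y g3 g4
  have hG1 : Cfg.embed (innerTape N M) Sum.inr (G.setTape (.work (Sum.inr true)) Tape.blank)
      (idle M w z []) = G.setTape (.work (Sum.inr true)) Tape.blank := by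
    apply Cfg.embed_self (innerTape_injective N M)
    · rintro (i | _ | _ | _ | _ | _) <;> simp [innerTape, Cfg.setTape, g1, g5, g6, g7]
    · rintro (i | _ | _ | _ | _ | _) <;> simp [innerTape, g2, g4, g5, g6, g7]
  obtain ⟨y', s2⟩ := Exec.call (φ := φ) (innerTape_injective N M) Sum.inr_injective rfl rfl hG1
    (hM w hw)
  have s3 := Exec.eraseString (K := K) (.work (Sum.inr false))
    (((G.setTape (.work (Sum.inr true)) Tape.blank).setTape .answer (Tape.ofString y')).setTape
      (.work (Sum.inr true)) (Tape.ofString (M.result φ w))) w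
    (by simp [Cfg.setTape, g1]) (by simp [g2])
  refine ⟨F.setTape .answer (Tape.ofString y'), hF.setTape_answer y', ?_⟩
  have s4 := s1.seq (s2.seq s3)
  have e1 : Cfg.embed (outerTape N M) Sum.inl (F.setTape .answer (Tape.ofString y'))
      ((C.setTape .qry Tape.blank).setTape .ans (Tape.ofString (M.result φ w))) =
      ((((G.setTape (.work (Sum.inr true)) Tape.blank).setTape .answer
        (Tape.ofString y')).setTape (.work (Sum.inr true)) (Tape.ofString (M.result φ w))).setTape
          (.work (Sum.inr false)) Tape.blank) := by
    rw [Cfg.embed_setTape he, Cfg.embed_setTape he, Cfg.setTape_embed he _ _ hans, ← hG,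
      Tape.map_blank, Tape.map_ofString]
    have a1 : outerTape N M .qry = .work (Sum.inr false) := rfl
    have a2 : outerTape N M .ans = .work (Sum.inr true) := rfl
    rw [a1, a2, Cfg.setTape_comm G (i := .work (Sum.inr true)) (j := .answer) (by simp),
      Cfg.setTape_setTape]
    exact Cfg.setTape_comm _ (by simp) _ _
  rw [e1]
  exact s4.mono (by omega)

/-- The composition of oracle machines, with a bound for the running time. -/
theorem OracleMachine.exists_comp [Finite S] (N M : OracleMachine S) :
    ∃ (C : OracleMachine S) (c : ℕ), ∀ (φ : Baire S) (a : List S) (tN tM : ℕ),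
      N.time (M.result φ) a ≤ tN → (∀ w, w.length ≤ tN + 2 → M.time φ w ≤ tM) →
      C.time φ a ≤ (3 * ((c + tN + 1) * ((c + tM + 1) * (108 * (tM + 2)) + 5 * tM +
        5 * (tN + 2) + 10 + 100 * (tN + 2))) : ℕ) ∧
      C.result φ a = N.result (M.result φ) a := by
  have := N.finW
  have := N.finQ
  have := N.finA
  have := M.finW
  have := M.finQ
  have := M.finA
  have := TapeIdx.finite (W := N.W)
  have := TapeIdx.finite (W := M.W)
  refine ⟨(compProg N M).compile, N.tapes.length + M.tapes.length, fun φ a tN tM hN hM => ?_⟩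
  have he := outerTape_injective N M
  -- The answers given to `N` are outputs of `M`, hence no longer than the running time `tM`; this
  -- is the invariant `P`. The value of `n` is the cost of `innerCall` for queries of length at most
  -- `tN + 2`.
  obtain ⟨y', -, h⟩ := Exec.simulate (x := a) (y := []) (P := fun y => y.length ≤ tM)
    (n := (M.tapes.length + tM + 1) * (108 * (tM + 2)) + 5 * tM + 5 * (tN + 2) + 10)
    (fun w hw => M.length_result_le (hM w hw)) hN le_rfl (Nat.zero_le _)
  obtain ⟨F, -, h'⟩ := Exec.subst he Sum.inl_injective InnerIdle
    (fun C C' n F hK hF => exec_innerCall hM hK hF) h (F := Prog.initCfg a)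
    ⟨fun _ => rfl, fun _ => rfl, rfl, rfl, ⟨[], by simp [Prog.initCfg]⟩, rfl⟩
  have e0 : Cfg.embed (outerTape N M) (Sum.inl : _ → CompSym N M) (Prog.initCfg a)
      (vcfg none (fun _ => Tape.blank) (fun _ => 0) a [] [] []) = Prog.initCfg a := by
    rw [← idle]
    apply Cfg.embed_self he
    · rintro (i | _ | _ | _ | _ | _) <;> simp [outerTape, Prog.initCfg]
    · rintro (i | _ | _ | _ | _ | _) <;> simp [Prog.initCfg]
  rw [e0] at h'
  obtain ⟨h1, h2⟩ := Prog.compile_spec (p := compProg N M) h'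
  constructor
  · refine h1.trans (Nat.cast_le.2 (Nat.mul_le_mul_left _ (Nat.mul_le_mul (by omega) ?_)))
    have : (M.tapes.length + tM + 1) * (108 * (tM + 2)) ≤
        (N.tapes.length + M.tapes.length + tM + 1) * (108 * (tM + 2)) :=
      Nat.mul_le_mul_right _ (by omega)
    omega
  · rw [h2]
    have := Cfg.embed_tape (f := (Sum.inl : _ → CompSym N M)) he F
      (vcfg none (fun _ => Tape.blank) (fun _ => 0) a y' [] (N.result (M.result φ) a)) .out
    have e1 : outerTape N M .out = .output := rfl
    rw [e1] at this
    rw [this, Tape.content_map]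
    exact Tape.content_ofString _

end Comp

/-! ### Some oracle machines -/

section Machines

variable {S : Type}

theorem letter_ofString {A : Type} (a : List S) (k : ℕ) :
    (Tape.ofString a (k : ℤ) : Symb S A).letter = a[k]? := by
  rw [Tape.ofString_natCast]
  cases a[k]? <;> rfl

theorem Exec.copyTape {I A : Type} {K : Cfg S I A → Cfg S I A → ℕ → Prop} (g : S → S) {j i : I}
    (hji : j ≠ i) (C : Cfg S I A) (v w : List S)
    (hj : ∀ k ≤ w.length, (C.tape j (C.head j + k)).letter.map g = w[k]?)
    (hi : C.tape i = Tape.ofString v) (hi' : C.head i = v.length) :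
    Exec K (.copy (fun r => (r j).letter.map g) i (only j .right)) C
      (((C.setTape i (Tape.ofString (v ++ w))).setHead j (C.head j + w.length)).setHead i
        (v.length + w.length)) (2 * w.length + 1) := by
  have := Exec.copy (K := K) (fun r => (r j).letter.map g) i (only j .right)
    (fun k => C.setHead j (C.head j + k)) v w
    (fun k _ j' _ => by
      refine ⟨rfl, ?_⟩
      by_cases h : j' = j
      · subst h; simp [only, add_assoc]
      · simp [only, h, Cfg.setHead_head_of_ne _ _ h])
    (fun k hk r hr => by
      rw [hr j hji, ← hj k hk]
      simp [Cfg.read])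
  rw [Nat.cast_zero, add_zero, Cfg.setHead_eq (C := C) rfl, Cfg.setTape_eq hi,
    Cfg.setHead_eq hi'] at this
  exact this

/-- A program for the identity operator. -/
noncomputable def identityProg : Prog S (TapeIdx Empty) Empty :=
  .copy (fun r => (r .input).letter.map id) .query (only .input .right) ;; .ask ;;
    .copy (fun r => (r .answer).letter.map id) .output (only .answer .right)

/-- This machine serves twice: as realiser of the identity for the standard parameter, and as
realiser of the parameter of a Kawamura-Cook space. -/
theorem OracleMachine.exists_identity (S : Type) :
    ∃ M : OracleMachine S, ∀ (φ : Baire S) (a : List S),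
      M.time φ a ≤ (3 * (2 * a.length + 2 * (φ a).length + 3) : ℕ) ∧ M.result φ a = φ a := by
  refine ⟨identityProg.compile, fun φ a => ?_⟩
  let K := Prog.AskOracle (S := S) (I := TapeIdx Empty) (A := Empty) φ .query .answer
  have h1 := Exec.copyTape (K := K) id (j := .input) (i := .query) (by simp) (Prog.initCfg a) [] a
    (fun k _ => by simp [Prog.initCfg, letter_ofString]) (by simp [Prog.initCfg]) rfl
  simp only [List.nil_append, List.length_nil, Nat.cast_zero, zero_add] at h1
  generalize hC : (((Prog.initCfg a).setTape (TapeIdx.query : TapeIdx Empty)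
    (Tape.ofString a)).setHead .input ((Prog.initCfg (A := Empty) a).head .input + a.length)).setHead
      .query a.length = C at h1
  have h2 : Exec K .ask C (C.setTape .answer (Tape.ofString (φ a))) 1 :=
    .ask ⟨by subst hC; simp [Cfg.ask], rfl⟩
  have h3 := Exec.copyTape (K := K) id (j := .answer) (i := .output) (by simp)
    (C.setTape .answer (Tape.ofString (φ a))) [] (φ a)
    (fun k _ => by
      subst hC
      simp [Cfg.setHead, Prog.initCfg, letter_ofString])
    (by subst hC; simp [Cfg.setTape, Prog.initCfg])
    (by subst hC; simp [Cfg.setHead, Prog.initCfg])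
  obtain ⟨h4, h5⟩ := Prog.compile_spec (p := identityProg) (h1.seq (h2.seq h3))
  refine ⟨h4.trans (Nat.cast_le.2 (by omega)), h5.trans ?_⟩
  simp

/-- The code of a pair of a string and a number. -/
def pairCode (one zero : S) (a : List S) (n : ℕ) : List S :=
  a.flatMap (fun s => [zero, s]) ++ List.replicate n one

theorem pairCode_succ (one zero : S) (a : List S) (n : ℕ) :
    pairCode one zero a n ++ [one] = pairCode one zero a (n + 1) := by
  simp only [pairCode, List.replicate_succ', List.append_assoc]

theorem pairCode_concat (one zero : S) (a : List S) (s : S) :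
    pairCode one zero (a ++ [s]) 0 = pairCode one zero a 0 ++ [zero] ++ [s] := by
  simp [pairCode]

theorem length_pairCode (one zero : S) (a : List S) (n : ℕ) :
    (pairCode one zero a n).length = 2 * a.length + n := by
  simp [pairCode, mul_comm]

/-- A program that reads a string symbol by symbol with the help of the oracle. -/
noncomputable def decodeProg (one zero : S) : Prog S (TapeIdx Empty) Empty :=
  .loop (IsLetter .input)
      (.put .query (fun _ => some (Sum.inl zero)) (only .query .right) ;;
        .put .query (fun r => r .input) (fun j => match j with
          | .query => .right
          | .input => .right
          | _ => .stay)) ;; .ask ;;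
    .loop (fun r => r .answer = some (Sum.inl zero))
      (.shift (only .answer .right) ;;
        .put .output (fun r => r .answer) (fun j => match j with
          | .output => .right
          | .answer => .left
          | _ => .stay) ;;
        .put .query (fun _ => some (Sum.inl one)) (only .query .right) ;; .ask)

/-- The configurations of `decodeProg`. -/
noncomputable def decodeCfg (a : List S) (n : ℕ) (q y o : List S) : Cfg S (TapeIdx Empty) Empty where
  tape j := match j with
    | .input => Tape.ofString a
    | .output => Tape.ofString o
    | .query => Tape.ofString q
    | .answer => Tape.ofString y
    | .work _ => Tape.blank
  head j := match j with
    | .input => n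
    | .output => o.length
    | .query => q.length
    | .answer => 0
    | .work _ => 0

theorem exec_decode_put {K : Cfg S (TapeIdx Empty) Empty → Cfg S (TapeIdx Empty) Empty → ℕ → Prop}
    (a : List S) (n : ℕ) (q y o : List S) (s : S) :
    Exec K (.put .query (fun _ => some (Sum.inl s)) (only .query .right))
      (decodeCfg a n q y o) (decodeCfg a n (q ++ [s]) y o) 1 := by
  have h1 := Exec.put (K := K) (.query : TapeIdx Empty)
    (fun _ => some (Sum.inl s)) (only .query .right) (decodeCfg a n q y o)
  convert h1 using 1
  apply Cfg.ext
  · funext j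
    cases j <;> simp [Cfg.moved, Cfg.setTape, decodeCfg, Tape.ofString_concat]
  · funext j
    cases j <;> simp [Cfg.moved, decodeCfg, only]

theorem exec_decode_read {K : Cfg S (TapeIdx Empty) Empty → Cfg S (TapeIdx Empty) Empty → ℕ → Prop}
    (a : List S) {n : ℕ} (hn : n < a.length) (q y o : List S) :
    Exec K (.put .query (fun r => r .input) (fun j => match j with
          | .query => .right
          | .input => .right
          | _ => .stay))
      (decodeCfg a n q y o) (decodeCfg a (n + 1) (q ++ [a[n]]) y o) 1 := by
  have h1 := Exec.put (K := K) (.query : TapeIdx Empty) (fun r => r .input) (fun j => match j with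
          | .query => .right
          | .input => .right
          | _ => .stay) (decodeCfg a n q y o)
  convert h1 using 1
  have hr : (decodeCfg a n q y o).read .input = some (Sum.inl a[n]) := Tape.ofString_of_lt a hn
  apply Cfg.ext
  · funext j
    cases j <;> simp [Cfg.moved, Cfg.setTape, decodeCfg, Tape.ofString_concat]
    exact congrArg _ hr.symm
  · funext j
    cases j <;> simp [Cfg.moved, decodeCfg]

theorem exec_decode_ask (φ : Baire S) (a : List S) (n : ℕ) (q y o : List S) :
    Exec (Prog.AskOracle φ .query .answer) .ask
      (decodeCfg a n q y o) (decodeCfg a n q (φ q) o) 1 := by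
  refine .ask ⟨?_, rfl⟩
  apply Cfg.ext
  · funext j
    cases j <;> simp [Cfg.ask, Cfg.setTape, decodeCfg]
  · rfl

theorem exec_decode_write {K : Cfg S (TapeIdx Empty) Empty → Cfg S (TapeIdx Empty) Empty → ℕ → Prop}
    (a : List S) (n : ℕ) (q y o : List S) (x s : S) :
    Exec K (.shift (only .answer .right) ;;
        .put .output (fun r => r .answer) (fun j => match j with
          | .output => .right
          | .answer => .left
          | _ => .stay))
      (decodeCfg a n q (x :: s :: y) o) (decodeCfg a n q (x :: s :: y) (o ++ [s])) 2 := by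
  have h1 := Exec.shift (K := K) (only .answer .right) (decodeCfg a n q (x :: s :: y) o)
  have h2 := Exec.put (K := K) .output (fun r => r .answer) (fun j => match j with
          | .output => .right
          | .answer => .left
          | _ => .stay) ((decodeCfg a n q (x :: s :: y) o).moved (only .answer .right))
  convert h1.seq h2 using 1
  have hr : ((decodeCfg a n q (x :: s :: y) o).moved (only .answer .right)).read .answer =
      some (Sum.inl s) := by
    simp [Cfg.read, Cfg.moved, decodeCfg, only, Tape.ofString]
  apply Cfg.ext
  · funext j
    cases j <;> simp [Cfg.moved, Cfg.setTape, decodeCfg, Tape.ofString_concat, only]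
    exact congrArg _ hr.symm
  · funext j
    cases j <;> simp [Cfg.moved, decodeCfg, only]

/-- Sequences associate to the right. The induction is needed because the derivation for `p ;; q`
may end with `Exec.mono`. -/
theorem Exec.seq_assoc {I A : Type} {K : Cfg S I A → Cfg S I A → ℕ → Prop} {p q r : Prog S I A}
    {C C' C'' : Cfg S I A} {m n : ℕ} (h : Exec K (p ;; q) C C' m) (h' : Exec K r C' C'' n) :
    Exec K (p ;; q ;; r) C C'' (m + n) := by
  generalize hs : (p ;; q) = s at h
  induction h generalizing n with
  | seq h1 h2 =>
    cases hs
    exact (h1.seq (h2.seq h')).mono (by omega)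
  | mono _ hst ih => exact (ih h' hs).mono (by omega)
  | _ => cases hs

/-- The length of `u` need not be known: the letters are requested in turn until an answer begins
with `one`. The next query arises by appending one letter on the query tape. At most two letters of
each answer are read, so the padding `v` does not enter the running time. -/
theorem OracleMachine.exists_decoder {one zero : S} (h01 : one ≠ zero) :
    ∃ M : OracleMachine S, ∀ (φ : Baire S) (a u : List S),
      (∀ k (hk : k < u.length), ∃ v, φ (pairCode one zero a k) = zero :: u[k] :: v) →
      (∃ v, φ (pairCode one zero a u.length) = one :: v) →
      M.time φ a ≤ (3 * (3 * a.length + 5 * u.length + 4) : ℕ) ∧ M.result φ a = u := by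
  refine ⟨(decodeProg one zero).compile, fun φ a u hu hu' => ?_⟩
  let K := Prog.AskOracle (S := S) (I := TapeIdx Empty) (A := Empty) φ .query .answer
  set q : ℕ → List S := pairCode one zero a with hq
  have h1 := Exec.loop_iterate (K := K) (b := IsLetter .input)
    (p := .put .query (fun _ => some (Sum.inl zero)) (only .query .right) ;;
        .put .query (fun r => r .input) (fun j => match j with
          | .query => .right
          | .input => .right
          | _ => .stay))
    (fun k => decodeCfg a k (pairCode one zero (a.take k) 0) [] []) a.length 2
    (fun k hk => by simp [IsLetter, Cfg.read, decodeCfg, letter_ofString, hk])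
    (fun k hk => by
      rw [List.take_add_one, List.getElem?_eq_getElem hk, Option.toList_some, pairCode_concat]
      exact (exec_decode_put a k _ [] [] zero).seq (exec_decode_read a hk _ [] []))
    (by simp [IsLetter, Cfg.read, decodeCfg, letter_ofString])
  have e0 : decodeCfg a 0 (pairCode one zero (a.take 0) 0) [] [] = Prog.initCfg a := by
    apply Cfg.ext
    · funext j
      cases j <;> simp [decodeCfg, Prog.initCfg, pairCode]
    · funext j
      cases j <;> simp [decodeCfg, Prog.initCfg, pairCode]
  rw [e0, List.take_length] at h1
  have h3 := Exec.loop_iterate (K := K) (b := fun r => r .answer = some (Sum.inl zero))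
    (p := .shift (only .answer .right) ;;
        .put .output (fun r => r .answer) (fun j => match j with
          | .output => .right
          | .answer => .left
          | _ => .stay) ;;
        .put .query (fun _ => some (Sum.inl one)) (only .query .right) ;; .ask)
    (fun k => decodeCfg a a.length (q k) (φ (q k)) (u.take k)) u.length 4
    (fun k hk => by
      obtain ⟨v, hv⟩ := hu k hk
      simp only [Cfg.read, decodeCfg]
      rw [hv]
      rfl)
    (fun k hk => by
      obtain ⟨v, hv⟩ := hu k hk
      have s1 := exec_decode_write (K := K) a a.length (q k) v (u.take k) zero u[k]
      rw [← hv] at s1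
      have s2 := exec_decode_put (K := K) a a.length (q k) (φ (q k)) (u.take k ++ [u[k]]) one
      rw [hq, pairCode_succ, ← hq] at s2
      have s3 := s1.seq_assoc (s2.seq (exec_decode_ask φ a a.length _ _ _))
      rwa [List.take_add_one, List.getElem?_eq_getElem hk, Option.toList_some])
    (by
      obtain ⟨v, hv⟩ := hu'
      simp only [Cfg.read, decodeCfg]
      rw [hv]
      simp [Tape.ofString, h01])
  rw [List.take_zero, List.take_length] at h3
  obtain ⟨h4, h5⟩ := Prog.compile_spec (p := decodeProg one zero)
    (h1.seq ((exec_decode_ask φ a a.length _ [] []).seq h3))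
  refine ⟨h4.trans (Nat.cast_le.2 (by omega)), h5.trans ?_⟩
  simp [decodeCfg]

end Machines

/-! ### Monotone codes of names -/

section Encoding

variable {S : Type}

/-- The string in a code of a pair. -/
noncomputable def pairArg (one : S) : List S → List S
  | [] => []
  | [x] => if x = one then [] else [one]
  | x :: y :: w => if x = one then [] else y :: pairArg one w

/-- The number in a code of a pair. -/
noncomputable def pairIdx (one : S) (w : List S) : ℕ := w.length - 2 * (pairArg one w).length

/-- Each letter of `a` is preceded by `zero`, so the first `one` in an even position marks the
beginning of the number. -/
theorem pairArg_pairCode {one zero : S} (h : one ≠ zero) (a : List S) (n : ℕ) :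
    pairArg one (pairCode one zero a n) = a := by
  induction a with
  | nil =>
    rcases n with _ | _ | n <;> simp [pairCode, pairArg, List.replicate_succ]
  | cons s a ih =>
    have : pairCode one zero (s :: a) n = zero :: s :: pairCode one zero a n := by simp [pairCode]
    rw [this, pairArg, if_neg h.symm, ih]

theorem pairIdx_pairCode {one zero : S} (h : one ≠ zero) (a : List S) (n : ℕ) :
    pairIdx one (pairCode one zero a n) = n := by
  rw [pairIdx, pairArg_pairCode h, length_pairCode]
  omega

theorem length_pairArg_le (one : S) (w : List S) : (pairArg one w).length ≤ w.length := by
  induction w using pairArg.induct (one := one) <;> simp_all [pairArg]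
  omega

theorem pairIdx_le (one : S) (w : List S) : pairIdx one w ≤ w.length := Nat.sub_le _ _

/-- A code for an optional letter. -/
def codeLetter (one zero : S) : Option S → List S
  | none => [one, one]
  | some s => [zero, s]

theorem length_codeLetter (one zero : S) (x : Option S) : (codeLetter one zero x).length = 2 := by
  cases x <;> rfl

/-- A name that encodes the symbols of the values of `φ`, with values padded to a length that is
controlled by `l`. -/
noncomputable def monotoneCode (one zero : S) (l : ℕ → ℕ) (φ : Baire S) : Baire S := fun w =>
  codeLetter one zero (φ (pairArg one w))[pairIdx one w]? ++ List.replicate (l w.length) one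

/-- A missing letter is also coded by two letters, so the length does not depend on `φ` and depends
on `w` only through its length. This makes codes length-monotone. -/
theorem length_monotoneCode (one zero : S) (l : ℕ → ℕ) (φ : Baire S) (w : List S) :
    (monotoneCode one zero l φ w).length = l w.length + 2 := by
  simp [monotoneCode, length_codeLetter, add_comm]

theorem monotoneCode_pairCode {one zero : S} (h : one ≠ zero) (l : ℕ → ℕ) (φ : Baire S)
    (a : List S) (n : ℕ) :
    monotoneCode one zero l φ (pairCode one zero a n) =
      codeLetter one zero (φ a)[n]? ++ List.replicate (l (2 * a.length + n)) one := by
  rw [monotoneCode, pairArg_pairCode h, pairIdx_pairCode h, length_pairCode]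

/-- The first two letters of the value at the code of `a` and `n` determine the optional letter of
index `n` in `φ a`, whatever the padding. -/
theorem monotoneCode_injective {one zero : S} (h : one ≠ zero) {l l' : ℕ → ℕ} {φ φ' : Baire S}
    (he : monotoneCode one zero l φ = monotoneCode one zero l' φ') : φ = φ' := by
  funext a
  refine List.ext_getElem? fun n => ?_
  have := congrFun he (pairCode one zero a n)
  rw [monotoneCode_pairCode h, monotoneCode_pairCode h] at this
  have := (List.append_inj this (by rw [length_codeLetter, length_codeLetter])).1
  cases h1 : (φ a)[n]? <;> cases h2 : (φ' a)[n]? <;> simp_all [codeLetter]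

end Encoding

/-! ### A machine that writes monotone codes. -/

section Encoder

variable {S : Type} (M N : OracleMachine S)

/-- The work tapes of the encoder. -/
abbrev EncWork : Type := (Option (TapeIdx M.W) ⊕ Option (TapeIdx N.W)) ⊕ Option Bool

/-- The auxiliary symbols of the encoder. -/
abbrev EncSym : Type := VSym S M.Q M.A ⊕ VSym S N.Q N.A

/-- The tape for the arguments of the subroutines. -/
abbrev encArg : TapeIdx (EncWork M N) := .work (Sum.inr none)

/-- The tape for the result of the first subroutine. -/
abbrev encLen : TapeIdx (EncWork M N) := .work (Sum.inr (some false))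

/-- The tape for the result of the second subroutine. -/
abbrev encVal : TapeIdx (EncWork M N) := .work (Sum.inr (some true))

/-- The tapes of the first subroutine. -/
def lenTape : VTape M.W → TapeIdx (EncWork M N)
  | .vt i => .work (Sum.inl (Sum.inl (some i)))
  | .st => .work (Sum.inl (Sum.inl none))
  | .inp => encArg M N
  | .qry => .query
  | .ans => .answer
  | .out => encLen M N

/-- The tapes of the second subroutine. -/
def valTape : VTape N.W → TapeIdx (EncWork M N)
  | .vt i => .work (Sum.inl (Sum.inr (some i)))
  | .st => .work (Sum.inl (Sum.inr none))
  | .inp => encArg M N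
  | .qry => .query
  | .ans => .answer
  | .out => encVal M N

theorem lenTape_injective : (lenTape M N).Injective := by
  rintro (_ | _ | _ | _ | _ | _) (_ | _ | _ | _ | _ | _) <;> simp [lenTape]

theorem valTape_injective : (valTape M N).Injective := by
  rintro (_ | _ | _ | _ | _ | _) (_ | _ | _ | _ | _ | _) <;> simp [valTape]

/-- The loop that extracts the string from the code of a pair. -/
noncomputable def argProg (one : S) : Prog S (TapeIdx (EncWork M N)) (EncSym M N) :=
  .loop (fun r => ∃ s, (r .input).letter = some s ∧ s ≠ one)
    (.shift (only .input .right) ;;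
      .put (encArg M N) (fun r => some (Sum.inl ((r .input).letter.getD one))) (fun j => match j with
        | .input => .right
        | .work (Sum.inr none) => .right
        | _ => .stay))

/-- The loop that finds the symbol of a value. -/
noncomputable def idxProg : Prog S (TapeIdx (EncWork M N)) (EncSym M N) :=
  .loop (IsLetter .input) (.shift fun j => match j with
        | .input => .right
        | .work (Sum.inr (some true)) => .right
        | _ => .stay)

/-- Output of the code of the scanned symbol of a value. -/
noncomputable def codeProg (one zero : S) : Prog S (TapeIdx (EncWork M N)) (EncSym M N) :=
  .put .output (fun r => some (Sum.inl (if (r (encVal M N)).letter = none then one else zero)))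
      (only .output .right) ;;
    .put .output (fun r => some (Sum.inl ((r (encVal M N)).letter.getD one))) (only .output .right)

/-- A program for monotone codes: `M` computes the lengths and `N` the values. -/
noncomputable def encProg (one zero : S) : Prog S (TapeIdx (EncWork M N)) (EncSym M N) :=
  .copy (fun r => (r .input).letter.map fun _ => one) (encArg M N) (only .input .right) ;;
    .rewind (encArg M N) ;; .rewind .input ;; .call M (lenTape M N) Sum.inl ;;
    .eraseString (encArg M N) ;; argProg M N one ;; .rewind (encArg M N) ;;
    .call N (valTape M N) Sum.inr ;; idxProg M N ;; codeProg M N one zero ;;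
    .copy (fun r => (r (encLen M N)).letter.map fun _ => one) .output (only (encLen M N) .right)

variable {M N}

/-- The configurations of `encProg`. -/
noncomputable def encCfg (y w : List S) (n : ℕ) (x : List S) (m : ℕ) (l v : List S) (i : ℕ)
    (o : List S) : Cfg S (TapeIdx (EncWork M N)) (EncSym M N) where
  tape j := match j with
    | .input => Tape.ofString w
    | .output => Tape.ofString o
    | .query => Tape.blank
    | .answer => Tape.ofString y
    | .work (Sum.inr none) => Tape.ofString x
    | .work (Sum.inr (some false)) => Tape.ofString l
    | .work (Sum.inr (some true)) => Tape.ofString v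
    | .work (Sum.inl _) => Tape.blank
  head j := match j with
    | .input => n
    | .output => o.length
    | .work (Sum.inr none) => m
    | .work (Sum.inr (some true)) => i
    | _ => 0

theorem encCfg_ext {C : Cfg S (TapeIdx (EncWork M N)) (EncSym M N)} {y w : List S} {n : ℕ}
    {x : List S} {m : ℕ} {l v : List S} {i : ℕ} {o : List S}
    (ht : ∀ j, C.tape j = (encCfg (M := M) (N := N) y w n x m l v i o).tape j)
    (hh : ∀ j, C.head j = (encCfg (M := M) (N := N) y w n x m l v i o).head j) :
    C = encCfg y w n x m l v i o :=
  Cfg.ext (funext ht) (funext hh)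

theorem encCfg_setHead_arg (y w : List S) (n : ℕ) (x : List S) (m m' : ℕ) (l v : List S) (i : ℕ)
    (o : List S) : (encCfg (M := M) (N := N) y w n x m l v i o).setHead (encArg M N) m' =
      encCfg y w n x m' l v i o := by
  apply encCfg_ext
  · intro j; rfl
  · rintro (_ | _ | _ | _ | (_ | _ | _ | _)) <;> simp [Cfg.setHead, encCfg]

theorem encCfg_setHead_input (y w : List S) (n n' : ℕ) (x : List S) (m : ℕ) (l v : List S) (i : ℕ)
    (o : List S) : (encCfg (M := M) (N := N) y w n x m l v i o).setHead .input n' =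
      encCfg y w n' x m l v i o := by
  apply encCfg_ext
  · intro j; rfl
  · rintro (_ | _ | _ | _ | (_ | _ | _ | _)) <;> simp [Cfg.setHead, encCfg]

theorem encCfg_setTape_arg (y w : List S) (n : ℕ) (x x' : List S) (m : ℕ) (l v : List S) (i : ℕ)
    (o : List S) :
    (encCfg (M := M) (N := N) y w n x m l v i o).setTape (encArg M N) (Tape.ofString x') =
      encCfg y w n x' m l v i o := by
  apply encCfg_ext
  · rintro (_ | _ | _ | _ | (_ | _ | _ | _)) <;> simp [Cfg.setTape, encCfg]
  · intro j; rfl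

theorem encCfg_setTape_len (y w : List S) (n : ℕ) (x : List S) (m : ℕ) (l l' v : List S) (i : ℕ)
    (o : List S) :
    (encCfg (M := M) (N := N) y w n x m l v i o).setTape (encLen M N) (Tape.ofString l') =
      encCfg y w n x m l' v i o := by
  apply encCfg_ext
  · rintro (_ | _ | _ | _ | (_ | _ | _ | _)) <;> simp [Cfg.setTape, encCfg]
  · intro j; rfl

theorem encCfg_setTape_val (y w : List S) (n : ℕ) (x : List S) (m : ℕ) (l v v' : List S) (i : ℕ)
    (o : List S) :
    (encCfg (M := M) (N := N) y w n x m l v i o).setTape (encVal M N) (Tape.ofString v') =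
      encCfg y w n x m l v' i o := by
  apply encCfg_ext
  · rintro (_ | _ | _ | _ | (_ | _ | _ | _)) <;> simp [Cfg.setTape, encCfg]
  · intro j; rfl

theorem encCfg_setTape_answer (y y' w : List S) (n : ℕ) (x : List S) (m : ℕ) (l v : List S) (i : ℕ)
    (o : List S) :
    (encCfg (M := M) (N := N) y w n x m l v i o).setTape .answer (Tape.ofString y') =
      encCfg y' w n x m l v i o := by
  apply encCfg_ext
  · rintro (_ | _ | _ | _ | (_ | _ | _ | _)) <;> simp [Cfg.setTape, encCfg]
  · intro j; rfl

theorem Exec.cast {I A : Type} {K : Cfg S I A → Cfg S I A → ℕ → Prop} {p : Prog S I A}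
    {C C' C'' : Cfg S I A} {t : ℕ} (h : Exec K p C C' t) (e : C' = C'') : Exec K p C C'' t := e ▸ h

variable {K : Cfg S (TapeIdx (EncWork M N)) (EncSym M N) →
  Cfg S (TapeIdx (EncWork M N)) (EncSym M N) → ℕ → Prop}

/-- If the second letter of a pair is absent, the blank is read as `one`, in agreement with the
clause of `pairArg` for a single letter. -/
theorem exec_arg_body (one : S) (y w : List S) (n : ℕ) (x l v : List S) (i : ℕ) (o : List S) :
    Exec K (.shift (only .input .right) ;;
      .put (encArg M N) (fun r => some (Sum.inl ((r .input).letter.getD one))) (fun j => match j with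
        | .input => .right
        | .work (Sum.inr none) => .right
        | _ => .stay))
      (encCfg y w n x x.length l v i o)
      (encCfg y w (n + 2) (x ++ [w[n + 1]?.getD one]) (x.length + 1) l v i o) 2 := by
  have h1 := Exec.shift (K := K) (only .input .right)
    (encCfg (M := M) (N := N) y w n x x.length l v i o)
  have h2 := Exec.put (K := K) (encArg M N) (fun r => some (Sum.inl ((r .input).letter.getD one)))
    (fun j => match j with
        | .input => .right
        | .work (Sum.inr none) => .right
        | _ => .stay)
    ((encCfg (M := M) (N := N) y w n x x.length l v i o).moved (only .input .right))
  convert h1.seq h2 using 1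
  have hr : (((encCfg (M := M) (N := N) y w n x x.length l v i o).moved
      (only .input .right)).read .input).letter = w[n + 1]? := by
    rw [← letter_ofString (A := EncSym M N) w (n + 1)]
    simp [Cfg.read, Cfg.moved, encCfg, only]
  rw [hr]
  symm
  apply encCfg_ext
  · rintro (_ | _ | _ | _ | (_ | _ | _ | _)) <;>
      simp [Cfg.moved, Cfg.setTape, encCfg, only, Tape.ofString_concat]
  · rintro (_ | _ | _ | _ | (_ | _ | _ | _)) <;> simp [Cfg.moved, encCfg, only]
    ring

/-- The recursion of `pairArg` is the loop: each recursive clause is one round, and the other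
clauses are the ways in which the test fails. -/
theorem exec_argProg (one : S) (y w : List S) (n : ℕ) (x l v : List S) (i : ℕ) (o : List S) :
    Exec K (argProg M N one) (encCfg y w n x x.length l v i o)
      (encCfg y w (n + 2 * (pairArg one (w.drop n)).length) (x ++ pairArg one (w.drop n))
        (x.length + (pairArg one (w.drop n)).length) l v i o)
      (3 * (pairArg one (w.drop n)).length + 1) := by
  have hr : ∀ n x, ((encCfg (M := M) (N := N) y w n x x.length l v i o).read .input).letter =
      (w.drop n)[0]? := fun n x => (letter_ofString w n).trans (by simp)
  have base : ∀ n x, (∀ s, (w.drop n)[0]? = some s → s = one) → pairArg one (w.drop n) = [] →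
      Exec K (argProg M N one) (encCfg y w n x x.length l v i o)
      (encCfg y w (n + 2 * (pairArg one (w.drop n)).length) (x ++ pairArg one (w.drop n))
        (x.length + (pairArg one (w.drop n)).length) l v i o)
      (3 * (pairArg one (w.drop n)).length + 1) := fun n x hb he => by
    rw [he, List.append_nil]
    refine (Exec.loop_neg ?_).mono (by simp)
    rintro ⟨s, hs, hs'⟩
    exact hs' (hb s ((hr n x).symm.trans hs))
  -- One round, in a form that covers both a complete pair of letters and a single last letter.
  have key : ∀ n x s u v', (w.drop n)[0]? = some s → s ≠ one → w[n + 1]?.getD one = u →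
      w.drop (n + 2) = v' → pairArg one (w.drop n) = u :: pairArg one v' →
      Exec K (argProg M N one) (encCfg y w (n + 2) (x ++ [u]) (x ++ [u]).length l v i o)
      (encCfg y w (n + 2 + 2 * (pairArg one v').length) (x ++ [u] ++ pairArg one v')
        ((x ++ [u]).length + (pairArg one v').length) l v i o)
        (3 * (pairArg one v').length + 1) →
      Exec K (argProg M N one) (encCfg y w n x x.length l v i o)
      (encCfg y w (n + 2 * (pairArg one (w.drop n)).length) (x ++ pairArg one (w.drop n))
        (x.length + (pairArg one (w.drop n)).length) l v i o)
      (3 * (pairArg one (w.drop n)).length + 1) := by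
    rintro n x s u v' hb hs rfl rfl he h
    have h1 := exec_arg_body (K := K) one y w n x l v i o
    have e1 : (x ++ [w[n + 1]?.getD one]).length = x.length + 1 := by simp
    rw [e1] at h
    have := Exec.loop_pos ⟨s, (hr n x).trans hb, hs⟩ h1 h
    rw [he, List.length_cons]
    rw [List.append_assoc, List.singleton_append] at this
    convert this.mono (show _ ≤ 3 * ((pairArg one (w.drop (n + 2))).length + 1) + 1 by omega)
      using 2
    · rfl
    · omega
    · omega
  generalize hw : w.drop n = w'
  rw [← hw]
  induction w' using pairArg.induct (one := one) generalizing n x with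
  | case1 => exact base n x (by simp [hw]) (by simp [hw, pairArg])
  | case2 => exact base n x (by simp [hw]) (by simp [hw, pairArg])
  | case3 s hs =>
    have h1 : w.drop (n + 2) = [] := by
      rw [← List.drop_drop, hw]; rfl
    have h2 : w[n + 1]? = none := by
      rw [← List.getElem?_drop, hw]; rfl
    refine key n x s one [] (by simp [hw]) hs (by rw [h2]; rfl) h1 (by simp [hw, pairArg, hs]) ?_
    have := base (n + 2) (x ++ [one]) (by simp [h1]) (by simp [h1, pairArg])
    rwa [h1] at this
  | case4 u w' => exact base n x (by simp [hw]) (by simp [hw, pairArg])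
  | case5 s u w' hs ih =>
    have h1 : w.drop (n + 2) = w' := by
      rw [← List.drop_drop, hw]; rfl
    have h2 : w[n + 1]? = some u := by
      rw [← List.getElem?_drop, hw]; rfl
    refine key n x s u w' (by simp [hw]) hs (by rw [h2]; rfl) h1 (by simp [hw, pairArg, hs]) ?_
    have := ih (n + 2) (x ++ [u]) h1
    rwa [h1] at this

/-- After an incomplete last pair the head stands one cell beyond the end of `w`. Then `pairIdx`
vanishes by truncated subtraction, which is why `hk` is required only for `k ≠ 0`. -/
theorem exec_idxProg (y w : List S) {n k : ℕ} (h : w.length ≤ n + k) (hk : k ≠ 0 → n + k ≤ w.length)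
    (x : List S) (m : ℕ) (l v : List S) (o : List S) :
    Exec K (idxProg M N) (encCfg y w n x m l v 0 o) (encCfg y w (n + k) x m l v k o)
      (2 * k + 1) := by
  have hr : ∀ n k, ((encCfg (M := M) (N := N) y w n x m l v k o).read .input).letter = w[n]? :=
    fun n k => letter_ofString w n
  have := Exec.loop_iterate (K := K) (b := IsLetter .input) (p := .shift fun j => match j with
        | .input => .right
        | .work (Sum.inr (some true)) => .right
        | _ => .stay) (fun j => encCfg (M := M) (N := N) y w (n + j) x m l v j o) k 1
    (fun j hj => by
      have : n + j < w.length := by have := hk (by omega); omega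
      simp [IsLetter, hr, this])
    (fun j hj => by
      refine (Exec.shift _ _).cast ?_
      apply encCfg_ext
      · intro; rfl
      · rintro (_ | _ | _ | _ | (_ | _ | _ | _)) <;> simp [Cfg.moved, encCfg, add_assoc])
    (by simp [IsLetter, hr, h])
  exact this.mono (by omega)

theorem exec_codeProg (one zero : S) (y w : List S) (n : ℕ) (x : List S) (m : ℕ) (l v : List S)
    (i : ℕ) :
    Exec K (codeProg M N one zero) (encCfg y w n x m l v i [])
      (encCfg y w n x m l v i (codeLetter one zero v[i]?)) 2 := by
  have hr : ∀ o, ((encCfg (M := M) (N := N) y w n x m l v i o).read (encVal M N)).letter = v[i]? :=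
    fun o => letter_ofString v i
  have hp : ∀ (g : Option S → S) o, Exec K (.put .output
      (fun r => some (Sum.inl (g (r (encVal M N)).letter))) (only .output .right))
      (encCfg y w n x m l v i o) (encCfg y w n x m l v i (o ++ [g v[i]?])) 1 := fun g o => by
    refine (Exec.put _ _ _ _).cast ?_
    rw [hr]
    apply encCfg_ext
    · rintro (_ | _ | _ | _ | (_ | _ | _ | _)) <;>
        simp [Cfg.moved, Cfg.setTape, encCfg, Tape.ofString_concat]
    · rintro (_ | _ | _ | _ | (_ | _ | _ | _)) <;> simp [Cfg.moved, encCfg, only]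
  refine ((hp (fun s => if s = none then one else zero) []).seq (hp (fun s => s.getD one) _)).cast ?_
  congr 1
  cases v[i]? <;> simp [codeLetter]

theorem embed_lenTape (y w : List S) (n : ℕ) (x o : List S) :
    Cfg.embed (lenTape M N) Sum.inl (encCfg (M := M) (N := N) y w n x 0 [] [] 0 o)
      (idle M x y []) = encCfg y w n x 0 [] [] 0 o := by
  apply Cfg.embed_self (lenTape_injective M N)
  · rintro (i | _ | _ | _ | _ | _) <;> simp [lenTape, encCfg]
  · rintro (i | _ | _ | _ | _ | _) <;> simp [lenTape, encCfg]

theorem embed_valTape (y w : List S) (n : ℕ) (x l o : List S) :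
    Cfg.embed (valTape M N) Sum.inr (encCfg (M := M) (N := N) y w n x 0 l [] 0 o)
      (idle N x y []) = encCfg y w n x 0 l [] 0 o := by
  apply Cfg.embed_self (valTape_injective M N)
  · rintro (i | _ | _ | _ | _ | _) <;> simp [valTape, encCfg]
  · rintro (i | _ | _ | _ | _ | _) <;> simp [valTape, encCfg]

/-- A machine that computes monotone codes. -/
theorem OracleMachine.exists_encoder [Finite S] (M N : OracleMachine S) (one zero : S) :
    ∃ (E : OracleMachine S) (c : ℕ), ∀ (φ : Baire S) (w : List S) (tM tN : ℕ),
      M.time φ (List.replicate w.length one) ≤ tM → N.time φ (pairArg one w) ≤ tN →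
      E.time φ w ≤ (3 * ((c + tM + 1) * (108 * (tM + 2)) + (c + tN + 1) * (108 * (tN + 2)) +
        20 * w.length + 2 * tM + 25) : ℕ) ∧
      E.result φ w = monotoneCode one zero
        (fun n => (M.result φ (List.replicate n one)).length) (N.result φ) w := by
  have := N.finW
  have := N.finQ
  have := N.finA
  have := M.finW
  have := M.finQ
  have := M.finA
  have := TapeIdx.finite (W := N.W)
  have := TapeIdx.finite (W := M.W)
  refine ⟨(encProg M N one zero).compile, M.tapes.length + N.tapes.length,
    fun φ w tM tN hM hN => ?_⟩
  let K := Prog.AskOracle (I := TapeIdx (EncWork M N)) (A := EncSym M N) φ .query .answer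
  set x := List.replicate w.length one with hx
  set a := pairArg one w with ha
  set l := M.result φ x with hl
  set v := N.result φ a with hv
  have hxl : x.length = w.length := by simp [hx]
  have e0 : (Prog.initCfg w : Cfg S (TapeIdx (EncWork M N)) (EncSym M N)) =
      encCfg [] w 0 [] 0 [] [] 0 [] := by
    apply encCfg_ext
    · rintro (_ | _ | _ | _ | (_ | _ | _ | _)) <;> simp [Prog.initCfg, encCfg]
    · rintro (_ | _ | _ | _ | (_ | _ | _ | _)) <;> simp [Prog.initCfg, encCfg]
  -- The machine for the lengths needs the argument `1ⁿ` with `n = |w|`, so the input is copied with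
  -- all letters replaced by `one`.
  have s1 := Exec.copyTape (K := K) (fun _ => one) (j := .input) (i := encArg M N) (by simp)
    (encCfg [] w 0 [] 0 [] [] 0 []) [] x
    (fun k _ => by
      have : ((Tape.ofString w : Tape S (EncSym M N)) k).letter.map (fun _ => one) = x[k]? := by
        rw [letter_ofString, hx, List.getElem?_replicate]
        split_ifs with h
        · simp [h]
        · simp [h]
      simpa [encCfg] using this) rfl rfl
  have e1 : (encCfg (M := M) (N := N) [] w 0 [] 0 [] [] 0 []).head .input + (x.length : ℤ) =
      (w.length : ℕ) := by simp [encCfg, hxl]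
  have e2 : (([] : List S).length : ℤ) + (x.length : ℤ) = (x.length : ℕ) := by simp
  rw [e1, e2, encCfg_setTape_arg, encCfg_setHead_input, encCfg_setHead_arg, List.nil_append,
    hxl] at s1
  have s2 := Exec.rewind (K := K) (encArg M N) (encCfg [] w w.length x 0 [] [] 0 []) x rfl hxl.ge
  have e3 : (0 : ℤ) = ((0 : ℕ) : ℤ) := rfl
  rw [e3, encCfg_setHead_arg, encCfg_setHead_arg] at s2
  have s3 := Exec.rewind (K := K) .input (encCfg [] w 0 x 0 [] [] 0 []) w rfl le_rfl
  rw [e3, encCfg_setHead_input, encCfg_setHead_input] at s3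
  obtain ⟨y1, s4⟩ := Exec.call (φ := φ) (lenTape_injective M N) Sum.inl_injective rfl rfl
    (embed_lenTape [] w 0 x []) hM
  have e4 : lenTape M N .out = encLen M N := rfl
  rw [encCfg_setTape_answer, e4, encCfg_setTape_len, ← hl] at s4
  -- Both subroutines read their argument from the same tape.
  have s5 := Exec.eraseString (K := K) (encArg M N) (encCfg y1 w 0 x 0 l [] 0 []) x rfl rfl
  rw [← Tape.ofString_nil, encCfg_setTape_arg, hxl] at s5
  have s6 := exec_argProg (K := K) one y1 w 0 [] l [] 0 []
  rw [List.drop_zero, List.length_nil, zero_add, zero_add, List.nil_append, ← ha] at s6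
  have s7 := Exec.rewind (K := K) (encArg M N) (encCfg y1 w (2 * a.length) a 0 l [] 0 []) a rfl le_rfl
  rw [e3, encCfg_setHead_arg, encCfg_setHead_arg] at s7
  obtain ⟨y2, s8⟩ := Exec.call (φ := φ) (valTape_injective M N) Sum.inr_injective rfl rfl
    (embed_valTape y1 w (2 * a.length) a l []) hN
  have e5 : valTape M N .out = encVal M N := rfl
  rw [encCfg_setTape_answer, e5, encCfg_setTape_val, ← hv] at s8
  have s9 := exec_idxProg (K := K) y2 w (n := 2 * a.length) (k := pairIdx one w)
    (by rw [pairIdx, ← ha]; omega) (by rw [pairIdx, ← ha]; omega) a 0 l v []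
  have s10 := exec_codeProg (K := K) one zero y2 w (2 * a.length + pairIdx one w) a 0 l v
    (pairIdx one w)
  have s11 := Exec.copyTape (K := K) (fun _ => one) (j := encLen M N) (i := .output) (by simp)
    (encCfg y2 w (2 * a.length + pairIdx one w) a 0 l v (pairIdx one w)
      (codeLetter one zero v[pairIdx one w]?)) (codeLetter one zero v[pairIdx one w]?)
    (List.replicate l.length one)
    (fun k _ => by
      have : ((Tape.ofString l : Tape S (EncSym M N)) k).letter.map (fun _ => one) =
          (List.replicate l.length one)[k]? := by
        rw [letter_ofString, List.getElem?_replicate]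
        split_ifs with h
        · simp [h]
        · simp [h]
      simpa [encCfg] using this) rfl rfl
  have h := s1.seq (s2.seq (s3.seq (s4.seq (s5.seq (s6.seq (s7.seq (s8.seq (s9.seq
    (s10.seq s11)))))))))
  rw [← e0] at h
  obtain ⟨h1, h2⟩ := Prog.compile_spec (p := encProg M N one zero) h
  constructor
  · refine h1.trans (Nat.cast_le.2 (Nat.mul_le_mul_left _ ?_))
    have b1 : (M.tapes.length + tM + 1) * (108 * (tM + 2)) ≤
        (M.tapes.length + N.tapes.length + tM + 1) * (108 * (tM + 2)) :=
      Nat.mul_le_mul_right _ (by omega)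
    have b2 : (N.tapes.length + tN + 1) * (108 * (tN + 2)) ≤
        (M.tapes.length + N.tapes.length + tN + 1) * (108 * (tN + 2)) :=
      Nat.mul_le_mul_right _ (by omega)
    have b3 : a.length ≤ w.length := length_pairArg_le one w
    have b4 := pairIdx_le one w
    have b5 : l.length ≤ tM := M.length_result_le hM
    rw [List.length_replicate]
    omega
  · rw [h2]
    simp [monotoneCode, ← hx, ← hl, ← ha, ← hv]

end Encoder

/-! ### Second-order polynomials -/

namespace IsSOP

variable {P Q : (ℕ → ℕ) → ℕ → ℕ}

theorem const (c : ℕ) : IsSOP fun _ _ => c := by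
  simpa using IsSOP.poly (Polynomial.C c)

theorem arg : IsSOP fun _ n => n := by
  simpa using IsSOP.poly Polynomial.X

theorem fn : IsSOP fun l n => l n := arg.app

theorem pow (h : IsSOP P) (k : ℕ) : IsSOP fun l n => P l n ^ k := by
  induction k with
  | zero => simpa using const 1
  | succ k ih => simpa only [pow_succ] using ih.mul h

theorem eval (p : Polynomial ℕ) (h : IsSOP P) : IsSOP fun l n => p.eval (P l n) := by
  induction p using Polynomial.induction_on' with
  | add p q hp hq => simpa only [Polynomial.eval_add] using hp.add hq
  | monomial k a => simpa only [Polynomial.eval_monomial] using (const a).mul (h.pow k)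

theorem comp (hP : IsSOP P) (hQ : IsSOP Q) : IsSOP fun l n => P l (Q l n) := by
  induction hP with
  | poly p => exact hQ.eval p
  | app _ ih => exact ih.app
  | add _ _ ih ih' => exact ih.add ih'
  | mul _ _ ih ih' => exact ih.mul ih'

/-- In a composition the second machine sees a name whose parameter is bounded by `Q l`, so `Q l`
takes the place of the function in its time bound. -/
theorem subst (hP : IsSOP P) (hQ : IsSOP Q) : IsSOP fun l n => P (Q l) n := by
  induction hP with
  | poly p => exact .poly p
  | app _ ih => exact hQ.comp ih
  | add _ _ ih ih' => exact ih.add ih'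
  | mul _ _ ih ih' => exact ih.mul ih'

/-- Only the larger function has to be monotone. It is in this lemma that the monotonicity of
parameters is needed. -/
theorem mono (hP : IsSOP P) {l l' : ℕ → ℕ} (hl' : Monotone l') (hl : ∀ n, l n ≤ l' n) {n n' : ℕ}
    (hn : n ≤ n') : P l n ≤ P l' n' := by
  induction hP with
  | poly p =>
    simp only [Polynomial.eval_eq_sum, Polynomial.sum]
    exact Finset.sum_le_sum fun i _ => Nat.mul_le_mul_left _ (Nat.pow_le_pow_left hn i)
  | app _ ih => exact (hl _).trans (hl' ih)
  | add _ _ ih ih' => exact Nat.add_le_add ih ih'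
  | mul _ _ ih ih' => exact Nat.mul_le_mul ih ih'

end IsSOP

/-! ### Polynomial-time computability -/

section Polytime

variable {S : Type}

theorem OracleMachine.mem_operator {M : OracleMachine S} {φ ψ : Baire S} :
    ψ ∈ M.operator φ ↔ (∀ a, M.time φ a ≠ ⊤) ∧ M.result φ = ψ :=
  ⟨fun ⟨h, e⟩ => ⟨h, e⟩, fun ⟨h, e⟩ => ⟨h, e⟩⟩

/-- A time bound makes the operator defined at `φ` with the only value `M.result φ`, so all
conditions can be stated for one name at a time. -/
theorem polytimeComputable_iff {X Y : PreparametrisedSpace.{u} S} {f : X.carrier → Y.carrier} :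
    PolytimeComputable X Y f ↔ ∃ (M : OracleMachine S) (P Q : (ℕ → ℕ) → ℕ → ℕ),
      IsSOP P ∧ IsSOP Q ∧ ∀ φ : X.rep.Dom,
        (∀ a, M.time φ a ≤ (P (X.param φ) a.length : ℕ)) ∧
        ∃ ψ : Y.rep.Dom, M.result φ = ψ ∧ (∀ x ∈ X.rep φ, f x ∈ Y.rep ψ) ∧
          ∀ n, Y.param ψ n ≤ Q (X.param φ) n := by
  constructor
  · rintro ⟨M, P, Q, hP, hQ, hr, ht, hp⟩
    refine ⟨M, P, Q, hP, hQ, fun φ => ⟨ht φ, ?_⟩⟩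
    obtain ⟨x, hx⟩ := (PFun.mem_dom _ _).1 φ.2
    obtain ⟨ψ, hψ, hxψ⟩ := hr φ x hx
    have hd : ψ ∈ Y.rep.Dom := (PFun.mem_dom _ _).2 ⟨_, hxψ⟩
    refine ⟨⟨ψ, hd⟩, (M.mem_operator.1 hψ).2, fun x' hx' => ?_, hp φ ⟨ψ, hd⟩ hψ⟩
    rw [Part.mem_unique hx' hx]
    exact hxψ
  · rintro ⟨M, P, Q, hP, hQ, h⟩
    refine ⟨M, P, Q, hP, hQ, fun φ x hx => ?_, fun φ => (h φ).1, fun φ ψ hψ => ?_⟩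
    · obtain ⟨ht, ψ, e, hf, -⟩ := h ⟨φ, (PFun.mem_dom _ _).2 ⟨_, hx⟩⟩
      exact ⟨ψ, M.mem_operator.2 ⟨fun a => ne_top_of_le_ne_top (ENat.natCast_ne_top _) (ht a), e⟩,
        hf x hx⟩
    · obtain ⟨-, ψ', e, -, hn⟩ := h φ
      have : ψ = ψ' := Subtype.ext ((M.mem_operator.1 hψ).2.symm.trans e)
      exact this ▸ hn

/-- Let `T` be the time bound of the outer machine on the intermediate name. Its queries have length
at most `T + 2`, so each is answered by the inner machine within `P` at `T + 2`. The bound from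
`exists_comp` is a second-order polynomial in these quantities. -/
theorem PolytimeComputable.comp [Finite S] {X Y Z : PreparametrisedSpace.{u} S}
    {g : Y.carrier → Z.carrier} {f : X.carrier → Y.carrier} (hg : PolytimeComputable Y Z g)
    (hf : PolytimeComputable X Y f) : PolytimeComputable X Z (g ∘ f) := by
  obtain ⟨M, P, Q, hP, hQ, hM⟩ := polytimeComputable_iff.1 hf
  obtain ⟨N, P', Q', hP', hQ', hN⟩ := polytimeComputable_iff.1 hg
  obtain ⟨C, c, hC⟩ := OracleMachine.exists_comp N M
  have k := IsSOP.const
  have hT := hP'.subst hQ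
  have hU := hP.comp (hT.add (k 2))
  refine polytimeComputable_iff.2 ⟨C, _, _, (k 3).mul ((((k c).add hT).add (k 1)).mul
    (((((((k c).add hU).add (k 1)).mul ((k 108).mul (hU.add (k 2)))).add ((k 5).mul hU)).add
      ((k 5).mul (hT.add (k 2)))).add (k 10) |>.add ((k 100).mul (hT.add (k 2))))),
    hQ'.subst hQ, fun φ => ?_⟩
  obtain ⟨hMt, ψ, hψ, hfψ, hpψ⟩ := hM φ
  obtain ⟨hNt, χ, hχ, hgχ, hpχ⟩ := hN ψ
  have hl := X.param_mono φ
  have hQm : Monotone (Q (X.param φ)) := fun _ _ h => hQ.mono hl (fun _ => le_rfl) h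
  have hC' : ∀ a, _ := fun a => hC φ a (P' (Q (X.param φ)) a.length)
    (P (X.param φ) (P' (Q (X.param φ)) a.length + 2))
    (by
      rw [hψ]
      exact (hNt a).trans (Nat.cast_le.2 (hP'.mono hQm hpψ le_rfl)))
    (fun w hw => (hMt w).trans (Nat.cast_le.2 (hP.mono hl (fun _ => le_rfl) hw)))
  refine ⟨fun a => (hC' a).1, χ, ?_, fun x hx => hgχ _ (hfψ x hx),
    fun n => (hpχ n).trans (hQ'.mono hQm hpψ le_rfl)⟩
  funext a
  rw [(hC' a).2, hψ, hχ]

theorem isParametrised_of_param_eq_size [Finite S] {X : PreparametrisedSpace.{u} S}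
    (h : ∀ φ : X.rep.Dom, X.param φ = size φ.1) : X.IsParametrised := by
  obtain ⟨M, hM⟩ := OracleMachine.exists_identity S
  have k := IsSOP.const
  refine polytimeComputable_iff.2 ⟨M, _, _, (k 3).mul ((((k 2).mul .arg).add ((k 2).mul .fn)).add
    (k 3)), .fn, fun φ => ⟨fun a => (hM φ a).1.trans (Nat.cast_le.2 ?_), φ,
    funext fun a => (hM φ a).2, fun x hx => hx, fun n => le_rfl⟩⟩
  have := length_le_size φ.1 (le_refl a.length)
  rw [h]
  omega

theorem size_eq_of_isLengthMonotone [Finite S] {φ : Baire S} (h : IsLengthMonotone φ) (one : S)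
    (n : ℕ) : size φ n = (φ (List.replicate n one)).length :=
  le_antisymm (size_le φ fun a ha => h a _ (by simpa using ha)) (length_le_size φ (by simp))

/-- By `size_eq_of_isLengthMonotone` a name of the space is also a name of its own parameter in
`natFunSpace`. -/
theorem PreparametrisedSpace.IsKawamuraCook.hasPolytimeParameter [Finite S]
    {X : PreparametrisedSpace.{u} S} (h : X.IsKawamuraCook) (one : S) :
    X.HasPolytimeParameter one := by
  obtain ⟨-, hm, hs⟩ := h
  obtain ⟨M, hM⟩ := OracleMachine.exists_identity S
  have k := IsSOP.const
  refine polytimeComputable_iff.2 ⟨M, _, _, (k 3).mul ((((k 2).mul .arg).add ((k 2).mul .fn)).add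
    (k 3)), .fn, fun φ => ⟨fun a => (hM φ a).1.trans (Nat.cast_le.2 ?_), ⟨φ, trivial⟩,
    funext fun a => (hM φ a).2, ?_, fun n => ?_⟩⟩
  · have := length_le_size φ.1 (le_refl a.length)
    have e : X.names.param φ = size φ.1 := hs φ
    rw [e]
    omega
  · rintro x ⟨hx, rfl⟩
    refine Part.mem_some_iff.2 (funext fun n => ?_)
    exact (congrFun (hs φ) n).trans (size_eq_of_isLengthMonotone (hm φ.1 φ.2) one n)
  · exact (congrFun (hs φ) n).ge

theorem PreparametrisedSpace.HasPolytimeParameter.exists_machine [Finite S] {one : S}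
    {X : PreparametrisedSpace.{u} S} (h : X.HasPolytimeParameter one) :
    ∃ (M : OracleMachine S) (P : (ℕ → ℕ) → ℕ → ℕ), IsSOP P ∧ ∀ φ : X.rep.Dom,
      (∀ a, M.time φ a ≤ (P (X.param φ) a.length : ℕ)) ∧
      ∀ n, (M.result φ (List.replicate n one)).length = X.param φ n := by
  obtain ⟨M, P, Q, hP, -, hM⟩ := polytimeComputable_iff.1 h
  refine ⟨M, P, hP, fun φ => ?_⟩
  obtain ⟨ht, ψ, e, hv, -⟩ := hM φ
  refine ⟨ht, fun n => ?_⟩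
  have := Part.mem_some_iff.1 (hv φ ⟨φ.2, rfl⟩)
  rw [this, e]

end Polytime

/-! ### The Kawamura-Cook space of monotone codes -/

section MonotoneSpace

variable {S : Type} (X : PreparametrisedSpace.{u} S) (P Q : (ℕ → ℕ) → ℕ → ℕ)

/-- The function `l` controls the size and the parameter of the name `φ`. -/
def Controls (l : ℕ → ℕ) (φ : X.rep.Dom) : Prop :=
  Monotone l ∧ (∀ a, (φ.1 a).length ≤ P l a.length) ∧ ∀ n, X.param φ n ≤ Q l n

variable {one zero : S}

theorem size_monotoneCode [Finite S] (one zero : S) {l : ℕ → ℕ} (hl : Monotone l) (φ : Baire S) (n : ℕ) :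
    size (monotoneCode one zero l φ) n = l n + 2 := by
  refine le_antisymm (size_le _ fun a ha => ?_) ?_
  · rw [length_monotoneCode]
    exact Nat.add_le_add_right (hl ha) 2
  · have := length_le_size (monotoneCode one zero l φ) (a := List.replicate n one) (n := n) (by simp)
    simpa [length_monotoneCode] using this

variable {X P Q}

theorem Controls.eq_of_monotoneCode (h01 : one ≠ zero) {l l' : ℕ → ℕ} {φ φ' : X.rep.Dom}
    (h : monotoneCode one zero l φ = monotoneCode one zero l' φ') : φ = φ' :=
  Subtype.ext (monotoneCode_injective h01 h)

variable (X P Q)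

/-- The monotone codes of the names of `X`, as a representation. -/
noncomputable def monotoneRep (one zero : S) : Baire S →. X.carrier := fun χ =>
  ⟨∃ φ : X.rep.Dom, ∃ l, Controls X P Q l φ ∧ χ = monotoneCode one zero l φ,
    fun h => (X.rep h.choose.1).get h.choose.2⟩

variable {X P Q}

/-- The choice in `monotoneRep` is harmless: a code determines the coded name, and the point does
not depend on the padding. -/
theorem mem_monotoneRep (h01 : one ≠ zero) {χ : Baire S} {x : X.carrier} :
    x ∈ monotoneRep X P Q one zero χ ↔ ∃ φ : X.rep.Dom, ∃ l, Controls X P Q l φ ∧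
      χ = monotoneCode one zero l φ ∧ x ∈ X.rep φ := by
  constructor
  · rintro ⟨h, rfl⟩
    obtain ⟨l, hl, e⟩ := h.choose_spec
    exact ⟨_, l, hl, e, Part.get_mem _⟩
  · rintro ⟨φ, l, hl, e, hx⟩
    have h : (monotoneRep X P Q one zero χ).Dom := ⟨φ, l, hl, e⟩
    obtain ⟨l', -, e'⟩ := h.choose_spec
    have : h.choose = φ := Controls.eq_of_monotoneCode h01 (e'.symm.trans e)
    exact ⟨h, Part.mem_unique (Part.get_mem h.choose.2) (this.symm ▸ hx)⟩

variable [Finite S]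

/-- The names of the elements of `X` in this space are the monotone codes of their names in `X`,
padded by a function that controls the name. -/
noncomputable def monotoneSpace (h01 : one ≠ zero)
    (h : ∀ x, ∃ φ l, Controls X P Q l φ ∧ x ∈ X.rep φ) : PreparametrisedSpace.{u} S where
  carrier := X.carrier
  rep := monotoneRep X P Q one zero
  rep_surjective x := by
    obtain ⟨φ, l, hl, hx⟩ := h x
    exact ⟨_, (mem_monotoneRep h01).2 ⟨φ, l, hl, rfl, hx⟩⟩
  param χ := size χ.1
  param_mono χ := size_mono χ.1

variable (h01 : one ≠ zero) (h : ∀ x, ∃ φ l, Controls X P Q l φ ∧ x ∈ X.rep φ)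

theorem isKawamuraCook_monotoneSpace : (monotoneSpace h01 h).IsKawamuraCook := by
  refine ⟨isParametrised_of_param_eq_size fun _ => rfl, ?_, fun _ => rfl⟩
  rintro _ ⟨φ, l, hl, rfl⟩ a b hab
  rw [length_monotoneCode, length_monotoneCode]
  exact Nat.add_le_add_right (hl.1 hab) 2

/-- The decoder needs time linear in `|a|` and `|φ(a)|`. The latter is at most `P l |a|` by control,
and `l` is below the size of the code; the parameter is bounded through `Q` in the same way. -/
theorem polytimeComputable_of_monotoneSpace (hP : IsSOP P) (hQ : IsSOP Q) :
    PolytimeComputable (monotoneSpace h01 h) X id := by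
  obtain ⟨M, hM⟩ := OracleMachine.exists_decoder h01
  have k := IsSOP.const
  refine polytimeComputable_iff.2 ⟨M, _, Q, (k 3).mul ((((k 3).mul .arg).add ((k 5).mul hP)).add
    (k 4)), hQ, ?_⟩
  rintro ⟨_, φ, l, hl, rfl⟩
  have hle : ∀ n, l n ≤ size (monotoneCode one zero l φ) n := fun n => by
    rw [size_monotoneCode one zero hl.1]
    exact Nat.le_add_right _ _
  have hm := size_mono (monotoneCode one zero l φ)
  have key := fun a => hM (monotoneCode one zero l φ) a (φ.1 a)
    (fun k hk => by
      rw [monotoneCode_pairCode h01, List.getElem?_eq_getElem hk]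
      exact ⟨_, rfl⟩)
    (by
      rw [monotoneCode_pairCode h01, List.getElem?_eq_none le_rfl]
      exact ⟨_, rfl⟩)
  refine ⟨fun a => (key a).1.trans (Nat.cast_le.2 ?_), φ, funext fun a => (key a).2, ?_, ?_⟩
  · have h1 : (φ.1 a).length ≤ P (size (monotoneCode one zero l φ)) a.length :=
      (hl.2.1 a).trans (hP.mono hm hle le_rfl)
    change _ ≤ 3 * (3 * a.length + 5 * P (size (monotoneCode one zero l φ)) a.length + 4)
    omega
  · intro x hx
    obtain ⟨φ', l', -, e, hx'⟩ := (mem_monotoneRep h01).1 hx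
    rwa [Controls.eq_of_monotoneCode h01 e]
  · exact fun n => (hl.2.2 n).trans (hQ.mono hm hle le_rfl)

end MonotoneSpace

/-! ### From a polytime computable parameter to a Kawamura-Cook space. -/

theorem PreparametrisedSpace.PolytimeIsomorphic.exists_isKawamuraCook {S : Type} [Finite S]
    [Nontrivial S] {one : S} {X Z : PreparametrisedSpace.{u} S} (h : X.PolytimeIsomorphic Z)
    (hZ : Z.HasPolytimeParameter one) :
    ∃ Y : PreparametrisedSpace.{u} S, Y.IsKawamuraCook ∧ X.PolytimeIsomorphic Y := by
  obtain ⟨zero, h01⟩ := exists_ne one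
  replace h01 := h01.symm
  obtain ⟨e, he, he'⟩ := h
  obtain ⟨N, P, Q, hP, hQ, hN⟩ := polytimeComputable_iff.1 he'
  obtain ⟨M, R, hR, hM⟩ := hZ.exists_machine
  -- The parameter of `ψ` controls the name that `N` computes from it; the bound on the values comes
  -- from the running time of `N`.
  have hc : ∀ ψ : Z.rep.Dom, ∃ φ : X.rep.Dom, N.result ψ = φ ∧
      (∀ z ∈ Z.rep ψ, e.symm z ∈ X.rep φ) ∧ Controls X P Q (Z.param ψ) φ := fun ψ => by
    obtain ⟨ht, φ, hφ, hv, hp⟩ := hN ψ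
    exact ⟨φ, hφ, hv, Z.param_mono ψ, fun a => hφ ▸ N.length_result_le (ht a), hp⟩
  -- A name of `X` need not be controlled by any function, but each point has a controlled one,
  -- produced by `N` from a name of its image in `Z`.
  have hs : ∀ x, ∃ φ l, Controls X P Q l φ ∧ x ∈ X.rep φ := fun x => by
    obtain ⟨ψ, hψ⟩ := Z.rep_surjective (e x)
    obtain ⟨φ, -, hv, hl⟩ := hc ⟨ψ, (PFun.mem_dom _ _).2 ⟨_, hψ⟩⟩
    exact ⟨φ, _, hl, by simpa using hv _ hψ⟩
  -- Here the computability of the parameter enters: the encoder has to write padding of length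
  -- `Z.param ψ n`. The blowup `l n + 2` is the size of the resulting code.
  have henc : PolytimeComputable Z (monotoneSpace h01 hs) e.symm := by
    obtain ⟨E, c, hE⟩ := OracleMachine.exists_encoder M N one zero
    have k := IsSOP.const
    refine polytimeComputable_iff.2 ⟨E, _, fun l n => l n + 2, (k 3).mul
      (((((((k c).add hR).add (k 1)).mul ((k 108).mul (hR.add (k 2)))).add
        ((((k c).add hP).add (k 1)).mul ((k 108).mul (hP.add (k 2))))).add ((k 20).mul .arg)).add
        ((k 2).mul hR) |>.add (k 25)), IsSOP.fn.add (k 2), fun ψ => ?_⟩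
    obtain ⟨φ, hφ, hv, hl⟩ := hc ψ
    have key := fun a : List S => hE ψ a (R (Z.param ψ) a.length) (P (Z.param ψ) a.length)
      (by simpa using (hM ψ).1 (List.replicate a.length one))
      (((hN ψ).1 _).trans (Nat.cast_le.2
        (hP.mono (Z.param_mono ψ) (fun _ => le_rfl) (length_pairArg_le one a))))
    have hr : E.result ψ = monotoneCode one zero (Z.param ψ) φ := by
      funext a
      rw [(key a).2, hφ]
      congr 1
      exact funext (hM ψ).2
    refine ⟨fun a => (key a).1, ⟨_, φ, _, hl, rfl⟩, hr,
      fun z hz => (mem_monotoneRep h01).2 ⟨φ, _, hl, rfl, hv z hz⟩,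
      fun n => (size_monotoneCode one zero hl.1 φ.1 n).le⟩
  -- The new space has the points of `X`, and the isomorphism is the identity. Towards the new space
  -- it is factored through `Z` as `e.symm ∘ e`.
  refine ⟨monotoneSpace h01 hs, isKawamuraCook_monotoneSpace h01 hs, Equiv.refl _, ?_,
    polytimeComputable_of_monotoneSpace h01 hs hP hQ⟩
  convert henc.comp he using 1
  exact (funext e.symm_apply_apply).symm

end SecondOrder

theorem mainTheorem7 {S : Type} [Finite S] [Nontrivial S] (one : S)
    (X : SecondOrder.PreparametrisedSpace.{u} S) (hX : X.IsParametrised) :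
    (∃ Y : SecondOrder.PreparametrisedSpace.{u} S,
        Y.IsKawamuraCook ∧ X.PolytimeIsomorphic Y) ↔
      ∃ Y : SecondOrder.PreparametrisedSpace.{u} S,
        Y.IsParametrised ∧ Y.HasPolytimeParameter one ∧ X.PolytimeIsomorphic Y := by
  constructor
  · rintro ⟨Y, hY, h⟩
    exact ⟨Y, hY.1, hY.hasPolytimeParameter one, h⟩
  · rintro ⟨Z, -, hZ, h⟩
    exact h.exists_isKawamuraCook hZ
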